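/- **Notation.** $\mathrm{Ber}(p)$ is the law of a bit that equals $1$ with probability $p$. For a distribution $\mathcal D$ on $\mathbb F_2^n$, an instance of Search-LPN with row distribution $\mathcal D$, noise rate $\eta$, dimension $n$ and $m$ samples is $(A, b=As+e)$, where $s\in\mathbb F_2^n$ is uniform, the $m$ rows of $A$ are independent samples from $\mathcal D$, and $e\sim\mathrm{Ber}(\eta)^m$. A (randomized) solver or oracle succeeds with probability $\alpha$ if it outputs $s$ on input $(A,b)$ with probability at least $\alpha$, over the instance and its own randomness. $\mathrm{LPN}^{=\sigma}_{\eta,n,m}$ is the case where $\mathcal D$ is uniform on the vectors of Hamming weight exactly $\sigma$, and $\mathrm{LPN}^{\approx\sigma}_{\eta,n,m}$ the case where $\mathcal D=\mathrm{Ber}(\sigma/n)^n$. **Theorem.** There is a probabilistic oracle program $R$ and a polynomial $p$ such that the following holds. Let $m,n,k,\sigma$ be positive integers with $\sigma\le n$ and $$m\ \ge\ \max\!\Big(\frac{48\,n^3}{\sigma^2},\ 1200\,n\Big),\qquad M=\lceil 3\sqrt{\sigma}\,m\rceil .$$ Let $\varepsilon>0$, $\delta>6\cdot 2^{-(2n-1)}$,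 $\eta\in(0,1/8)$, and suppose that $$\frac{192}{\delta}\,\ln\!\Big(\frac{16}{\varepsilon}\Big)\ <\ k\ <\ 2^{2n-2}\,\varepsilon .$$ Then $R$, given an instance of $\mathrm{LPN}^{\approx\sigma}_{\eta,n,M}$ and the numbers $n,m,k,\sigma,M,\lceil1/\delta\rceil,\lceil1/\varepsilon\rceil$, always halts within $p(n,m,k,1/\delta,1/\varepsilon)$ steps, whatever the oracle; and with any (possibly randomized) oracle that solves $$\mathrm{LPN}^{=k\sigma}_{\frac{1-(1-2\eta)^k}{2},\,kn,\,m}$$ with success probability at least $\varepsilon$, it solves $\mathrm{LPN}^{\approx\sigma}_{\eta,n,M}$ with success probability at least $1-\delta$. Here a program runs on a random access machine over the natural numbers with addition, truncated subtraction, tests for zero, and memory cells addressed by two registers; it may draw uniform elements of $\{0,\dots,r\}$ for a register $r$, draw samples of $\mathrm{Ber}(\eta)$, and query the oracle, with independent randomness each time, and each step has cost $1$. -/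

import Mathlib

open scoped ENNReal Matrix

noncomputable section

namespace SparseLPN

/-! ### Distributions -/

/-- The Bernoulli distribution on `𝔽₂`: the value is `1` with probability `p`.
(The parameter is clamped to `[0, 1]`, so that the definition makes sense for every real `p`.) -/
def ber (p : ℝ) : PMF (ZMod 2) :=
  PMF.ofFintype
    (fun x => if x = 0 then 1 - ENNReal.ofReal (min p 1) else ENNReal.ofReal (min p 1))
    (by
      have h : (Finset.univ : Finset (ZMod 2)) = {0, 1} := by decide
      have h1 : ENNReal.ofReal (min p 1) ≤ 1 := by
        rw [ENNReal.ofReal_le_one]; exact min_le_right _ _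
      rw [h, Finset.sum_pair (by decide)]
      simp only [if_true, one_ne_zero, if_false]
      exact tsub_add_cancel_of_le h1)

/-- The joint law of independent draws from `p`, one for each element of `ι`. -/
def iid (ι : Type) [Fintype ι] [DecidableEq ι] {α : Type} [Fintype α] (p : PMF α) :
    PMF (ι → α) :=
  PMF.ofFintype (fun f => ∏ i, p (f i))
    (by
      have h : ∑ a, p a = 1 := by
        have hp := p.tsum_coe
        rwa [tsum_fintype] at hp
      have := (Finset.prod_univ_sum (fun _ : ι => (Finset.univ : Finset α))
        (fun _ a => p a)).symm
      rw [Fintype.piFinset_univ] at this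
      rw [this, h, Finset.prod_const_one])

/-- The set of vectors in `𝔽₂ⁿ` of Hamming weight exactly `σ`. -/
def weightSet (n σ : ℕ) : Finset (Fin n → ZMod 2) :=
  Finset.univ.filter fun a => hammingNorm a = σ

theorem weightSet_nonempty {n σ : ℕ} (h : σ ≤ n) : (weightSet n σ).Nonempty := by
  obtain ⟨t, -, ht⟩ := Finset.exists_subset_card_eq (s := (Finset.univ : Finset (Fin n)))
    (n := σ) (by simpa using h)
  refine ⟨fun i => if i ∈ t then 1 else 0, ?_⟩
  simp [weightSet, hammingNorm, ht]

/-- Row distribution of the exact-sparse variant: uniform over the vectors of weight `σ`. -/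
def exactRow (n σ : ℕ) (h : σ ≤ n) : PMF (Fin n → ZMod 2) :=
  PMF.uniformOfFinset (weightSet n σ) (weightSet_nonempty h)

/-- Row distribution of the approximate-sparse variant: independent `Ber(σ/n)` coordinates. -/
def approxRow (n σ : ℕ) : PMF (Fin n → ZMod 2) :=
  iid (Fin n) (ber ((σ : ℝ) / n))

/-! ### Search-LPN -/

/-- A (randomised) solver: from `(A, b)` it produces a random guess for the secret. -/
abbrev Solver (m n : ℕ) : Type :=
  Matrix (Fin m) (Fin n) (ZMod 2) → (Fin m → ZMod 2) → PMF (Fin n → ZMod 2)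

/-- The joint law of (secret, guess) when `S` is run on a random instance `(A, A s + e)`:
uniform secret `s`, the `m` rows of `A` independent from `row`, noise `e` from `Ber(η)^m`. -/
def searchExperiment {m n : ℕ} (row : PMF (Fin n → ZMod 2)) (η : ℝ) (S : Solver m n) :
    PMF ((Fin n → ZMod 2) × (Fin n → ZMod 2)) :=
  (PMF.uniformOfFintype (Fin n → ZMod 2)).bind fun s =>
    (iid (Fin m) row).bind fun A =>
      (iid (Fin m) (ber η)).bind fun e =>
        (S (Matrix.of A) (Matrix.of A *ᵥ s + e)).map fun g => (s, g)

/-- The success probability of `S`: the probability that the guess is the secret. -/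
def successProb {m n : ℕ} (row : PMF (Fin n → ZMod 2)) (η : ℝ) (S : Solver m n) : ℝ :=
  ((searchExperiment row η S).toOuterMeasure {p | p.2 = p.1}).toReal

/-! ### Probabilistic oracle programs with a step count

A random access machine over the natural numbers. It has registers `reg x`, and memory cells
`arr a i j` (array number `a`, row `i`, column `j`) that are addressed through registers.
Additions, subtractions and tests are the only arithmetic. Every step costs `1`. -/

/-- The store of the machine. -/
structure Store where
  reg : ℕ → ℕ
  arr : ℕ → ℕ → ℕ → ℕ

/-- Assign the value `v` to register `x`. -/
def Store.setReg (st : Store) (x v : ℕ) : Store :=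
  { st with reg := fun y => if y = x then v else st.reg y }

/-- Assign the value `v` to the memory cell `(a, i, j)`. -/
def Store.setCell (st : Store) (a i j v : ℕ) : Store :=
  { st with arr := fun a' i' j' =>
      if a' = a ∧ i' = i ∧ j' = j then v else st.arr a' i' j' }

/-- Elementary instructions; all operands `x y z i j` are names of registers, while `v` is a
constant and `a` the number of an array. -/
inductive Instr : Type
  /-- `x := v` -/
  | const (x v : ℕ)
  /-- `x := y + z` -/
  | add (x y z : ℕ)
  /-- `x := max (y - z) 0` -/
  | sub (x y z : ℕ)
  /-- `x := arr a i j` -/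
  | load (x a i j : ℕ)
  /-- `arr a i j := x` -/
  | store (a i j x : ℕ)
  /-- `x :=` a uniformly random element of `{0, …, y}` -/
  | rand (x y : ℕ)
  /-- `x :=` a fresh sample of the noise distribution, as a bit -/
  | noise (x : ℕ)
  /-- call the oracle on the matrix in array `2` and the vector in column `0` of array `3`;
  the answer is written to column `0` of array `4` -/
  | query

/-- Structured programs over these instructions; a register counts as true if it is nonzero. -/
inductive Prog : Type
  | instr (c : Instr)
  | seq (p q : Prog)
  | ite (x : ℕ) (p q : Prog)
  | while (x : ℕ) (p : Prog)

/-- What an oracle call does on raw memory: from a matrix and a vector to a random vector. -/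
abbrev RawOracle : Type := (ℕ → ℕ → ℕ) → (ℕ → ℕ) → PMF (ℕ → ℕ)

/-- Effect of one instruction, where `ν` is the noise distribution and `orc` the oracle.
Different samples and different oracle calls use independent randomness. -/
def Instr.exec (ν : PMF (ZMod 2)) (orc : RawOracle) (st : Store) : Instr → PMF Store
  | .const x v => PMF.pure (st.setReg x v)
  | .add x y z => PMF.pure (st.setReg x (st.reg y + st.reg z))
  | .sub x y z => PMF.pure (st.setReg x (st.reg y - st.reg z))
  | .load x a i j => PMF.pure (st.setReg x (st.arr a (st.reg i) (st.reg j)))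
  | .store a i j x => PMF.pure (st.setCell a (st.reg i) (st.reg j) (st.reg x))
  | .rand x y =>
      (PMF.uniformOfFinset (Finset.range (st.reg y + 1)) Finset.nonempty_range_add_one).map
        fun v => st.setReg x v
  | .noise x => ν.map fun e => st.setReg x e.val
  | .query =>
      (orc (st.arr 2) (fun i => st.arr 3 i 0)).map fun ans =>
        { st with arr := fun a i j => if a = 4 ∧ j = 0 then ans i else st.arr a i j }

/-- A configuration: the stack of programs still to be executed, and the store. -/
abbrev Config : Type := List Prog × Store

/-- One step of the machine. A configuration with an empty stack has halted and stays put. -/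
def step (ν : PMF (ZMod 2)) (orc : RawOracle) : Config → PMF Config
  | ([], st) => PMF.pure ([], st)
  | (.instr c :: K, st) => (c.exec ν orc st).map fun st' => (K, st')
  | (.seq p q :: K, st) => PMF.pure (p :: q :: K, st)
  | (.ite x p q :: K, st) => PMF.pure ((if st.reg x ≠ 0 then p else q) :: K, st)
  | (.while x p :: K, st) =>
      PMF.pure (if st.reg x ≠ 0 then p :: .while x p :: K else K, st)

/-- The law of the configuration after `T` steps. -/
def run (ν : PMF (ZMod 2)) (orc : RawOracle) : ℕ → Config → PMF Config
  | 0, c => PMF.pure c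
  | T + 1, c => (step ν orc c).bind (run ν orc T)

/-! ### Programs as reductions between LPN problems -/

/-- The solver `O` seen as an oracle on raw memory: entries are read modulo `2`. -/
def rawOracle {m d : ℕ} (O : Solver m d) : RawOracle := fun A b =>
  (O (Matrix.of fun i j => (A i j : ZMod 2)) (fun i => (b i : ZMod 2))).map fun s i =>
    if h : i < d then (s ⟨i, h⟩).val else 0

/-- The initial store on an instance `(A, b)` with `M` samples in dimension `n`. Register `x` holds
the `x`-th entry of `params`, array `0` holds `A`, column `0` of array `1` holds `b`, and everything
else is `0`. -/
def startStore {M n : ℕ} (params : List ℕ) (A : Matrix (Fin M) (Fin n) (ZMod 2))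
    (b : Fin M → ZMod 2) : Store where
  reg x := params.getD x 0
  arr a i j :=
    if a = 0 then (if h : i < M ∧ j < n then (A ⟨i, h.1⟩ ⟨j, h.2⟩).val else 0)
    else if a = 1 then (if h : i < M ∧ j = 0 then (b ⟨i, h.1⟩).val else 0)
    else 0

/-- The vector in `𝔽₂ⁿ` that is read off, modulo `2`, from column `0` of array `5`. -/
def readOutput (n : ℕ) (c : Config) : Fin n → ZMod 2 :=
  fun j => (c.2.arr 5 j 0 : ZMod 2)

/-- The law of the final configuration of the program `P` after `T` steps on the instance `(A, b)`,
when `P` may sample from `Ber(η)` and query the oracle `O`. -/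
def runOn {M n m d : ℕ} (P : Prog) (params : List ℕ) (η : ℝ) (O : Solver m d) (T : ℕ)
    (A : Matrix (Fin M) (Fin n) (ZMod 2)) (b : Fin M → ZMod 2) : PMF Config :=
  run (ber η) (rawOracle O) T ([P], startStore params A b)

/-- The program `P` halts within `T` steps on every instance and for all outcomes of its coins and
of the oracle. -/
def HaltsWithin (P : Prog) (params : List ℕ) (M n : ℕ) {m d : ℕ} (η : ℝ) (O : Solver m d)
    (T : ℕ) : Prop :=
  ∀ (A : Matrix (Fin M) (Fin n) (ZMod 2)) (b : Fin M → ZMod 2),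
    ∀ c ∈ (runOn P params η O T A b).support, c.1 = []

/-- The solver that is obtained by running the program `P` with oracle `O` for `T` steps. -/
def programSolver (P : Prog) (params : List ℕ) (M n : ℕ) {m d : ℕ} (η : ℝ) (O : Solver m d)
    (T : ℕ) : Solver M n :=
  fun A b => (runOn P params η O T A b).map (readOutput n)

end SparseLPN

end

noncomputable section

namespace SparseLPN

/-! ### A Hölder inequality for block functions on a homogeneous space -/

/-! The program plants its instance in one random block of an oracle query. A row of the query is a
uniform vector of weight `kσ` in dimension `kn`, and each of its `k` blocks of length `n` looks like
a `Ber(σ/n)` vector. Rejection sampling turns the latter law into the former exactly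
(`approxRow_mul_acceptLaw`), with acceptance probability at least `1/(e√σ)` (`le_acceptProb`); this
is why about `3√σ m` samples yield `m` rows. The other `k - 1` blocks are completed at random
(`blockRow_bind_completeRow`), the labels are shifted by the inner products with a random secret
outside the planted block, and `k - 1` further noise bits are added to each label, so that the bias
of the noise becomes `(1 - 2η)^k`. A correct answer of the oracle contains the secret in the planted
block. Trials are repeated, and the candidate closest to the labels is kept.

Repetition helps only if a trial succeeds with probability of order `ε` on almost every instance,
not merely on average. This is a direct product argument (`hardProb_le`). Suppose that the instances
on which a trial succeeds with probability below `ε/32` have mass `μ > δ/2`. Their indicator is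
pushed forward to a weight `φ` with values in `[0, 1]` on a block of a query, that is, on its
secret, rows and noise (`exists_blockWeight`). Over a query, the sum of `φ` over the `k` blocks is
small only with probability exponentially small in `kμ`. Where it is large, the success of the
oracle is charged to hard blocks, and there it is small. Since `kδ` is large compared with
`log(16/ε)`, the two contributions together stay below `ε` (`le_exp_mul_add`, `direct_product`).

The exponential bound needs a substitute for independence, because the blocks of a row of fixed
weight are dependent. It is the Hölder type inequality `E ∏ F_j ≤ ∏ (E F_j²)^(1/2)` for functions of
single blocks, used in the form `block_holder`. The uniform law on matrices with rows of fixed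
weight is invariant under transpositions of two coordinates of one row, and a transposition touches
at most two blocks. By the inequality between the arithmetic and the geometric mean, averaging over
transpositions therefore does not decrease `E ∏ √g_j` to first order, and the extremal case is that
of constant functions (`block_holder_normalized`).

The secret must also be the unique best candidate, which follows from exponential moments and a
union bound (`Ex_exists_closer_le`). To bring this error below a multiple of `δ`, the oracle is used
once more: there are only `2^m` label vectors, so success probability `ε` forces `kn ≤ 2n + m`
(`successProb_le_pow`), and `k` is at least `480/δ`. The same counting excludes `σ = n`, where all
rows coincide.

The machine enters only through couplings: `SpecL` matches the final store of a program with a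
sample of an explicit law and bounds the number of steps, and it composes along the program. -/

theorem two_mul_prod_sqrt_sub_one_le {J : Type} [Fintype J] [DecidableEq J] (r : J → ℝ)
    (hr : ∀ j, 0 ≤ r j) (a b : J) (h : ∀ j, j ≠ a → j ≠ b → r j = 1) :
    2 * (∏ j, √(r j) - 1) ≤ ∑ j, (r j - 1) := by
  have hs : ∀ t : Finset J, (∀ j, j ∉ t → r j = 1) →
      (∏ j, √(r j) = ∏ j ∈ t, √(r j)) ∧ (∑ j, (r j - 1) = ∑ j ∈ t, (r j - 1)) := by
    intro t ht
    constructor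
    · symm
      apply Finset.prod_subset (Finset.subset_univ _)
      intro j _ hj
      rw [ht j hj, Real.sqrt_one]
    · symm
      apply Finset.sum_subset (Finset.subset_univ _)
      intro j _ hj
      rw [ht j hj, sub_self]
  -- At most two factors move, so the claim is `2(√(r_a r_b) - 1) ≤ r_a + r_b - 2`, the inequality
  -- of the arithmetic and geometric means. It would fail for three moving factors.
  by_cases hab : a = b
  · subst hab
    obtain ⟨h1, h2⟩ := hs {a} (fun j hj => h j (by simpa using hj) (by simpa using hj))
    rw [h1, h2, Finset.prod_singleton, Finset.sum_singleton]
    nlinarith [Real.sq_sqrt (hr a), sq_nonneg (√(r a) - 1)]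
  · obtain ⟨h1, h2⟩ := hs {a, b} (fun j hj => by
      simp only [Finset.mem_insert, Finset.mem_singleton, not_or] at hj
      exact h j hj.1 hj.2)
    rw [h1, h2, Finset.prod_pair hab, Finset.sum_pair hab]
    nlinarith [Real.sq_sqrt (hr a), Real.sq_sqrt (hr b), sq_nonneg (√(r a) - √(r b))]

theorem deriv_nonpos_of_right_max {f : ℝ → ℝ} {f' h₀ : ℝ} (hf : HasDerivAt f f' 0) (h0 : 0 < h₀)
    (hmax : ∀ h, 0 ≤ h → h ≤ h₀ → f h ≤ f 0) : f' ≤ 0 := by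
  have h1 := (hasDerivAt_iff_tendsto_slope.1 hf).mono_left
    (nhdsWithin_mono (0 : ℝ) (s := Set.Ioi 0) (fun x (hx : 0 < x) => ne_of_gt hx))
  refine le_of_tendsto h1 ?_
  filter_upwards [Ioc_mem_nhdsGT h0] with x hx
  rw [slope_def_field]
  exact div_nonpos_of_nonpos_of_nonneg (by linarith [hmax x hx.1.le hx.2]) (by linarith [hx.1])

section BlockHolder

variable {Ω X J : Type} [Fintype Ω] [Fintype X] [Fintype J] [DecidableEq J]

/-- The sum is twice the derivative of `∑ ∏ √g_j` in the direction `g ∘ t - g`. By the preceding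
inequality for the ratios `g_j(t ω) / g_j(ω)`, it is at least twice the change of `∑ ∏ √g_j` under
`t`, which is zero because `t` permutes the points. -/
theorem sum_prod_sqrt_deriv_nonneg (t : Equiv.Perm Ω) (a b : J) (g : J → Ω → ℝ)
    (hpos : ∀ j ω, 0 < g j ω) (hinv : ∀ j, j ≠ a → j ≠ b → ∀ ω, g j (t ω) = g j ω) :
    0 ≤ ∑ ω, (∏ j, √(g j ω)) * ∑ j, (g j (t ω) - g j ω) / g j ω := by
  have h1 : ∀ ω, 2 * (∏ j, √(g j (t ω)) - ∏ j, √(g j ω)) ≤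
      (∏ j, √(g j ω)) * ∑ j, (g j (t ω) - g j ω) / g j ω := by
    intro ω
    have h2 := two_mul_prod_sqrt_sub_one_le (fun j => g j (t ω) / g j ω)
      (fun j => (div_pos (hpos _ _) (hpos _ _)).le) a b
      (fun j ha hb => by rw [hinv j ha hb, div_self (hpos _ _).ne'])
    have h3 : ∏ j, √(g j (t ω)) = (∏ j, √(g j ω)) * ∏ j, √(g j (t ω) / g j ω) := by
      rw [← Finset.prod_mul_distrib]
      refine Finset.prod_congr rfl fun j _ => ?_
      rw [← Real.sqrt_mul (hpos _ _).le, mul_div_cancel₀ _ (hpos _ _).ne']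
    have h4 : ∀ j, (g j (t ω) - g j ω) / g j ω = g j (t ω) / g j ω - 1 := fun j => by
      rw [sub_div, div_self (hpos _ _).ne']
    have h5 : 0 ≤ ∏ j, √(g j ω) := Finset.prod_nonneg fun j _ => Real.sqrt_nonneg _
    simp only [h4]
    rw [h3]
    nlinarith [mul_le_mul_of_nonneg_left h2 h5]
  refine le_trans (le_of_eq ?_) (Finset.sum_le_sum fun ω _ => h1 ω)
  rw [← Finset.mul_sum, Finset.sum_sub_distrib, Equiv.sum_comp t (fun ω => ∏ j, √(g j ω)),
    sub_self, mul_zero]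

/-- `f` and `f ∘ t` have the same sum of squares. Hence a quadratic penalty decreases strictly along
the averaging flow unless `f` is invariant. -/
theorem sum_mul_sub_comp_perm (t : Equiv.Perm Ω) (f : Ω → ℝ) :
    ∑ ω, f ω * (f (t ω) - f ω) = -(1 / 2) * ∑ ω, (f (t ω) - f ω) ^ 2 := by
  have h := Equiv.sum_comp t (fun ω => f ω ^ 2)
  have h2 : ∑ ω, (f (t ω) - f ω) ^ 2 =
      ∑ ω, f (t ω) ^ 2 - ∑ ω, f ω ^ 2 - 2 * ∑ ω, f ω * (f (t ω) - f ω) := by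
    rw [Finset.mul_sum, ← Finset.sum_sub_distrib, ← Finset.sum_sub_distrib]
    exact Finset.sum_congr rfl fun ω _ => by ring
  rw [h2, h]; ring

/-- Moving each `g_j` along the Laplacian `∑ x, (g_j ∘ τ x - g_j)` respects the constraints, and to
first order it does not decrease the objective, since a generator touches at most two of the
functions. A maximiser of the objective with a small quadratic penalty must then be fixed by all
generators, hence constant. The hypothesis `hconj` makes the Laplacian of `g_j` inherit the
invariances of `g_j`. -/
theorem block_holder_normalized [Nonempty Ω] (τ : X → Equiv.Perm Ω) (touch : X → J → Prop)
    (h2 : ∀ x, ∃ a b, ∀ j, touch x j → j = a ∨ j = b)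
    (hconj : ∀ x j, ¬ touch x j → ∃ e : Equiv.Perm X, ∀ y ω, τ y (τ x ω) = τ x (τ (e y) ω))
    (htrans : ∀ f : Ω → ℝ, (∀ x ω, f (τ x ω) = f ω) → ∃ c, ∀ ω, f ω = c)
    (g : J → Ω → ℝ) {c : ℝ} (hc : 0 < c) (hg : ∀ j ω, c ≤ g j ω)
    (hsum : ∀ j, ∑ ω, g j ω = Fintype.card Ω)
    (hinv : ∀ j x, ¬ touch x j → ∀ ω, g j (τ x ω) = g j ω) :
    ∑ ω, ∏ j, √(g j ω) ≤ Fintype.card Ω := by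
  set N : ℝ := ((Fintype.card Ω : ℕ) : ℝ) with hN
  have hNpos : 0 < N := by rw [hN]; exact_mod_cast Fintype.card_pos
  -- The lower bound `c` keeps the square roots differentiable, and together with the fixed sum it
  -- bounds every entry by `N`, so that `K` is compact.
  let K : Set (J → Ω → ℝ) := {g | (∀ j ω, c ≤ g j ω) ∧ (∀ j, ∑ ω, g j ω = N) ∧
    (∀ j x, ¬ touch x j → ∀ ω, g j (τ x ω) = g j ω)}
  have hKc : IsCompact K := by
    refine IsCompact.of_isClosed_subset
      (isCompact_Icc (a := fun (_ : J) (_ : Ω) => c) (b := fun (_ : J) (_ : Ω) => N)) ?_ ?_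
    · refine IsClosed.inter ?_ (IsClosed.inter ?_ ?_)
      · change IsClosed {g : J → Ω → ℝ | ∀ j ω, c ≤ g j ω}
        simp only [Set.ofPred_forall]
        exact isClosed_iInter fun j => isClosed_iInter fun ω =>
          isClosed_le continuous_const (by fun_prop)
      · change IsClosed {g : J → Ω → ℝ | ∀ j, ∑ ω, g j ω = N}
        simp only [Set.ofPred_forall]
        exact isClosed_iInter fun j => isClosed_eq (by fun_prop) continuous_const
      · change IsClosed {g : J → Ω → ℝ | ∀ j x, ¬ touch x j → ∀ ω, g j (τ x ω) = g j ω}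
        simp only [Set.ofPred_forall]
        exact isClosed_iInter fun j => isClosed_iInter fun x => isClosed_iInter fun _ =>
          isClosed_iInter fun ω => isClosed_eq (by fun_prop) (by fun_prop)
    · intro g hg
      refine ⟨fun j ω => hg.1 j ω, fun j ω => ?_⟩
      rw [← hg.2.1 j]
      exact Finset.single_le_sum (f := g j) (fun ω _ => hc.le.trans (hg.1 j ω)) (Finset.mem_univ ω)
  have hKg : g ∈ K := ⟨hg, hsum, hinv⟩
  -- Without the penalty, maximality would only make the first derivative vanish; the penalty forces
  -- the maximiser to be invariant.
  have main : ∀ θ : ℝ, 0 < θ → ∑ ω, ∏ j, √(g j ω) - θ * ∑ j, ∑ ω, g j ω ^ 2 ≤ N := by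
    intro θ hθ
    let F : (J → Ω → ℝ) → ℝ := fun g => ∑ ω, ∏ j, √(g j ω) - θ * ∑ j, ∑ ω, g j ω ^ 2
    obtain ⟨u, huK, hu⟩ := hKc.exists_isMaxOn ⟨g, hKg⟩ (f := F)
      (Continuous.continuousOn (by fun_prop))
    have hupos : ∀ j ω, 0 < u j ω := fun j ω => hc.trans_le (huK.1 j ω)
    let L : J → Ω → ℝ := fun j ω => ∑ x, (u j (τ x ω) - u j ω)
    -- For such `h` the new value at `ω` is a convex combination of `u j ω` and the `u j (τ x ω)`,
    -- so the lower bound survives; sums are preserved because each `τ x` is a permutation.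
    have hLK : ∀ h : ℝ, 0 ≤ h → h ≤ 1 / (Fintype.card X + 1) →
        (fun j ω => u j ω + h * L j ω) ∈ K := by
      intro h h0 h1
      have hX : h * Fintype.card X ≤ 1 := by
        rw [le_div_iff₀ (by positivity)] at h1; linarith
      refine ⟨fun j ω => ?_, fun j => ?_, fun j x hx ω => ?_⟩
      · have e1 : (Fintype.card X : ℝ) * (c - u j ω) ≤ L j ω := by
          calc (Fintype.card X : ℝ) * (c - u j ω) = ∑ _x : X, (c - u j ω) := by
                simp [Finset.card_univ]; ring
            _ ≤ L j ω := Finset.sum_le_sum fun x _ => by linarith [huK.1 j (τ x ω)]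
        have e2 := mul_le_mul_of_nonneg_left e1 h0
        have e3 := huK.1 j ω
        nlinarith
      · rw [Finset.sum_add_distrib, ← Finset.mul_sum, huK.2.1 j, Finset.sum_comm]
        have : ∀ x : X, ∑ ω, (u j (τ x ω) - u j ω) = 0 := fun x => by
          rw [Finset.sum_sub_distrib, Equiv.sum_comp (τ x) (u j), sub_self]
        simp [this]
      · have e1 : L j (τ x ω) = L j ω := by
          obtain ⟨e, he⟩ := hconj x j hx
          simp only [L]
          rw [← Equiv.sum_comp e (fun y => u j (τ y ω) - u j ω)]
          refine Finset.sum_congr rfl fun y _ => ?_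
          rw [he, huK.2.2 j x hx, huK.2.2 j x hx]
        simp only [e1, huK.2.2 j x hx]
    have hder : HasDerivAt (fun h : ℝ => F (fun j ω => u j ω + h * L j ω))
        (∑ ω, ∑ j, (∏ i ∈ Finset.univ.erase j, √(u i ω)) * (L j ω / (2 * √(u j ω))) -
          θ * ∑ j, ∑ ω, 2 * u j ω * L j ω) 0 := by
      have hlin : ∀ j ω, HasDerivAt (fun h : ℝ => u j ω + h * L j ω) (L j ω) 0 := fun j ω => by
        simpa using ((hasDerivAt_id (0 : ℝ)).mul_const (L j ω)).const_add (u j ω)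
      refine HasDerivAt.sub (HasDerivAt.fun_sum fun ω _ => ?_) (HasDerivAt.const_mul θ
        (HasDerivAt.fun_sum fun j _ => HasDerivAt.fun_sum fun ω _ => ?_))
      · have := HasDerivAt.fun_finsetProd (u := Finset.univ) (x := (0 : ℝ))
          (f := fun j (h : ℝ) => √(u j ω + h * L j ω))
          (f' := fun j => L j ω / (2 * √(u j ω)))
          (fun j _ => by simpa using (hlin j ω).sqrt (by simpa using (hupos j ω).ne'))
        simpa using this
      · simpa using (hlin j ω).fun_pow 2
    have hnonpos := deriv_nonpos_of_right_max (h₀ := 1 / (Fintype.card X + 1)) hder (by positivity)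
      (fun h h0 h1 => by
        have := hu (hLK h h0 h1)
        simpa using this)
    have hD1 : 0 ≤ ∑ ω, ∑ j, (∏ i ∈ Finset.univ.erase j, √(u i ω)) * (L j ω / (2 * √(u j ω))) := by
      have e1 : ∀ ω, ∑ j, (∏ i ∈ Finset.univ.erase j, √(u i ω)) * (L j ω / (2 * √(u j ω))) =
          ∑ x, (1 / 2) * ((∏ j, √(u j ω)) * ∑ j, (u j (τ x ω) - u j ω) / u j ω) := by
        intro ω
        rw [← Finset.mul_sum, ← Finset.mul_sum, Finset.sum_comm, Finset.mul_sum, Finset.mul_sum]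
        refine Finset.sum_congr rfl fun j _ => ?_
        rw [← Finset.mul_prod_erase Finset.univ (fun j => √(u j ω)) (Finset.mem_univ j),
          ← Finset.sum_div]
        have hsq := Real.sqrt_pos.2 (hupos j ω)
        have hsq2 := Real.mul_self_sqrt (hupos j ω).le
        change _ = 1 / 2 * (√(u j ω) * _ * (L j ω / u j ω))
        rw [← hsq2]
        rw [Real.sqrt_mul_self hsq.le]
        field_simp
      simp only [e1]
      rw [Finset.sum_comm]
      refine Finset.sum_nonneg fun x _ => ?_
      rw [← Finset.mul_sum]
      obtain ⟨a, b, hab⟩ := h2 x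
      refine mul_nonneg (by norm_num) (sum_prod_sqrt_deriv_nonneg (τ x) a b u hupos ?_)
      intro j ha hb
      refine huK.2.2 j x (fun ht => ?_)
      rcases hab j ht with h | h
      · exact ha h
      · exact hb h
    have hD2 : ∑ j, ∑ ω, 2 * u j ω * L j ω =
        -∑ j, ∑ x, ∑ ω, (u j (τ x ω) - u j ω) ^ 2 := by
      rw [← Finset.sum_neg_distrib]
      refine Finset.sum_congr rfl fun j _ => ?_
      simp only [L, Finset.mul_sum]
      rw [Finset.sum_comm, ← Finset.sum_neg_distrib]
      refine Finset.sum_congr rfl fun x _ => ?_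
      have := sum_mul_sub_comp_perm (τ x) (u j)
      simp only [mul_assoc, ← Finset.mul_sum]
      rw [this]; ring
    -- The derivative at the maximiser is nonpositive. It is a nonnegative first part plus `θ` times
    -- this sum of squares, so the sum vanishes.
    have hz : ∑ j, ∑ x, ∑ ω, (u j (τ x ω) - u j ω) ^ 2 = 0 := by
      refine le_antisymm ?_ (Finset.sum_nonneg fun j _ => Finset.sum_nonneg fun x _ =>
        Finset.sum_nonneg fun ω _ => sq_nonneg _)
      rw [hD2] at hnonpos
      by_contra hlt
      push Not at hlt
      nlinarith [mul_pos hθ hlt]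
    have hinvu : ∀ j x ω, u j (τ x ω) = u j ω := by
      intro j x ω
      have h1 := (Finset.sum_eq_zero_iff_of_nonneg (fun j _ => Finset.sum_nonneg fun x _ =>
        Finset.sum_nonneg fun ω _ => sq_nonneg _)).1 hz j (Finset.mem_univ j)
      have h2 := (Finset.sum_eq_zero_iff_of_nonneg (fun x _ =>
        Finset.sum_nonneg fun ω _ => sq_nonneg _)).1 h1 x (Finset.mem_univ x)
      have h3 := (Finset.sum_eq_zero_iff_of_nonneg (fun ω _ => sq_nonneg _)).1 h2 ω
        (Finset.mem_univ ω)
      exact sub_eq_zero.1 (pow_eq_zero_iff (two_ne_zero)|>.1 h3)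
    have hu1 : ∀ j ω, u j ω = 1 := by
      intro j ω
      obtain ⟨d, hd⟩ := htrans (u j) (hinvu j)
      have := huK.2.1 j
      simp only [hd, Finset.sum_const, Finset.card_univ, nsmul_eq_mul] at this
      rw [hd]
      have h' : N * d = N * 1 := by rw [mul_one]; exact this
      exact mul_left_cancel₀ hNpos.ne' h'
    have hFu : F u ≤ N := by
      simp only [F, hu1, Real.sqrt_one, Finset.prod_const_one, Finset.sum_const, Finset.card_univ,
        nsmul_eq_mul, mul_one, one_pow]
      have : 0 ≤ θ * ((Fintype.card J : ℝ) * (Fintype.card Ω : ℝ)) := by positivity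
      linarith
    exact (hu hKg).trans hFu
  -- Now `θ` tends to `0`: with `θ = e / (S + 1)` the penalty at `g` is at most `e`.
  set S := ∑ j, ∑ ω, g j ω ^ 2
  have hS : 0 ≤ S := Finset.sum_nonneg fun j _ => Finset.sum_nonneg fun ω _ => sq_nonneg _
  refine le_of_forall_pos_le_add fun e he => ?_
  have := main (e / (S + 1)) (by positivity)
  have h3 : e / (S + 1) * S ≤ e := by
    rw [div_mul_eq_mul_div, div_le_iff₀ (by positivity)]
    nlinarith
  linarith

/-- Weak form of the inequality `E ∏ Fⱼ ≤ ∏ ‖Fⱼ‖₂` for block functions. -/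
theorem block_holder [Nonempty Ω] (τ : X → Equiv.Perm Ω) (touch : X → J → Prop)
    (h2 : ∀ x, ∃ a b, ∀ j, touch x j → j = a ∨ j = b)
    (hconj : ∀ x j, ¬ touch x j → ∃ e : Equiv.Perm X, ∀ y ω, τ y (τ x ω) = τ x (τ (e y) ω))
    (htrans : ∀ f : Ω → ℝ, (∀ x ω, f (τ x ω) = f ω) → ∃ c, ∀ ω, f ω = c)
    (F : J → Ω → ℝ) (hF : ∀ j ω, 0 < F j ω)
    (hinv : ∀ j x, ¬ touch x j → ∀ ω, F j (τ x ω) = F j ω) :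
    (∑ ω, ∏ j, F j ω) / Fintype.card Ω ≤
      ∏ j, ((1 + (∑ ω, F j ω ^ 2) / Fintype.card Ω) / 2) := by
  set N : ℝ := ((Fintype.card Ω : ℕ) : ℝ) with hN
  have hNpos : 0 < N := by rw [hN]; exact_mod_cast Fintype.card_pos
  let A : J → ℝ := fun j => (∑ ω, F j ω ^ 2) / N
  have hA : ∀ j, 0 < A j := fun j =>
    div_pos (Finset.sum_pos (fun ω _ => pow_pos (hF j ω) 2) Finset.univ_nonempty) hNpos
  let g : J → Ω → ℝ := fun j ω => F j ω ^ 2 / A j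
  have hgpos : ∀ j ω, 0 < g j ω := fun j ω => div_pos (pow_pos (hF j ω) 2) (hA j)
  obtain ⟨c, hc, hcg⟩ : ∃ c > 0, ∀ j ω, c ≤ g j ω := by
    rcases isEmpty_or_nonempty J with hJ | hJ
    · exact ⟨1, one_pos, fun j => (hJ.false j).elim⟩
    · obtain ⟨q, hq⟩ := Finite.exists_min (fun q : J × Ω => g q.1 q.2)
      exact ⟨g q.1 q.2, hgpos _ _, fun j ω => hq (j, ω)⟩
  have key := block_holder_normalized τ touch h2 hconj htrans g hc hcg
    (fun j => by
      simp only [g]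
      rw [← Finset.sum_div, div_eq_iff (hA j).ne']
      simp only [A]
      rw [← hN]; field_simp)
    (fun j x hx ω => by simp only [g, hinv j x hx])
  have e1 : ∀ ω, ∏ j, F j ω = (∏ j, √(A j)) * ∏ j, √(g j ω) := by
    intro ω
    rw [← Finset.prod_mul_distrib]
    refine Finset.prod_congr rfl fun j _ => ?_
    rw [← Real.sqrt_mul (hA j).le, mul_div_cancel₀ _ (hA j).ne', Real.sqrt_sq (hF j ω).le]
  have hP : 0 ≤ ∏ j, √(A j) := Finset.prod_nonneg fun j _ => Real.sqrt_nonneg _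
  calc (∑ ω, ∏ j, F j ω) / N = (∏ j, √(A j)) * ((∑ ω, ∏ j, √(g j ω)) / N) := by
        simp only [e1]; rw [← Finset.mul_sum, mul_div_assoc]
    _ ≤ (∏ j, √(A j)) * 1 := by
        refine mul_le_mul_of_nonneg_left ?_ hP
        rw [div_le_one hNpos]; exact key
    _ = ∏ j, √(A j) := mul_one _
    -- `√A ≤ (1 + A) / 2` replaces the norm by an expression affine in the second moment.
    _ ≤ _ := by
        refine Finset.prod_le_prod (fun j _ => Real.sqrt_nonneg _) fun j _ => ?_
        change _ ≤ (1 + A j) / 2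
        nlinarith [Real.sq_sqrt (hA j).le, sq_nonneg (√(A j) - 1)]

end BlockHolder

/-! ### Expectations over finite types -/

/-- The expectation of a real function under a distribution on a finite type. -/
def Ex {α : Type} [Fintype α] (p : PMF α) (f : α → ℝ) : ℝ := ∑ a, (p a).toReal * f a

section Ex

variable {α β : Type} [Fintype α] [Fintype β]

theorem sum_toReal_pmf (p : PMF α) : ∑ a, (p a).toReal = 1 := by
  have h := p.tsum_coe
  rw [tsum_fintype] at h
  rw [← ENNReal.toReal_sum (fun a _ => p.apply_ne_top a), h, ENNReal.toReal_one]

theorem Ex_const (p : PMF α) (c : ℝ) : Ex p (fun _ => c) = c := by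
  rw [Ex, ← Finset.sum_mul, sum_toReal_pmf, one_mul]

theorem Ex_add (p : PMF α) (f g : α → ℝ) : Ex p (fun a => f a + g a) = Ex p f + Ex p g := by
  simp only [Ex, mul_add, Finset.sum_add_distrib]

theorem Ex_sub (p : PMF α) (f g : α → ℝ) : Ex p (fun a => f a - g a) = Ex p f - Ex p g := by
  simp only [Ex, mul_sub, Finset.sum_sub_distrib]

theorem Ex_mul_left (p : PMF α) (c : ℝ) (f : α → ℝ) : Ex p (fun a => c * f a) = c * Ex p f := by
  simp only [Ex, Finset.mul_sum]
  exact Finset.sum_congr rfl fun a _ => by ring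

theorem Ex_sum {ι : Type} (s : Finset ι) (p : PMF α) (f : ι → α → ℝ) :
    Ex p (fun a => ∑ i ∈ s, f i a) = ∑ i ∈ s, Ex p (f i) := by
  simp only [Ex, Finset.mul_sum]
  exact Finset.sum_comm

theorem Ex_mono_support (p : PMF α) {f g : α → ℝ} (h : ∀ a ∈ p.support, f a ≤ g a) :
    Ex p f ≤ Ex p g := by
  refine Finset.sum_le_sum fun a _ => ?_
  by_cases ha : p a = 0
  · simp [ha]
  · exact mul_le_mul_of_nonneg_left (h a ((PMF.mem_support_iff p a).2 ha)) ENNReal.toReal_nonneg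

theorem Ex_mono (p : PMF α) {f g : α → ℝ} (h : ∀ a, f a ≤ g a) : Ex p f ≤ Ex p g :=
  Ex_mono_support p fun a _ => h a

theorem Ex_congr_support (p : PMF α) {f g : α → ℝ} (h : ∀ a ∈ p.support, f a = g a) :
    Ex p f = Ex p g :=
  le_antisymm (Ex_mono_support p fun a ha => (h a ha).le)
    (Ex_mono_support p fun a ha => (h a ha).ge)

theorem Ex_nonneg (p : PMF α) {f : α → ℝ} (h : ∀ a, 0 ≤ f a) : 0 ≤ Ex p f :=
  Finset.sum_nonneg fun a _ => mul_nonneg ENNReal.toReal_nonneg (h a)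

theorem Ex_le_one (p : PMF α) {f : α → ℝ} (h : ∀ a, f a ≤ 1) : Ex p f ≤ 1 :=
  (Ex_mono p h).trans_eq (Ex_const p 1)

theorem Ex_pure (a : α) (f : α → ℝ) : Ex (PMF.pure a) f = f a := by
  classical
  rw [Ex, Finset.sum_eq_single a]
  · simp
  · intro b _ hb; simp [hb]
  · simp

theorem Ex_bind (p : PMF α) (q : α → PMF β) (f : β → ℝ) :
    Ex (p.bind q) f = Ex p fun a => Ex (q a) f := by
  have h : ∀ b, ((p.bind q) b).toReal = ∑ a, (p a).toReal * (q a b).toReal := fun b => by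
    rw [PMF.bind_apply, tsum_fintype, ENNReal.toReal_sum
      (fun a _ => ENNReal.mul_ne_top (p.apply_ne_top a) ((q a).apply_ne_top b))]
    simp only [ENNReal.toReal_mul]
  simp only [Ex, h, Finset.sum_mul, Finset.mul_sum]
  rw [Finset.sum_comm]
  exact Finset.sum_congr rfl fun a _ => Finset.sum_congr rfl fun b _ => by ring

theorem Ex_map (p : PMF α) (q : α → β) (f : β → ℝ) :
    Ex (p.map q) f = Ex p fun a => f (q a) := by
  rw [PMF.map, Ex_bind]
  simp only [Function.comp, Ex_pure]

theorem Ex_comm (p : PMF α) (q : PMF β) (f : α → β → ℝ) :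
    Ex p (fun a => Ex q (f a)) = Ex q fun b => Ex p fun a => f a b := by
  simp only [Ex, Finset.mul_sum]
  rw [Finset.sum_comm]
  exact Finset.sum_congr rfl fun a _ => Finset.sum_congr rfl fun b _ => by ring

theorem Ex_uniformOfFintype [Nonempty α] (f : α → ℝ) :
    Ex (PMF.uniformOfFintype α) f = (∑ a, f a) / Fintype.card α := by
  simp only [Ex, PMF.uniformOfFintype_apply, ENNReal.toReal_inv, ENNReal.toReal_natCast]
  rw [← Finset.mul_sum, div_eq_inv_mul]

theorem Ex_uniformOfFinset (s : Finset α) (hs : s.Nonempty) (f : α → ℝ) :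
    Ex (PMF.uniformOfFinset s hs) f = (∑ a ∈ s, f a) / s.card := by
  classical
  rw [Ex, ← Finset.sum_subset (Finset.subset_univ s)]
  · rw [div_eq_inv_mul, Finset.mul_sum]
    refine Finset.sum_congr rfl fun a ha => ?_
    rw [PMF.uniformOfFinset_apply_of_mem hs ha, ENNReal.toReal_inv, ENNReal.toReal_natCast]
  · intro a _ ha
    rw [PMF.uniformOfFinset_apply_of_notMem hs ha]; simp

theorem Ex_indicator_eq [DecidableEq α] (p : PMF α) (a : α) :
    Ex p (fun x => if x = a then 1 else 0) = (p a).toReal := by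
  simp [Ex]

theorem pmf_ext_Ex {p q : PMF α} (h : ∀ f, Ex p f = Ex q f) : p = q := by
  classical
  ext a
  have := h fun x => if x = a then 1 else 0
  rw [Ex_indicator_eq, Ex_indicator_eq] at this
  exact (ENNReal.toReal_eq_toReal_iff' (p.apply_ne_top a) (q.apply_ne_top a)).1 this

theorem Ex_eq_bool (p : PMF Bool) (f : Bool → ℝ) :
    Ex p f = (p true).toReal * f true + (1 - (p true).toReal) * f false := by
  have h := sum_toReal_pmf p
  simp only [Ex, Fintype.sum_bool] at h ⊢
  rw [show (p false).toReal = 1 - (p true).toReal by linarith]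

theorem Ex_ofReal_eq (p : PMF α) (f : α → ℝ≥0∞) (hf : ∀ a, f a ≠ ∞) :
    (∑' a, p a * f a).toReal = Ex p fun a => (f a).toReal := by
  rw [tsum_fintype, ENNReal.toReal_sum
    (fun a _ => ENNReal.mul_ne_top (p.apply_ne_top a) (hf a))]
  simp only [ENNReal.toReal_mul, Ex]

end Ex

/-! ### Products of distributions -/

section Indep

variable {ι : Type} [Fintype ι] [DecidableEq ι] {α β γ : Type} [Fintype α] [Fintype β] [Fintype γ]

/-- The joint law of independent draws from `κ i`. -/
def indep (κ : ι → PMF α) : PMF (ι → α) :=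
  PMF.ofFintype (fun f => ∏ i, κ i (f i))
    (by
      have h : ∀ i, ∑ a, κ i a = 1 := fun i => by
        have hp := (κ i).tsum_coe
        rwa [tsum_fintype] at hp
      have := (Finset.prod_univ_sum (fun _ : ι => (Finset.univ : Finset α))
        (fun i a => κ i a)).symm
      rw [Fintype.piFinset_univ] at this
      simp only [this, h, Finset.prod_const_one])

theorem indep_apply (κ : ι → PMF α) (f : ι → α) : indep κ f = ∏ i, κ i (f i) := rfl

theorem iid_eq_indep (p : PMF α) : iid ι p = indep fun _ => p := rfl

theorem indep_apply_toReal (κ : ι → PMF α) (f : ι → α) :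
    (indep κ f).toReal = ∏ i, (κ i (f i)).toReal := by
  rw [indep_apply, ENNReal.toReal_prod]

theorem Ex_indep_prod (κ : ι → PMF α) (f : ι → α → ℝ) :
    Ex (indep κ) (fun x => ∏ i, f i (x i)) = ∏ i, Ex (κ i) (f i) := by
  simp only [Ex, indep_apply_toReal, ← Finset.prod_mul_distrib]
  rw [Finset.prod_univ_sum, Fintype.piFinset_univ]

theorem Ex_indep_bind (μ : ι → PMF α) (κ : ι → α → PMF β) (F : (ι → β) → ℝ) :
    Ex (indep fun i => (μ i).bind (κ i)) F =
      Ex (indep μ) fun a => Ex (indep fun i => κ i (a i)) F := by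
  have h : ∀ b : ι → β, ((indep fun i => (μ i).bind (κ i)) b).toReal =
      Ex (indep μ) fun a => ((indep fun i => κ i (a i)) b).toReal := by
    intro b
    simp only [indep_apply_toReal]
    rw [Ex_indep_prod μ (fun i a => (κ i a (b i)).toReal)]
    refine Finset.prod_congr rfl fun i _ => ?_
    rw [PMF.bind_apply, Ex_ofReal_eq _ _ (fun a => (κ i a).apply_ne_top _)]
  rw [Ex]
  simp only [h]
  simp only [Ex, Finset.sum_mul, Finset.mul_sum]
  rw [Finset.sum_comm]
  exact Finset.sum_congr rfl fun a _ => Finset.sum_congr rfl fun b _ => by ring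

theorem indep_pure (a : ι → α) : (indep fun i => PMF.pure (a i)) = PMF.pure a := by
  classical
  ext b
  rw [indep_apply, PMF.pure_apply]
  by_cases h : b = a
  · subst h; simp
  · obtain ⟨i, hi⟩ := Function.ne_iff.1 h
    rw [if_neg h]
    exact Finset.prod_eq_zero (Finset.mem_univ i) (by simp [hi])

theorem Ex_indep_map (μ : ι → PMF α) (f : ι → α → β) (F : (ι → β) → ℝ) :
    Ex (indep fun i => (μ i).map (f i)) F = Ex (indep μ) fun a => F fun i => f i (a i) := by
  have h := Ex_indep_bind μ (fun i a => PMF.pure (f i a)) F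
  simp only [indep_pure, Ex_pure] at h
  exact h

theorem Ex_indep_pair (μ : ι → PMF α) (κ : ι → α → PMF β) (F : (ι → α) → (ι → β) → ℝ) :
    Ex (indep μ) (fun a => Ex (indep fun i => κ i (a i)) (F a)) =
      Ex (indep fun i => (μ i).bind fun a => (κ i a).map (Prod.mk a))
        fun w => F (fun i => (w i).1) (fun i => (w i).2) := by
  rw [Ex_indep_bind]
  simp only [Ex_indep_map]

/-- If `ν` is the law of a pair in which the first entry is a function of the second, then
integrating over the first entry and then over the second is integrating over the second. -/
theorem Ex_indep_disintegrate (μ : ι → PMF α) (κ : ι → α → PMF β) (π : ι → β → α)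
    (h : ∀ i a, ∀ b ∈ (κ i a).support, (μ i a ≠ 0) → π i b = a) (F : (ι → α) → (ι → β) → ℝ) :
    Ex (indep μ) (fun a => Ex (indep fun i => κ i (a i)) (F a)) =
      Ex (indep fun i => (μ i).bind (κ i)) fun b => F (fun i => π i (b i)) b := by
  rw [Ex_indep_bind]
  refine Ex_congr_support _ fun a ha => Ex_congr_support _ fun b hb => ?_
  have e : (fun i => π i (b i)) = a := by
    funext i
    refine h i (a i) (b i) ?_ ?_
    · rw [PMF.mem_support_iff] at hb ⊢
      intro h0; exact hb (Finset.prod_eq_zero (Finset.mem_univ i) h0)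
    · rw [PMF.mem_support_iff] at ha
      intro h0; exact ha (Finset.prod_eq_zero (Finset.mem_univ i) h0)
  rw [e]

theorem Ex_indep_insertNth {n : ℕ} (κ : Fin (n + 1) → PMF α) (j : Fin (n + 1))
    (F : (Fin (n + 1) → α) → ℝ) :
    Ex (indep κ) F = Ex (κ j) fun x => Ex (indep fun i => κ (j.succAbove i)) fun y =>
      F (j.insertNth x y) := by
  simp only [Ex, indep_apply_toReal]
  rw [← Equiv.sum_comp (Fin.insertNthEquiv (fun _ => α) j), Fintype.sum_prod_type]
  refine Finset.sum_congr rfl fun x _ => ?_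
  rw [Finset.mul_sum]
  refine Finset.sum_congr rfl fun y _ => ?_
  rw [Fin.prod_univ_succAbove _ j]
  simp [Fin.insertNthEquiv, mul_assoc]

theorem Ex_iid_reindex {ι' : Type} [Fintype ι'] [DecidableEq ι'] (e : ι ≃ ι') (p : PMF α)
    (F : (ι → α) → ℝ) :
    Ex (iid ι p) F = Ex (iid ι' p) fun x => F fun i => x (e i) := by
  simp only [Ex, iid_eq_indep, indep_apply_toReal]
  rw [← Equiv.sum_comp (Equiv.arrowCongr e (Equiv.refl α)).symm]
  refine Finset.sum_congr rfl fun x _ => ?_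
  have h1 : (Equiv.arrowCongr e (Equiv.refl α)).symm x = fun i => x (e i) := by
    funext i; simp [Equiv.arrowCongr]
  rw [h1, ← Equiv.prod_comp e (fun i => (p (x i)).toReal)]

theorem Ex_iid_curry {ι' : Type} [Fintype ι'] [DecidableEq ι'] (p : PMF α)
    (F : (ι × ι' → α) → ℝ) :
    Ex (iid (ι × ι') p) F = Ex (iid ι (iid ι' p)) fun x => F fun i => x i.1 i.2 := by
  simp only [Ex, iid_eq_indep, indep_apply_toReal]
  rw [← Equiv.sum_comp (Equiv.curry ι ι' α).symm]
  refine Finset.sum_congr rfl fun x _ => ?_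
  rw [Fintype.prod_prod_type]
  rfl

theorem uniform_eq_iid [Nonempty α] :
    PMF.uniformOfFintype (ι → α) = iid ι (PMF.uniformOfFintype α) := by
  ext f
  rw [iid_eq_indep, indep_apply]
  simp only [PMF.uniformOfFintype_apply, Finset.prod_const, Finset.card_univ, Fintype.card_pi]
  rw [Nat.cast_pow, ENNReal.inv_pow]

/-- Exchanging the fresh value with coordinate `j` preserves the product law. This is how a secret
planted in block `j` becomes a block of a uniform secret. -/
theorem Ex_iid_resample (p : PMF α) (j : ι) (F : α → (ι → α) → ℝ) :
    Ex p (fun s => Ex (iid ι p) fun S => F s (Function.update S j s)) =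
      Ex (iid ι p) fun S => F (S j) S := by
  classical
  have h1 : ∀ S : ι → α, ((iid ι p) S).toReal = (p (S j)).toReal *
      ∏ i ∈ Finset.univ.erase j, (p (S i)).toReal := fun S => by
    rw [iid_eq_indep, indep_apply_toReal, Finset.mul_prod_erase _ (fun i => (p (S i)).toReal)
      (Finset.mem_univ j)]
  -- swap the fresh value with the coordinate `j`
  let e : (α × (ι → α)) ≃ (α × (ι → α)) :=
    { toFun := fun q => (q.2 j, Function.update q.2 j q.1)
      invFun := fun q => (q.2 j, Function.update q.2 j q.1)
      left_inv := fun q => by simp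
      right_inv := fun q => by simp }
  have h2 : ∑ q : α × (ι → α), (p q.1).toReal * ((iid ι p q.2).toReal *
      F q.1 (Function.update q.2 j q.1)) =
      ∑ q : α × (ι → α), (p q.1).toReal * ((iid ι p q.2).toReal * F (q.2 j) q.2) := by
    rw [← Equiv.sum_comp e]
    refine Finset.sum_congr rfl fun q _ => ?_
    simp only [e, Equiv.coe_fn_mk, h1, Function.update_self, Function.update_idem,
      Function.update_eq_self]
    have h3 : ∏ i ∈ Finset.univ.erase j, (p (Function.update q.2 j q.1 i)).toReal =
        ∏ i ∈ Finset.univ.erase j, (p (q.2 i)).toReal :=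
      Finset.prod_congr rfl fun i hi => by
        rw [Function.update_of_ne (Finset.ne_of_mem_erase hi)]
    rw [h3]; ring
  have h4 := Ex_const p (Ex (iid ι p) fun S => F (S j) S)
  rw [← h4]
  simp only [Ex, Finset.mul_sum]
  rw [Fintype.sum_prod_type, Fintype.sum_prod_type] at h2
  exact h2

end Indep

/-! ### The inequality for matrices with independent rows of fixed weight -/

/-- The vectors of Hamming weight `K`, as a type. -/
abbrev Slice (d K : ℕ) : Type := {v : Fin d → ZMod 2 // v ∈ weightSet d K}

theorem hammingNorm_comp_perm {d : ℕ} (v : Fin d → ZMod 2) (e : Equiv.Perm (Fin d)) :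
    hammingNorm (fun c => v (e c)) = hammingNorm v := by
  unfold hammingNorm
  refine Finset.card_bij (fun c _ => e c) ?_ ?_ ?_
  · intro c hc; simpa using hc
  · intro c _ c' _ h; exact e.injective h
  · intro c hc; exact ⟨e.symm c, by simpa using hc, by simp⟩

/-- Permuting the coordinates of a vector of fixed weight. -/
def Slice.perm {d K : ℕ} (e : Equiv.Perm (Fin d)) (v : Slice d K) : Slice d K :=
  ⟨fun c => v.1 (e c), by
    have h := v.2
    simp only [weightSet, Finset.mem_filter, Finset.mem_univ, true_and] at h ⊢
    rw [hammingNorm_comp_perm, h]⟩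

theorem Slice.perm_mul {d K : ℕ} (e e' : Equiv.Perm (Fin d)) (v : Slice d K) :
    (v.perm e).perm e' = v.perm (e * e') := rfl

/-- Over `𝔽₂` a vector is determined by its support, and a bijection between two supports extends to
a permutation of all coordinates. -/
theorem Slice.exists_perm {d K : ℕ} (v w : Slice d K) : ∃ e, v.perm e = w := by
  have hcard : Fintype.card {c // w.1 c ≠ 0} = Fintype.card {c // v.1 c ≠ 0} := by
    have hv := v.2
    have hw := w.2
    simp only [weightSet, Finset.mem_filter, Finset.mem_univ, true_and] at hv hw
    rw [Fintype.card_subtype, Fintype.card_subtype]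
    exact hw.trans hv.symm
  obtain ⟨e⟩ := Fintype.card_eq.1 hcard
  have h01 : ∀ x y : ZMod 2, x ≠ 0 → y ≠ 0 → x = y := by decide
  refine ⟨e.extendSubtype, Subtype.ext (funext fun c => ?_)⟩
  change v.1 (e.extendSubtype c) = w.1 c
  by_cases hc : w.1 c = 0
  · have := e.extendSubtype_not_mem c (by simpa using hc)
    rw [hc]; simpa using this
  · exact h01 _ _ (e.extendSubtype_mem c hc) hc

/-- Exchange two coordinates in one row. -/
def swapRow {m d K : ℕ} (x : Fin m × Fin d × Fin d) (ω : Fin m → Slice d K) : Fin m → Slice d K :=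
  Function.update ω x.1 ((ω x.1).perm (Equiv.swap x.2.1 x.2.2))

theorem swapRow_swapRow {m d K : ℕ} (x : Fin m × Fin d × Fin d) (ω : Fin m → Slice d K) :
    swapRow x (swapRow x ω) = ω := by
  simp [swapRow, Slice.perm]

def swapRowEquiv {m d K : ℕ} (x : Fin m × Fin d × Fin d) : Equiv.Perm (Fin m → Slice d K) where
  toFun := swapRow x
  invFun := swapRow x
  left_inv := swapRow_swapRow x
  right_inv := swapRow_swapRow x

/-- Within the row of `x`, conjugation by a transposition turns transpositions into transpositions;
generators in other rows commute with it. -/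
theorem swapRow_conj {m d K : ℕ} (x : Fin m × Fin d × Fin d) :
    ∃ e : Equiv.Perm (Fin m × Fin d × Fin d), ∀ y (ω : Fin m → Slice d K),
      swapRow y (swapRow x ω) = swapRow x (swapRow (e y) ω) := by
  let s := Equiv.swap x.2.1 x.2.2
  let f : Fin m × Fin d × Fin d → Fin m × Fin d × Fin d := fun y =>
    if y.1 = x.1 then (y.1, s y.2.1, s y.2.2) else y
  have hf : Function.Involutive f := by
    intro y
    by_cases h : y.1 = x.1
    · simp [f, h, s]
      ext <;> simp [h]
    · simp [f, h]
  refine ⟨hf.toPerm, fun y ω => ?_⟩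
  obtain ⟨i, c, c'⟩ := x
  obtain ⟨i', b, b'⟩ := y
  by_cases h : i' = i
  · subst h
    simp only [Function.Involutive.coe_toPerm, f, if_true, swapRow, Function.update_self,
      Function.update_idem, Slice.perm_mul]
    congr 2
    exact Equiv.mul_swap_eq_swap_mul _ _ _
  · simp only [Function.Involutive.coe_toPerm, f, if_neg h, swapRow]
    rw [Function.update_of_ne h, Function.update_of_ne (Ne.symm h),
      Function.update_comm (Ne.symm h)]

/-- Transpositions generate the symmetric group, which acts transitively on vectors of fixed weight;
the rows are exchanged one at a time. -/
theorem eq_of_swapRow_invariant {m d K : ℕ} (f : (Fin m → Slice d K) → ℝ)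
    (hf : ∀ x ω, f (swapRow x ω) = f ω) (ω ω' : Fin m → Slice d K) : f ω = f ω' := by
  have h1 : ∀ (e : Equiv.Perm (Fin d)) (i : Fin m) (ω : Fin m → Slice d K),
      f (Function.update ω i ((ω i).perm e)) = f ω := by
    intro e i
    induction e using Equiv.Perm.swap_induction_on with
    | one => intro ω; simp [Slice.perm]
    | swap_mul e x y _ ih =>
      intro ω
      have h := ih (swapRow (i, x, y) ω)
      simp only [swapRow, Function.update_self, Function.update_idem, Slice.perm_mul] at h
      rw [h]
      exact hf (i, x, y) ω
  have h2 : ∀ s : Finset (Fin m), f (fun i => if i ∈ s then ω' i else ω i) = f ω := by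
    intro s
    induction s using Finset.induction_on with
    | empty => simp
    | insert a s ha ih =>
      rw [← ih]
      obtain ⟨e, he⟩ := Slice.exists_perm (ω a) (ω' a)
      refine Eq.trans ?_ (h1 e a _)
      congr 1
      funext i
      by_cases hi : i = a
      · subst hi; simp [ha, he]
      · simp [hi]
  have := h2 Finset.univ
  simpa using this.symm

/-- The `j`-th block of a vector that consists of `k` blocks of length `n`. -/
def block {k n : ℕ} (j : Fin k) (v : Fin (k * n) → ZMod 2) : Fin n → ZMod 2 :=
  fun t => v (finProdFinEquiv (j, t))

theorem exactRow_eq_map {d K : ℕ} (h : K ≤ d) :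
    haveI : Nonempty (Slice d K) := (weightSet_nonempty h).to_subtype
    exactRow d K h = (PMF.uniformOfFintype (Slice d K)).map Subtype.val := by
  have : Nonempty (Slice d K) := (weightSet_nonempty h).to_subtype
  refine pmf_ext_Ex fun f => ?_
  rw [Ex_map, Ex_uniformOfFintype, exactRow, Ex_uniformOfFinset, Fintype.card_coe,
    Finset.sum_coe_sort]

theorem Ex_iid_exactRow {m d K : ℕ} (h : K ≤ d) (f : (Fin m → Fin d → ZMod 2) → ℝ) :
    Ex (iid (Fin m) (exactRow d K h)) f =
      (∑ ω : Fin m → Slice d K, f fun i => (ω i).1) / Fintype.card (Fin m → Slice d K) := by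
  have : Nonempty (Slice d K) := (weightSet_nonempty h).to_subtype
  rw [exactRow_eq_map, iid_eq_indep, Ex_indep_map, ← iid_eq_indep, ← uniform_eq_iid,
    Ex_uniformOfFintype]

/-- The blocks of a row of fixed weight are dependent, but a transposition of two coordinates
changes at most the two blocks that contain them, so `block_holder` applies. Compared with
independence, the price is that second moments appear in place of first ones. -/
theorem exactRow_block_holder {m k n K : ℕ} (h : K ≤ k * n)
    (F : Fin k → (Fin m → Fin n → ZMod 2) → ℝ) (hF : ∀ j q, 0 < F j q) :
    Ex (iid (Fin m) (exactRow (k * n) K h)) (fun Q => ∏ j, F j fun i => block j (Q i)) ≤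
      ∏ j, ((1 + Ex (iid (Fin m) (exactRow (k * n) K h))
        (fun Q => F j (fun i => block j (Q i)) ^ 2)) / 2) := by
  have : Nonempty (Slice (k * n) K) := (weightSet_nonempty h).to_subtype
  simp only [Ex_iid_exactRow]
  refine block_holder (Ω := Fin m → Slice (k * n) K) (X := Fin m × Fin (k * n) × Fin (k * n))
    swapRowEquiv
    (fun x j => (finProdFinEquiv.symm x.2.1).1 = j ∨ (finProdFinEquiv.symm x.2.2).1 = j)
    ?_ ?_ ?_ (fun j ω => F j fun i => block j (ω i).1) (fun j ω => hF _ _) ?_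
  · intro x
    refine ⟨(finProdFinEquiv.symm x.2.1).1, (finProdFinEquiv.symm x.2.2).1, fun j hj => ?_⟩
    exact hj.imp Eq.symm Eq.symm
  · intro x j _
    exact swapRow_conj x
  · intro f hf
    exact ⟨f (Classical.arbitrary _), fun ω => eq_of_swapRow_invariant f hf _ _⟩
  · intro j x hx ω
    push Not at hx
    have e : (fun i => block j (swapRowEquiv x ω i).1) = fun i => block j (ω i).1 := by
      funext i t
      change (swapRow x ω i).1 (finProdFinEquiv (j, t)) = (ω i).1 (finProdFinEquiv (j, t))
      by_cases hi : i = x.1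
      · subst hi
        simp only [swapRow, Function.update_self]
        change (ω x.1).1 (Equiv.swap x.2.1 x.2.2 (finProdFinEquiv (j, t))) = _
        rw [Equiv.swap_apply_of_ne_of_ne]
        · intro h; exact hx.1 (by rw [← h]; simp)
        · intro h; exact hx.2 (by rw [← h]; simp)
      · simp only [swapRow, Function.update_of_ne hi]
    rw [e]

/-! ### Specifications of programs -/

/-- Started in the store `st`, the stack `L` of programs terminates within `T` steps, and its final
store is coupled with a sample of `μ` through the relation `R`. -/
def SpecL (ν : PMF (ZMod 2)) (orc : RawOracle) (L : List Prog) (st : Store) (T : ℕ) {α : Type}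
    (μ : PMF α) (R : α → Store → Prop) : Prop :=
  ∃ D : PMF (α × Store × ℕ), D.map Prod.fst = μ ∧
    (∀ x ∈ D.support, R x.1 x.2.1 ∧ x.2.2 ≤ T) ∧
    ∀ K n, T ≤ n → run ν orc n (L ++ K, st) = D.bind fun x => run ν orc (n - x.2.2) (K, x.2.1)

/-- `SpecL` for a single program. -/
abbrev Spec (ν : PMF (ZMod 2)) (orc : RawOracle) (P : Prog) (st : Store) (T : ℕ) {α : Type}
    (μ : PMF α) (R : α → Store → Prop) : Prop :=
  SpecL ν orc [P] st T μ R

/-- The program `P` makes no random choices that matter for the relation `R` on final stores. -/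
abbrev Det (ν : PMF (ZMod 2)) (orc : RawOracle) (P : Prog) (st : Store) (T : ℕ)
    (R : Store → Prop) : Prop :=
  Spec ν orc P st T (PMF.pure ()) fun _ => R

theorem pmf_bind_congr {α β : Type} (p : PMF α) {f g : α → PMF β}
    (h : ∀ a ∈ p.support, f a = g a) : p.bind f = p.bind g := by
  ext b
  rw [PMF.bind_apply, PMF.bind_apply]
  refine tsum_congr fun a => ?_
  by_cases ha : p a = 0
  · simp [ha]
  · rw [h a ((PMF.mem_support_iff p a).2 ha)]

section Rules

variable {ν : PMF (ZMod 2)} {orc : RawOracle} {α β : Type}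

theorem SpecL.weaken {L : List Prog} {st : Store} {T T' : ℕ} {μ : PMF α} {R R' : α → Store → Prop}
    (h : SpecL ν orc L st T μ R) (hT : T ≤ T') (hR : ∀ a ∈ μ.support, ∀ st', R a st' → R' a st') :
    SpecL ν orc L st T' μ R' := by
  obtain ⟨D, h1, h2, h3⟩ := h
  refine ⟨D, h1, fun x hx => ⟨hR _ ?_ _ (h2 x hx).1, (h2 x hx).2.trans hT⟩,
    fun K n hn => h3 K n (hT.trans hn)⟩
  rw [← h1, PMF.support_map]
  exact ⟨x, hx, rfl⟩

theorem SpecL.mono {L : List Prog} {st : Store} {T : ℕ} {μ : PMF α} {R R' : α → Store → Prop}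
    (h : SpecL ν orc L st T μ R) (hR : ∀ a st', R a st' → R' a st') :
    SpecL ν orc L st T μ R' :=
  h.weaken le_rfl fun a _ st' => hR a st'

theorem SpecL.time {L : List Prog} {st : Store} {T T' : ℕ} {μ : PMF α} {R : α → Store → Prop}
    (h : SpecL ν orc L st T μ R) (hT : T ≤ T') : SpecL ν orc L st T' μ R :=
  h.weaken hT fun _ _ _ h => h

theorem SpecL.map {L : List Prog} {st : Store} {T : ℕ} {μ : PMF α} {R : α → Store → Prop}
    (h : SpecL ν orc L st T μ R) (f : α → β) {R' : β → Store → Prop}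
    (hR : ∀ a st', R a st' → R' (f a) st') : SpecL ν orc L st T (μ.map f) R' := by
  obtain ⟨D, h1, h2, h3⟩ := h
  refine ⟨D.map fun x => (f x.1, x.2), ?_, ?_, fun K n hn => ?_⟩
  · rw [PMF.map_comp, ← h1, PMF.map_comp]; rfl
  · intro x hx
    rw [PMF.support_map] at hx
    obtain ⟨y, hy, rfl⟩ := hx
    exact ⟨hR _ _ (h2 y hy).1, (h2 y hy).2⟩
  · rw [h3 K n hn, PMF.bind_map]; rfl

theorem SpecL.nil {st : Store} {a : α} {R : α → Store → Prop} (h : R a st) :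
    SpecL ν orc [] st 0 (PMF.pure a) R := by
  refine ⟨PMF.pure (a, st, 0), PMF.pure_map _ _, ?_, fun K n _ => ?_⟩
  · intro x hx
    rw [PMF.support_pure, Set.mem_singleton_iff] at hx
    subst hx
    exact ⟨h, le_rfl⟩
  · rw [PMF.pure_bind]; rfl

theorem SpecL.append {L L' : List Prog} {st : Store} {T T' : ℕ} {μ : PMF α} {κ : α → PMF β}
    {R : α → Store → Prop} {R' : β → Store → Prop} (h : SpecL ν orc L st T μ R)
    (h' : ∀ a st', R a st' → SpecL ν orc L' st' T' (κ a) R') :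
    SpecL ν orc (L ++ L') st (T + T') (μ.bind κ) R' := by
  classical
  obtain ⟨D, h1, h2, h3⟩ := h
  -- The coupling for `L'` exists only from stores satisfying `R`; `choose!` needs a default for all
  -- others.
  have : Nonempty (PMF (β × Store × ℕ)) := by
    obtain ⟨x, hx⟩ := D.support_nonempty
    exact ⟨(h' _ _ (h2 x hx).1).choose⟩
  choose! E hE using h'
  refine ⟨D.bind fun x => (E x.1 x.2.1).map fun y => (y.1, y.2.1, x.2.2 + y.2.2), ?_, ?_, ?_⟩
  · rw [PMF.map_bind, ← h1, PMF.bind_map]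
    refine pmf_bind_congr _ fun x hx => ?_
    rw [PMF.map_comp, Function.comp_apply, ← (hE x.1 x.2.1 (h2 x hx).1).1]
    rfl
  · intro z hz
    rw [PMF.mem_support_bind_iff] at hz
    obtain ⟨x, hx, hz⟩ := hz
    rw [PMF.support_map] at hz
    obtain ⟨y, hy, rfl⟩ := hz
    have := (hE x.1 x.2.1 (h2 x hx).1).2.1 y hy
    exact ⟨this.1, Nat.add_le_add (h2 x hx).2 this.2⟩
  · intro K n hn
    rw [List.append_assoc, h3 (L' ++ K) n (le_of_add_le_left hn), PMF.bind_bind]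
    refine pmf_bind_congr _ fun x hx => ?_
    have hx2 := (h2 x hx).2
    rw [(hE x.1 x.2.1 (h2 x hx).1).2.2 K (n - x.2.2) (by omega), PMF.bind_map]
    refine pmf_bind_congr _ fun y _ => ?_
    simp only [Function.comp_apply, Nat.sub_sub]

/-- Prefixing a deterministic step of the machine. -/
theorem SpecL.of_step' {P : Prog} {L L' : List Prog} {st : Store} {T : ℕ} {μ : PMF α}
    {R : α → Store → Prop} (hs : ∀ K, step ν orc (P :: K, st) = PMF.pure (L ++ K, st))
    (h : SpecL ν orc (L ++ L') st T μ R) : SpecL ν orc (P :: L') st (T + 1) μ R := by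
  obtain ⟨D, h1, h2, h3⟩ := h
  refine ⟨D.map fun x => (x.1, x.2.1, x.2.2 + 1), ?_, ?_, fun K n hn => ?_⟩
  · rw [PMF.map_comp, ← h1]; rfl
  · intro x hx
    rw [PMF.support_map] at hx
    obtain ⟨y, hy, rfl⟩ := hx
    exact ⟨(h2 y hy).1, Nat.succ_le_succ (h2 y hy).2⟩
  · obtain ⟨n, rfl⟩ : ∃ n', n = n' + 1 := ⟨n - 1, by omega⟩
    change (step ν orc (P :: (L' ++ K), st)).bind (run ν orc n) = _
    rw [hs, PMF.pure_bind, ← List.append_assoc, h3 K n (by omega), PMF.bind_map]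
    refine pmf_bind_congr _ fun x _ => ?_
    simp only [Function.comp_apply, Nat.add_sub_add_right]

theorem SpecL.of_step {P : Prog} {L : List Prog} {st : Store} {T : ℕ} {μ : PMF α}
    {R : α → Store → Prop} (hs : ∀ K, step ν orc (P :: K, st) = PMF.pure (L ++ K, st))
    (h : SpecL ν orc L st T μ R) : Spec ν orc P st (T + 1) μ R :=
  SpecL.of_step' (L' := []) hs (by simpa using h)

theorem Spec.instr {c : Instr} {st : Store} {μ : PMF α} {R : α → Store → Prop} (f : α → Store)
    (hc : c.exec ν orc st = μ.map f) (hR : ∀ a, R a (f a)) :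
    Spec ν orc (.instr c) st 1 μ R := by
  refine ⟨μ.map fun a => (a, f a, 1), ?_, ?_, fun K n hn => ?_⟩
  · rw [PMF.map_comp]; exact PMF.map_id μ
  · intro x hx
    rw [PMF.support_map] at hx
    obtain ⟨a, _, rfl⟩ := hx
    exact ⟨hR a, le_rfl⟩
  · obtain ⟨n, rfl⟩ : ∃ n', n = n' + 1 := ⟨n - 1, by omega⟩
    change ((c.exec ν orc st).map fun st' => (K, st')).bind (run ν orc n) = _
    rw [hc, PMF.map_comp, PMF.bind_map, PMF.bind_map]
    rfl

theorem Spec.while_zero {x : ℕ} {P : Prog} {st : Store} {a : α}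
    {R : α → Store → Prop} (hx : st.reg x = 0) (h : R a st) :
    Spec ν orc (.while x P) st 1 (PMF.pure a) R :=
  SpecL.of_step (L := []) (fun K => by simp [step, hx]) (SpecL.nil h)

theorem Spec.while_succ {x : ℕ} {P : Prog} {st : Store} {T T' : ℕ} {μ : PMF α} {κ : α → PMF β}
    {R : α → Store → Prop} {R' : β → Store → Prop} (hx : st.reg x ≠ 0)
    (h : Spec ν orc P st T μ R)
    (h' : ∀ a st', R a st' → Spec ν orc (.while x P) st' T' (κ a) R') :
    Spec ν orc (.while x P) st (T + T' + 1) (μ.bind κ) R' :=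
  SpecL.of_step (L := [P] ++ [.while x P]) (fun K => by simp [step, hx]) (SpecL.append h h')

/-- The law of a state after a loop that counts down from `N`. -/
def iter (κ : ℕ → α → PMF α) : ℕ → α → PMF α
  | 0, a => PMF.pure a
  | i + 1, a => (κ i a).bind (iter κ i)

/-- A round costs its body and one test; the final failing test is the extra step. -/
theorem Spec.while_iter {x : ℕ} {P : Prog} {T : ℕ} {κ : ℕ → α → PMF α}
    {I : ℕ → α → Store → Prop} (hx : ∀ i a st, I i a st → st.reg x = i)
    (hP : ∀ i a st, I (i + 1) a st → Spec ν orc P st T (κ i a) (I i)) :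
    ∀ N a st, I N a st → Spec ν orc (.while x P) st (N * (T + 1) + 1) (iter κ N a) (I 0) := by
  intro N
  induction N with
  | zero =>
    intro a st h
    simpa [iter] using Spec.while_zero (hx 0 a st h) h
  | succ N ih =>
    intro a st h
    refine SpecL.time (Spec.while_succ (by rw [hx _ _ _ h]; omega) (hP N a st h)
      fun a' st' h' => ih a' st' h') (le_of_eq (by ring))

theorem Spec.while_det {x : ℕ} {P : Prog} {T : ℕ}
    {I : ℕ → Store → Prop} (hx : ∀ i st, I i st → st.reg x = i)
    (hP : ∀ i st, I (i + 1) st → Det ν orc P st T (I i)) (N : ℕ) (st : Store) (h : I N st) :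
    Det ν orc (.while x P) st (N * (T + 1) + 1) (I 0) := by
  have := Spec.while_iter (κ := fun _ => PMF.pure) (I := fun i (_ : Unit) st => I i st)
    (fun i _ st h => hx i st h) (fun i _ st h => hP i st h) N () st h
  have e : ∀ N (a : Unit), iter (fun _ => PMF.pure) N a = PMF.pure a := by
    intro N
    induction N with
    | zero => intro a; rfl
    | succ N ih => intro a; simp [iter, ih]
  rwa [e] at this

end Rules

/-! ### Straight-line code -/

/-- Sequential composition of a list of programs. -/
def seqs : List Prog → Prog
  | [] => .instr (.const 60 0)
  | P :: L => L.foldl .seq P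

/-- The program that only writes to a scratch register. -/
def skip : Prog := .instr (.const 60 0)

/-- Repeat `P` as often as register `x` says; register `7` holds `1`. -/
def loop (x : ℕ) (L : List Prog) : Prog := .while x (seqs (L ++ [.instr (.sub x x 7)]))

section Rules

variable {ν : PMF (ZMod 2)} {orc : RawOracle} {α β : Type}

theorem SpecL.cons {P : Prog} {L : List Prog} {st : Store} {T T' : ℕ} {μ : PMF α} {κ : α → PMF β}
    {R : α → Store → Prop} {R' : β → Store → Prop} (h : Spec ν orc P st T μ R)
    (h' : ∀ a st', R a st' → SpecL ν orc L st' T' (κ a) R') :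
    SpecL ν orc (P :: L) st (T + T') (μ.bind κ) R' :=
  SpecL.append h h'

theorem SpecL.det_cons {P : Prog} {L : List Prog} {st : Store} {T T' : ℕ} {μ : PMF β}
    {R : Store → Prop} {R' : β → Store → Prop} (h : Det ν orc P st T R)
    (h' : ∀ st', R st' → SpecL ν orc L st' T' μ R') :
    SpecL ν orc (P :: L) st (T + T') μ R' := by
  have := SpecL.cons (κ := fun _ => μ) h fun _ st' => h' st'
  rwa [PMF.pure_bind] at this

theorem SpecL.const {x v : ℕ} {L : List Prog} {st : Store} {T : ℕ} {μ : PMF β}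
    {R : β → Store → Prop} (h : SpecL ν orc L (st.setReg x v) T μ R) :
    SpecL ν orc (.instr (.const x v) :: L) st (1 + T) μ R :=
  SpecL.det_cons (R := (· = st.setReg x v))
    (Spec.instr (fun _ => st.setReg x v) (by simp [Instr.exec, PMF.pure_map]) fun _ => rfl)
    fun _ h' => h' ▸ h

theorem SpecL.add {x y z : ℕ} {L : List Prog} {st : Store} {T : ℕ} {μ : PMF β}
    {R : β → Store → Prop} (h : SpecL ν orc L (st.setReg x (st.reg y + st.reg z)) T μ R) :
    SpecL ν orc (.instr (.add x y z) :: L) st (1 + T) μ R :=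
  SpecL.det_cons (R := (· = st.setReg x (st.reg y + st.reg z)))
    (Spec.instr (fun _ => _) (by simp [Instr.exec, PMF.pure_map]) fun _ => rfl)
    fun _ h' => h' ▸ h

theorem SpecL.sub {x y z : ℕ} {L : List Prog} {st : Store} {T : ℕ} {μ : PMF β}
    {R : β → Store → Prop} (h : SpecL ν orc L (st.setReg x (st.reg y - st.reg z)) T μ R) :
    SpecL ν orc (.instr (.sub x y z) :: L) st (1 + T) μ R :=
  SpecL.det_cons (R := (· = st.setReg x (st.reg y - st.reg z)))
    (Spec.instr (fun _ => _) (by simp [Instr.exec, PMF.pure_map]) fun _ => rfl)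
    fun _ h' => h' ▸ h

theorem SpecL.load {x a i j : ℕ} {L : List Prog} {st : Store} {T : ℕ} {μ : PMF β}
    {R : β → Store → Prop}
    (h : SpecL ν orc L (st.setReg x (st.arr a (st.reg i) (st.reg j))) T μ R) :
    SpecL ν orc (.instr (.load x a i j) :: L) st (1 + T) μ R :=
  SpecL.det_cons (R := (· = st.setReg x (st.arr a (st.reg i) (st.reg j))))
    (Spec.instr (fun _ => _) (by simp [Instr.exec, PMF.pure_map]) fun _ => rfl)
    fun _ h' => h' ▸ h

theorem SpecL.store {x a i j : ℕ} {L : List Prog} {st : Store} {T : ℕ} {μ : PMF β}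
    {R : β → Store → Prop}
    (h : SpecL ν orc L (st.setCell a (st.reg i) (st.reg j) (st.reg x)) T μ R) :
    SpecL ν orc (.instr (.store a i j x) :: L) st (1 + T) μ R :=
  SpecL.det_cons (R := (· = st.setCell a (st.reg i) (st.reg j) (st.reg x)))
    (Spec.instr (fun _ => _) (by simp [Instr.exec, PMF.pure_map]) fun _ => rfl)
    fun _ h' => h' ▸ h

theorem uniformOfFinset_range (r : ℕ) :
    PMF.uniformOfFinset (Finset.range (r + 1)) Finset.nonempty_range_add_one =
      (PMF.uniformOfFintype (Fin (r + 1))).map Fin.val := by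
  classical
  ext v
  rw [PMF.map_apply, tsum_fintype]
  simp only [PMF.uniformOfFintype_apply, Fintype.card_fin]
  by_cases hv : v < r + 1
  · rw [PMF.uniformOfFinset_apply_of_mem _ (Finset.mem_range.2 hv), Finset.card_range,
      Finset.sum_eq_single ⟨v, hv⟩]
    · simp
    · intro b _ hb
      rw [if_neg]
      intro h; exact hb (Fin.ext h.symm)
    · simp
  · rw [PMF.uniformOfFinset_apply_of_notMem _ (by simpa using hv), eq_comm]
    refine Finset.sum_eq_zero fun b _ => ?_
    rw [if_neg]
    intro h; exact hv (h ▸ b.2)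

theorem SpecL.rand {x y r : ℕ} {L : List Prog} {st : Store} {T : ℕ} {κ : Fin (r + 1) → PMF β}
    {R : β → Store → Prop} (hr : st.reg y = r)
    (h : ∀ v : Fin (r + 1), SpecL ν orc L (st.setReg x v) T (κ v) R) :
    SpecL ν orc (.instr (.rand x y) :: L) st (1 + T)
      ((PMF.uniformOfFintype (Fin (r + 1))).bind κ) R := by
  have h1 : Spec ν orc (.instr (.rand x y)) st 1 (PMF.uniformOfFintype (Fin (r + 1)))
      fun v st' => st' = st.setReg x v.val := by
    refine Spec.instr (fun v : Fin (r + 1) => st.setReg x v) ?_ fun _ => rfl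
    simp only [Instr.exec]
    subst hr
    rw [uniformOfFinset_range, PMF.map_comp]; rfl
  exact SpecL.cons h1 fun v _ h' => h' ▸ h v

theorem SpecL.noise {x : ℕ} {L : List Prog} {st : Store} {T : ℕ} {κ : ZMod 2 → PMF β}
    {R : β → Store → Prop}
    (h : ∀ e : ZMod 2, SpecL ν orc L (st.setReg x e.val) T (κ e) R) :
    SpecL ν orc (.instr (.noise x) :: L) st (1 + T) (ν.bind κ) R :=
  SpecL.cons (R := fun e st' => st' = st.setReg x (ZMod.val e))
    (Spec.instr (fun v => st.setReg x (ZMod.val v)) rfl fun _ => rfl)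
    fun v _ h' => h' ▸ h v

/-- The sequence is nested to the left, and unfolding it costs one step for each further program in
the list. -/
theorem SpecL.foldl (L : List Prog) : ∀ {P : Prog} {L' : List Prog} {st : Store} {T : ℕ}
    {μ : PMF α} {R : α → Store → Prop}, SpecL ν orc (P :: L ++ L') st T μ R →
      SpecL ν orc (L.foldl .seq P :: L') st (T + L.length) μ R := by
  induction L with
  | nil => intro P L' st T μ R h; exact h
  | cons Q L ih =>
    intro P L' st T μ R h
    have := SpecL.of_step' (P := .seq P Q) (L := [P, Q]) (L' := L ++ L') (fun _ => rfl) h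
    exact (ih (P := .seq P Q) this).time (by simp only [List.length_cons]; omega)

theorem Spec.seqs {P : Prog} {L : List Prog} {st : Store} {T : ℕ} {μ : PMF α}
    {R : α → Store → Prop} (h : SpecL ν orc (P :: L) st T μ R) :
    Spec ν orc (seqs (P :: L)) st (T + L.length) μ R :=
  SpecL.foldl L (L' := []) (by simpa using h)

theorem SpecL.skip_cons {L : List Prog} {st : Store} {T : ℕ} {μ : PMF β}
    {R : β → Store → Prop} (h : SpecL ν orc L (st.setReg 60 0) T μ R) :
    SpecL ν orc (skip :: L) st (1 + T) μ R :=
  SpecL.const h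

end Rules

@[simp] theorem Store.reg_setReg (st : Store) (x v y : ℕ) :
    (st.setReg x v).reg y = if y = x then v else st.reg y := rfl

@[simp] theorem Store.arr_setReg (st : Store) (x v : ℕ) : (st.setReg x v).arr = st.arr := rfl

@[simp] theorem Store.reg_setCell (st : Store) (a i j v : ℕ) :
    (st.setCell a i j v).reg = st.reg := rfl

@[simp] theorem Store.arr_setCell (st : Store) (a i j v a' i' j' : ℕ) :
    (st.setCell a i j v).arr a' i' j' =
      if a' = a ∧ i' = i ∧ j' = j then v else st.arr a' i' j' := rfl

/-- `x := y * z`, with counter `c`; register `7` holds `1` and register `8` holds `0`. -/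
def mulProg (x y z c : ℕ) : Prog :=
  seqs [.instr (.const x 0), .instr (.add c z 8), loop c [.instr (.add x x y)]]

theorem SpecL.mul {ν : PMF (ZMod 2)} {orc : RawOracle} {x y z c : ℕ} {L : List Prog} {β : Type}
    {st : Store} {T p q : ℕ} {μ : PMF β} {R : β → Store → Prop} (hx : 8 < x) (hc : x < c)
    (hy : y < x) (hz : z < x) (h7 : st.reg 7 = 1) (h8 : st.reg 8 = 0) (hp : st.reg y = p)
    (hq : st.reg z = q) (h : SpecL ν orc L ((st.setReg x (p * q)).setReg c 0) T μ R) :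
    SpecL ν orc (mulProg x y z c :: L) st (4 * q + 10 + T) μ R := by
  subst hp hq
  refine SpecL.det_cons (R := fun st' => st' = (st.setReg x (st.reg y * st.reg z)).setReg c 0) ?_
    fun st' h' => h' ▸ h
  refine SpecL.time (Spec.seqs (SpecL.const (SpecL.add (T := st.reg z * (3 + 1) + 1)
    (SpecL.mono (Spec.while_det (T := 3)
      (I := fun i st' => st'.reg c = i ∧ st'.reg x + i * st.reg y = st.reg y * st.reg z ∧
        (∀ r, r ≠ x → r ≠ c → st'.reg r = st.reg r) ∧ st'.arr = st.arr)
      (fun i st h => h.1) ?_ (st.reg z) _ ?_) ?_)))) ?_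
  · intro i st' ⟨h1, h2, h3, h4⟩
    refine SpecL.time (Spec.seqs (SpecL.add (SpecL.sub (SpecL.nil ?_)))) le_rfl
    have e1 := h3 7 (by omega) (by omega)
    have e2 := h3 y (by omega) (by omega)
    refine ⟨?_, ?_, ?_, ?_⟩
    · simp; grind
    · simp; grind
    · intro r hr hr'; simp [hr, hr', h3 r hr hr']
    · simp [h4]
  · refine ⟨?_, ?_, ?_, ?_⟩
    · simp; grind
    · simp; grind
    · intro r hr hr'; simp [hr, hr']
    · simp
  · rintro _ st' ⟨h1, h2, h3, h4⟩
    obtain ⟨g, a⟩ := st'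
    simp only [Store.setReg, Store.mk.injEq]
    refine ⟨?_, h4⟩
    funext r
    by_cases hr' : r = c
    · simpa [hr'] using h1
    · by_cases hr : r = x
      · simp only [hr, if_true]
        rw [if_neg (by omega)]; simpa using h2
      · simp only [hr', hr, if_false]; exact h3 r hr hr'
  · simp only [List.length_cons, List.length_nil]; omega

section Rules

variable {ν : PMF (ZMod 2)} {orc : RawOracle} {α β : Type}

theorem SpecL.ite {x : ℕ} {P Q : Prog} {L : List Prog} {st : Store} {T : ℕ} {μ : PMF α}
    {R : α → Store → Prop} (hP : st.reg x ≠ 0 → SpecL ν orc (P :: L) st T μ R)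
    (hQ : st.reg x = 0 → SpecL ν orc (Q :: L) st T μ R) :
    SpecL ν orc (.ite x P Q :: L) st (1 + T) μ R := by
  rw [add_comm]
  by_cases hx : st.reg x = 0
  · exact SpecL.of_step' (L := [Q]) (fun K => by simp [step, hx]) (hQ hx)
  · exact SpecL.of_step' (L := [P]) (fun K => by simp [step, hx]) (hP hx)

theorem SpecL.seqs_cons {P : Prog} {L L' : List Prog} {st : Store} {T : ℕ} {μ : PMF α}
    {R : α → Store → Prop} (h : SpecL ν orc (P :: L ++ L') st T μ R) :
    SpecL ν orc (seqs (P :: L) :: L') st (T + L.length) μ R :=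
  SpecL.foldl L h

theorem Spec.loop_iter {x : ℕ} {L : List Prog} {T : ℕ} {κ : ℕ → α → PMF α}
    {I : ℕ → α → Store → Prop} (hx : ∀ i a st, I i a st → st.reg x = i)
    (hP : ∀ i a st, I (i + 1) a st →
      SpecL ν orc (L ++ [.instr (.sub x x 7)]) st T (κ i a) (I i))
    (N : ℕ) (a : α) (st : Store) (h : I N a st) :
    Spec ν orc (loop x L) st (N * (T + L.length + 1) + 1) (iter κ N a) (I 0) := by
  refine Spec.while_iter hx (fun i a st h => ?_) N a st h
  cases L with
  | nil => exact Spec.seqs (hP i a st h)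
  | cons P L => exact SpecL.time (Spec.seqs (hP i a st h)) (by simp)

theorem Spec.loop_det {x : ℕ} {L : List Prog} {T : ℕ}
    {I : ℕ → Store → Prop} (hx : ∀ i st, I i st → st.reg x = i)
    (hP : ∀ i st, I (i + 1) st →
      SpecL ν orc (L ++ [.instr (.sub x x 7)]) st T (PMF.pure ()) (fun _ => I i))
    (N : ℕ) (st : Store) (h : I N st) :
    Det ν orc (loop x L) st (N * (T + L.length + 1) + 1) (I 0) := by
  refine Spec.while_det hx (fun i st h => ?_) N st h
  cases L with
  | nil => exact Spec.seqs (hP i st h)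
  | cons P L => exact SpecL.time (Spec.seqs (hP i st h)) (by simp)

end Rules

/-! ### Memory discipline: which registers and arrays a routine leaves alone -/

/-- The stores agree on the registers below `b` and on all arrays outside `S`. -/
def Frame (b : ℕ) (S : List ℕ) (st st' : Store) : Prop :=
  (∀ x, x < b → st'.reg x = st.reg x) ∧ ∀ a, a ∉ S → st'.arr a = st.arr a

theorem Frame.refl (b : ℕ) (S : List ℕ) (st : Store) : Frame b S st st :=
  ⟨fun _ _ => rfl, fun _ _ => rfl⟩

theorem Frame.trans {b b' : ℕ} {S S' : List ℕ} {st st' st'' : Store} (h : Frame b S st st')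
    (h' : Frame b' S' st' st'') {c : ℕ} {U : List ℕ} (hb : c ≤ b) (hb' : c ≤ b')
    (hS : S ⊆ U) (hS' : S' ⊆ U) : Frame c U st st'' :=
  ⟨fun x hx => (h'.1 x (hx.trans_le hb')).trans (h.1 x (hx.trans_le hb)),
    fun a ha => (h'.2 a fun h => ha (hS' h)).trans (h.2 a fun h => ha (hS h))⟩

theorem Frame.setReg {b : ℕ} {S : List ℕ} {st st' : Store} (h : Frame b S st st') {x : ℕ} (v : ℕ)
    (hx : b ≤ x) : Frame b S st (st'.setReg x v) :=
  ⟨fun y hy => by simp [(hy.trans_le hx).ne, h.1 y hy], fun a ha => by simp [h.2 a ha]⟩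

theorem Frame.setCell {b : ℕ} {S : List ℕ} {st st' : Store} (h : Frame b S st st') {a : ℕ}
    (i j v : ℕ) (ha : a ∈ S) : Frame b S st (st'.setCell a i j v) :=
  ⟨fun y hy => by simp [h.1 y hy], fun a' ha' => by
    funext i' j'
    have : a' ≠ a := fun h => ha' (h ▸ ha)
    simp [this, h.2 a' ha']⟩

theorem Frame.mono {b c : ℕ} {S U : List ℕ} {st st' : Store} (h : Frame b S st st') (hb : c ≤ b)
    (hS : S ⊆ U) : Frame c U st st' :=
  ⟨fun x hx => h.1 x (hx.trans_le hb), fun a ha => h.2 a fun h => ha (hS h)⟩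

/-- What the program knows about the parameters and the instance after its first phase. -/
structure Base {n M : ℕ} (m k' σ : ℕ) (A : Matrix (Fin M) (Fin n) (ZMod 2)) (b : Fin M → ZMod 2)
    (st : Store) : Prop where
  r0 : st.reg 0 = n
  r1 : st.reg 1 = m
  r3 : st.reg 3 = σ
  r4 : st.reg 4 = M
  r7 : st.reg 7 = 1
  r8 : st.reg 8 = 0
  r9 : st.reg 9 = (k' + 1) * n
  r10 : st.reg 10 = k'
  r11 : st.reg 11 = n - σ
  r12 : st.reg 12 = (k' + 1) * σ
  r13 : st.reg 13 = k' * σ * (n - σ)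
  r14 : st.reg 14 = k' * n
  a0 : ∀ (i : Fin M) (j : Fin n), st.arr 0 i j = (A i j).val
  a1 : ∀ i : Fin M, st.arr 1 i 0 = (b i).val

section Routines

variable {ν : PMF (ZMod 2)} {orc : RawOracle} {n M m k' σ : ℕ}
  {A : Matrix (Fin M) (Fin n) (ZMod 2)} {b : Fin M → ZMod 2}

theorem Base.frame {st st' : Store} (h : Base m k' σ A b st) {c : ℕ} {S : List ℕ}
    (hf : Frame c S st st') (hc : 15 ≤ c) (h0 : 0 ∉ S) (h1 : 1 ∉ S) : Base m k' σ A b st' := by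
  have e : ∀ x, x < 15 → st'.reg x = st.reg x := fun x hx => hf.1 x (hx.trans_le hc)
  constructor <;> simp only [e, Nat.reduceLT, hf.2 0 h0, hf.2 1 h1, h.r0, h.r1, h.r3, h.r4, h.r7,
    h.r8, h.r9, h.r10, h.r11, h.r12, h.r13, h.r14, h.a0, h.a1, implies_true]

/-! ### The weight of a row -/

theorem sum_val_eq_hammingNorm {d : ℕ} (v : Fin d → ZMod 2) :
    ∑ t, (v t).val = hammingNorm v := by
  have h : ∀ x : ZMod 2, x.val = if x ≠ 0 then 1 else 0 := by decide
  rw [hammingNorm, Finset.card_filter]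
  exact Finset.sum_congr rfl fun t _ => h (v t)

/-- Register `21` becomes the weight of the row of `A` whose index is in register `20`. -/
def weightProg : Prog :=
  seqs [.instr (.const 21 0), .instr (.add 22 0 8), loop 22 [.instr (.sub 23 22 7),
    .instr (.load 24 0 20 23), .instr (.add 21 21 24)]]

theorem weightProg_spec {st : Store} (hB : Base m k' σ A b st) (r : Fin M) (hr : st.reg 20 = r) :
    Det ν orc weightProg st (8 * n + 10) fun st' =>
      st'.reg 21 = hammingNorm (A r) ∧ Frame 21 [] st st' := by
  refine SpecL.time (Spec.seqs (SpecL.const (SpecL.add (T := n * (4 + 3 + 1) + 1)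
    (SpecL.mono (Spec.loop_det (T := 4)
      (I := fun i st' => st'.reg 22 = i ∧ i ≤ n ∧
        st'.reg 21 = ∑ t ∈ Finset.Ico i n, st.arr 0 r t ∧ Frame 21 [] st st')
      (fun i st h => h.1) ?_ n _ ?_) ?_)))) ?_
  · intro i st' ⟨h1, h2, h3, h4⟩
    have e7 := (hB.frame h4 (by simp) (by simp) (by simp)).r7
    refine SpecL.time (SpecL.sub (SpecL.load (SpecL.add (SpecL.sub (SpecL.nil ?_))))) le_rfl
    refine ⟨by simp [h1, e7], by omega, ?_, ?_⟩
    · rw [Finset.sum_eq_sum_Ico_succ_bot (by omega)]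
      simp [h1, e7, h3, h4.2 0, h4.1 20, hr, add_comm]
    · exact (((h4.setReg _ (by simp)).setReg _ (by simp)).setReg _ (by simp)).setReg _ (by simp)
  · refine ⟨by simp [hB.r0, hB.r8], le_rfl, by simp, ?_⟩
    exact ((Frame.refl _ _ _).setReg _ (by simp)).setReg _ (by simp)
  · rintro _ st' ⟨h1, h2, h3, h4⟩
    refine ⟨?_, h4⟩
    rw [h3, ← Finset.range_eq_Ico, Finset.sum_range, ← sum_val_eq_hammingNorm]
    exact Finset.sum_congr rfl fun t _ => hB.a0 r t
  · simp only [List.length_cons, List.length_nil]; omega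

/-! ### Acceptance of a row -/

/-- A biased coin: true with probability `N / (r + 1)`. -/
def coin (N r : ℕ) : PMF Bool :=
  (PMF.uniformOfFintype (Fin (r + 1))).map fun v => decide (v.val < N)

/-- Update of the acceptance flag when `i` factors remain out of `x`. -/
def accStep (u p q x i : ℕ) (flag : Bool) : PMF Bool :=
  (coin (u - (x - (i + 1)) * q) (u + (x - i) * p - 1)).map fun t => flag && t

/-- Multiply the acceptance probability by `∏ (u - i q) / (u + (i + 1) p)`, with `p`, `q` the
contents of the registers `p`, `q`, and as many factors as register `26` says. -/
def accProg (p q : ℕ) : Prog :=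
  seqs [.instr (.add 27 13 8), .instr (.add 28 13 8), loop 26 [.instr (.add 28 28 p),
    .instr (.sub 29 28 7), .instr (.rand 30 29), .instr (.sub 31 27 30),
    .ite 31 skip (.instr (.const 25 0)), .instr (.sub 27 27 q)]]

theorem accProg_spec {st : Store} (hB : Base m k' σ A b st) {p q : ℕ} (hp : p < 15) (hq : q < 15)
    (x : ℕ) (hx : st.reg 26 = x) (flag : Bool) (hflag : st.reg 25 = if flag then 1 else 0) :
    Spec ν orc (accProg p q) st (15 * x + 10)
      (iter (accStep (k' * σ * (n - σ)) (st.reg p) (st.reg q) x) x flag) fun flag' st' =>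
        st'.reg 25 = (if flag' then 1 else 0) ∧ Frame 25 [] st st' := by
  refine SpecL.time (Spec.seqs (SpecL.add (SpecL.add (T := x * (8 + 6 + 1) + 1)
    (SpecL.mono (Spec.loop_iter (T := 8)
      (I := fun i flag st' => st'.reg 26 = i ∧ i ≤ x ∧ st'.reg 25 = (if flag then 1 else 0) ∧
        st'.reg 27 = k' * σ * (n - σ) - (x - i) * st.reg q ∧
        st'.reg 28 = k' * σ * (n - σ) + (x - i) * st.reg p ∧ Frame 25 [] st st')
      (fun i _ st h => h.1) ?_ x flag _ ?_) ?_)))) ?_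
  · intro i flag st' ⟨h1, h2, h3, h4, h5, h6⟩
    have hB' := hB.frame h6 (by simp) (by simp) (by simp)
    have e7 := hB'.r7
    have ep : st'.reg p = st.reg p := h6.1 p (by omega)
    have eq : st'.reg q = st.reg q := h6.1 q (by omega)
    have hp28 : p ≠ 28 := by omega
    have hp29 : p ≠ 29 := by omega
    have ex : x - i = (x - (i + 1)) + 1 := by omega
    have ex1 : ∀ c : ℕ, (x - (i + 1)) * c + c = (x - i) * c := fun c => by rw [ex]; ring
    rw [accStep, coin, PMF.map_comp]
    refine SpecL.time (T := 1 + (1 + (1 + (1 + (1 + (1 + (1 + (1 + 0)))))))) ?_ le_rfl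
    -- A draw is uniform on `{0, …, r}`, so `r` is the denominator of the factor minus one.
    -- Truncated subtraction of the draw from the numerator is nonzero exactly when the draw is
    -- below the numerator.
    refine SpecL.add (SpecL.sub (SpecL.rand (r := k' * σ * (n - σ) + (x - i) * st.reg p - 1) ?_
      fun v => SpecL.sub (SpecL.ite ?_ ?_)))
    · simp [h5, ep, e7]
      rw [← ex1]; omega
    · intro hv
      refine SpecL.skip_cons (SpecL.sub (SpecL.sub (SpecL.nil ⟨?_, by omega, ?_, ?_, ?_, ?_⟩)))
      · simp [h1, e7]
      · have : v.val < k' * σ * (n - σ) - (x - (i + 1)) * st.reg q := by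
          simp [h4] at hv; omega
        simp [h3, this]
      · have q1 : q ≠ 60 := by omega
        have q2 : q ≠ 31 := by omega
        have q3 : q ≠ 30 := by omega
        have q4 : q ≠ 29 := by omega
        have q5 : q ≠ 28 := by omega
        simp [h4, eq, q1, q2, q3, q4, q5, Nat.sub_sub]
        rw [ex1]
      · simp [h5, ep, ← ex1, add_assoc]
      · exact (((((((h6.setReg _ (by simp)).setReg _ (by simp)).setReg _ (by simp)).setReg _
          (by simp)).setReg _ (by simp)).setReg _ (by simp)).setReg _ (by simp))
    · intro hv
      refine SpecL.const (SpecL.sub (SpecL.sub (SpecL.nil ⟨?_, by omega, ?_, ?_, ?_, ?_⟩)))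
      · simp [h1, e7]
      · have : ¬ v.val < k' * σ * (n - σ) - (x - (i + 1)) * st.reg q := by
          simp [h4] at hv; omega
        simp [this]
      · have q1 : q ≠ 25 := by omega
        have q2 : q ≠ 31 := by omega
        have q3 : q ≠ 30 := by omega
        have q4 : q ≠ 29 := by omega
        have q5 : q ≠ 28 := by omega
        simp [h4, eq, q1, q2, q3, q4, q5, Nat.sub_sub]
        rw [ex1]
      · simp [h5, ep, ← ex1, add_assoc]
      · exact (((((((h6.setReg _ (by simp)).setReg _ (by simp)).setReg _ (by simp)).setReg _
          (by simp)).setReg _ (by simp)).setReg _ (by simp)).setReg _ (by simp))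
  · refine ⟨by simp [hx], le_rfl, by simp [hflag], by simp [hB.r8, hB.r13], by simp [hB.r8, hB.r13],
      ?_⟩
    exact ((Frame.refl _ _ _).setReg _ (by simp)).setReg _ (by simp)
  · rintro flag' st' ⟨h1, h2, h3, h4, h5, h6⟩
    exact ⟨h3, h6⟩
  · simp only [List.length_cons, List.length_nil]; omega

/-- Law of the acceptance flag for a row of weight `w`. -/
def acceptLaw (n σ k' w : ℕ) : PMF Bool :=
  (iter (accStep (k' * σ * (n - σ)) σ (n - σ) (w - σ)) (w - σ) true).bind
    (iter (accStep (k' * σ * (n - σ)) (n - σ) σ (σ - w)) (σ - w))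

/-- By truncated subtraction at least one of the two loops is empty: the first treats weights above
`σ`, the second weights below `σ`. -/
def acceptProg : Prog :=
  seqs [.instr (.const 25 1), .instr (.sub 26 21 3), accProg 3 11, .instr (.sub 26 3 21),
    accProg 11 3]

theorem acceptProg_spec {st : Store} (hB : Base m k' σ A b st) (w : ℕ) (hw : st.reg 21 = w) :
    Spec ν orc acceptProg st (15 * (w + σ) + 40) (acceptLaw n σ k' w) fun flag st' =>
      st'.reg 25 = (if flag then 1 else 0) ∧ Frame 25 [] st st' := by
  have hf : Frame 25 [] st ((st.setReg 25 1).setReg 26 (w - σ)) :=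
    ((Frame.refl _ _ _).setReg _ (by simp)).setReg _ (by simp)
  have hB1 := hB.frame hf (by simp) (by simp) (by simp)
  have e3 := hB1.r3
  have e11 := hB1.r11
  have s1 := accProg_spec (ν := ν) (orc := orc) hB1 (p := 3) (q := 11) (by simp) (by simp) (w - σ)
    (by simp) true (by simp)
  rw [e3, e11] at s1
  have key : SpecL ν orc [accProg 3 11, .instr (.sub 26 3 21), accProg 11 3]
      ((st.setReg 25 1).setReg 26 (w - σ)) ((15 * (w - σ) + 10) + (1 + (15 * (σ - w) + 10)))
      (acceptLaw n σ k' w) fun flag st' =>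
        st'.reg 25 = (if flag then 1 else 0) ∧ Frame 25 [] st st' := by
    refine SpecL.cons s1 ?_
    rintro flag st1 ⟨h1, h2⟩
    have hf2 := hf.trans h2 (c := 25) (U := []) le_rfl le_rfl (by simp) (by simp)
    have hB2 := hB.frame hf2 (by simp) (by simp) (by simp)
    refine SpecL.sub ?_
    have e : st1.reg 3 - st1.reg 21 = σ - w := by rw [hB2.r3, hf2.1 21 (by simp), hw]
    rw [e]
    have hf3 := hf2.setReg (x := 26) (σ - w) (by simp)
    have hB3 := hB.frame hf3 (by simp) (by simp) (by simp)
    have s2 := accProg_spec (ν := ν) (orc := orc) hB3 (p := 11) (q := 3) (by simp) (by simp) (σ - w)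
      (by simp) flag (by simp [h1])
    rw [hB3.r3, hB3.r11] at s2
    exact s2.mono fun flag' st' h =>
      ⟨h.1, hf3.trans h.2 le_rfl le_rfl (by simp) (by simp)⟩
  refine SpecL.time (Spec.seqs (SpecL.const (SpecL.sub (T := 15 * (w - σ) + 10 +
    (1 + (15 * (σ - w) + 10))) ?_))) ?_
  · have e : (st.setReg 25 1).reg 21 - (st.setReg 25 1).reg 3 = w - σ := by simp [hw, hB.r3]
    rw [e]
    exact key
  · simp only [List.length_cons, List.length_nil]; omega

end Routines

section Rules

variable {ν : PMF (ZMod 2)} {orc : RawOracle} {α β : Type}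

theorem SpecL.rand_bit {x y : ℕ} {L : List Prog} {st : Store} {T : ℕ} {κ : ZMod 2 → PMF β}
    {R : β → Store → Prop} (hr : st.reg y = 1)
    (h : ∀ v : ZMod 2, SpecL ν orc L (st.setReg x v.val) T (κ v) R) :
    SpecL ν orc (.instr (.rand x y) :: L) st (1 + T)
      ((PMF.uniformOfFintype (ZMod 2)).bind κ) R :=
  SpecL.rand (r := 1) hr h

theorem Spec.loop_zero {x : ℕ} {L : List Prog} {st : Store} {a : α}
    {R : α → Store → Prop} (hx : st.reg x = 0) (h : R a st) :
    Spec ν orc (loop x L) st 1 (PMF.pure a) R :=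
  Spec.while_zero hx h

theorem Spec.loop_succ {x : ℕ} {L : List Prog} {st : Store} {T T' : ℕ} {μ : PMF α}
    {κ : α → PMF β} {R : α → Store → Prop} {R' : β → Store → Prop} (hx : st.reg x ≠ 0)
    (h : SpecL ν orc (L ++ [.instr (.sub x x 7)]) st T μ R)
    (h' : ∀ a st', R a st' → Spec ν orc (loop x L) st' T' (κ a) R') :
    Spec ν orc (loop x L) st (T + L.length + T' + 1) (μ.bind κ) R' := by
  refine Spec.while_succ hx ?_ h'
  cases L with
  | nil => exact Spec.seqs h
  | cons P L => exact SpecL.time (Spec.seqs h) (by simp)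

end Rules

/-! ### Drawing a vector coordinate by coordinate -/

/-- Draw the entries of a vector from the last one down, where entry `c` is drawn from `p c v` when
`v` is the vector so far. -/
def drawAll {d : ℕ} {β : Type} (p : Fin d → (Fin d → β) → PMF β) :
    ℕ → (Fin d → β) → PMF (Fin d → β) :=
  iter fun i v => if h : i < d then (p ⟨i, h⟩ v).map (Function.update v ⟨i, h⟩) else PMF.pure v

theorem sum_filter_le_eq_add {d : ℕ} {B : Type} [AddCommMonoid B] (f : Fin d → B) {i : ℕ}
    (hi : i < d) : ∑ c ∈ Finset.univ.filter (fun c : Fin d => i ≤ c), f c =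
      f ⟨i, hi⟩ + ∑ c ∈ Finset.univ.filter (fun c : Fin d => i + 1 ≤ c), f c := by
  have : Finset.univ.filter (fun c : Fin d => i ≤ c) =
      insert ⟨i, hi⟩ (Finset.univ.filter (fun c : Fin d => i + 1 ≤ c)) := by
    ext c
    simp only [Finset.mem_filter, Finset.mem_univ, true_and, Finset.mem_insert, Fin.ext_iff]
    omega
  rw [this, Finset.sum_insert (by simp)]

theorem sum_filter_le_update {d : ℕ} {B β : Type} [AddCommMonoid B] (f : Fin d → β → B)
    (v : Fin d → β) {i : ℕ} (hi : i < d) (x : β) :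
    ∑ c ∈ Finset.univ.filter (fun c : Fin d => i ≤ c), f c (Function.update v ⟨i, hi⟩ x c) =
      f ⟨i, hi⟩ x + ∑ c ∈ Finset.univ.filter (fun c : Fin d => i + 1 ≤ c), f c (v c) := by
  rw [sum_filter_le_eq_add _ hi, Function.update_self]
  congr 1
  refine Finset.sum_congr rfl fun c hc => ?_
  rw [Function.update_of_ne]
  intro h
  simp [h] at hc

theorem sum_filter_ge_eq_zero {d : ℕ} {B : Type} [AddCommMonoid B] (f : Fin d → B) :
    ∑ c ∈ Finset.univ.filter (fun c : Fin d => d ≤ c), f c = 0 := by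
  rw [Finset.filter_false_of_mem (fun c _ => by omega), Finset.sum_empty]

section Routines

variable {ν : PMF (ZMod 2)} {orc : RawOracle} {n M m k' σ : ℕ}
  {A : Matrix (Fin M) (Fin n) (ZMod 2)} {b : Fin M → ZMod 2}

/-! ### A random vector -/

/-- Fill column `0` of array `6` with `kn` random bits. -/
def secretProg : Prog :=
  seqs [.instr (.add 21 9 8), loop 21 [.instr (.sub 23 21 7), .instr (.rand 22 7),
    .instr (.store 6 23 8 22)]]

theorem secretProg_spec {st : Store} (hB : Base m k' σ A b st) :
    Spec ν orc secretProg st (8 * ((k' + 1) * n) + 10)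
      (drawAll (fun _ _ => PMF.uniformOfFintype (ZMod 2)) ((k' + 1) * n) 0)
      fun S st' => (∀ c : Fin ((k' + 1) * n), st'.arr 6 c 0 = (S c).val) ∧ Frame 21 [6] st st' := by
  refine SpecL.time (Spec.seqs (SpecL.add (T := (k' + 1) * n * (4 + 3 + 1) + 1)
    (SpecL.mono (Spec.loop_iter (T := 4)
      (I := fun i (S : Fin ((k' + 1) * n) → ZMod 2) st' => st'.reg 21 = i ∧ i ≤ (k' + 1) * n ∧
        (∀ c : Fin ((k' + 1) * n), i ≤ c → st'.arr 6 c 0 = (S c).val) ∧ Frame 21 [6] st st')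
      (fun i _ st h => h.1) ?_ _ 0 _ ?_) ?_))) ?_
  · intro i S st' ⟨h1, h2, h3, h4⟩
    have hB' := hB.frame h4 (by simp) (by simp) (by simp)
    have e7 := hB'.r7
    have e8 := hB'.r8
    rw [dif_pos (by omega)]
    refine SpecL.time (T := 1 + (1 + (1 + (1 + 0)))) ?_ le_rfl
    refine SpecL.sub (SpecL.rand_bit (by simp [e7]) fun v => SpecL.store (SpecL.sub
      (SpecL.nil ⟨?_, by omega, ?_, ?_⟩)))
    · simp [h1, e7]
    · intro c hc
      by_cases hci : c.val = i
      · have : c = ⟨i, by omega⟩ := Fin.ext hci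
        rw [this, Function.update_self]
        simp [h1, e7, e8]
      · have : c ≠ ⟨i, by omega⟩ := fun h => hci (by rw [h])
        rw [Function.update_of_ne this]
        simp [h1, e7, e8, hci, h3 c (by omega)]
    · exact (((h4.setReg _ (by simp)).setReg _ (by simp)).setCell _ _ _ (by simp)).setReg _ (by simp)
  · refine ⟨by simp [hB.r8, hB.r9], le_rfl, fun c hc => absurd c.2 (by omega), ?_⟩
    exact (Frame.refl _ _ _).setReg _ (by simp)
  · rintro S st' ⟨h1, h2, h3, h4⟩
    exact ⟨fun c => h3 c (Nat.zero_le _), h4⟩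
  · simp only [List.length_cons, List.length_nil]; omega

/-! ### Selection of rows -/

/-- Run through the rows `r - 1, …, 0`, accept each of them with the law `acc` of its index until
`i` of them are accepted; the last one that is accepted comes first in the result. -/
def sel (acc : ℕ → PMF Bool) : (r i : ℕ) → PMF (Option (Fin i → Fin r))
  | _, 0 => PMF.pure (some Fin.elim0)
  | 0, _ + 1 => PMF.pure none
  | r + 1, i + 1 => (acc r).bind fun t =>
      if t then (sel acc r i).map (Option.map fun u =>
        Fin.snoc (α := fun _ => Fin (r + 1)) (fun x => (u x).castSucc) (Fin.last r))
      else (sel acc r (i + 1)).map (Option.map fun u x => (u x).castSucc)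

/-- Register `18` is also the position in array `7` for the next accepted index, so array `7` is
filled from its end. When it reaches `0`, the remaining rows are passed over. -/
def selBody : List Prog :=
  [.instr (.sub 20 19 7), .ite 18 (seqs [weightProg, acceptProg,
    .ite 25 (seqs [.instr (.sub 18 18 7), .instr (.store 7 18 8 20)]) skip]) skip]

/-- Select `m` rows; register `18` counts how many are missing, array `7` holds their indices. -/
def selProg : Prog :=
  seqs [.instr (.add 18 1 8), .instr (.add 19 4 8), loop 19 selBody]

/-- The relation between the result of the selection and the final store. -/
def SelRel {i r : ℕ} (st : Store) (o : Option (Fin i → Fin r)) (st' : Store) : Prop :=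
  Frame 18 [7] st st' ∧ (∀ x, i ≤ x → st'.arr 7 x 0 = st.arr 7 x 0) ∧
    match o with
    | none => st'.reg 18 ≠ 0
    | some u => st'.reg 18 = 0 ∧ ∀ x : Fin i, st'.arr 7 x 0 = u x

theorem selBody_zero {st : Store} (h18 : st.reg 18 = 0) {r : ℕ} (hr : st.reg 19 = r + 1)
    (h7 : st.reg 7 = 1) :
    SpecL ν orc (selBody ++ [.instr (.sub 19 19 7)]) st 4 (PMF.pure ())
      fun _ st' => st'.reg 18 = 0 ∧ st'.reg 19 = r ∧ Frame 18 [] st st' := by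
  refine SpecL.time (T := 1 + (1 + (1 + (1 + 0)))) ?_ le_rfl
  refine SpecL.sub (SpecL.ite (fun h => absurd h (by simp [h18])) fun _ =>
    SpecL.skip_cons (SpecL.sub (SpecL.nil ⟨by simp [h18], by simp [hr, h7], ?_⟩)))
  exact ((((Frame.refl _ _ _).setReg _ (by simp)).setReg _ (by simp)).setReg _ (by simp))

theorem selBody_succ {st : Store} (hB : Base m k' σ A b st) (hσ : σ ≤ n) {r i : ℕ} (hrM : r < M)
    (h18 : st.reg 18 = i + 1) (hr : st.reg 19 = r + 1) :
    SpecL ν orc (selBody ++ [.instr (.sub 19 19 7)]) st (40 * n + 70)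
      (acceptLaw n σ k' (hammingNorm (A ⟨r, hrM⟩)))
      fun t st' => st'.reg 19 = r ∧ (t = true → st'.reg 18 = i ∧ st'.arr 7 i 0 = r) ∧
        (t = false → st'.reg 18 = i + 1 ∧ st'.arr 7 i 0 = st.arr 7 i 0) ∧
        (∀ x, x ≠ i → st'.arr 7 x 0 = st.arr 7 x 0) ∧ Frame 18 [7] st st' := by
  set w := hammingNorm (A ⟨r, hrM⟩)
  have hw : w ≤ n := by
    have := hammingNorm_le_card_fintype (x := A ⟨r, hrM⟩)
    simpa using this
  have h7 := hB.r7
  have h8 := hB.r8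
  have tail : SpecL ν orc [acceptProg,
      .ite 25 (seqs [.instr (.sub 18 18 7), .instr (.store 7 18 8 20)]) skip,
      .instr (.sub 19 19 7)] = SpecL ν orc ([acceptProg] ++ [
      .ite 25 (seqs [.instr (.sub 18 18 7), .instr (.store 7 18 8 20)]) skip,
      .instr (.sub 19 19 7)]) := rfl
  refine SpecL.time (T := 1 + (1 + ((8 * n + 10) + ((15 * (w + σ) + 40) +
    (1 + (1 + (1 + (1 + 0)) + 1))) + 2))) ?_ (by omega)
  refine SpecL.sub (SpecL.ite (fun _ => ?_) fun h => absurd h (by simp [h18]))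
  have hf : Frame 20 [] st (st.setReg 20 (st.reg 19 - st.reg 7)) :=
    (Frame.refl _ _ _).setReg _ (by simp)
  refine SpecL.seqs_cons (SpecL.det_cons (weightProg_spec (hB.frame hf (by simp) (by simp) (by simp))
    ⟨r, hrM⟩ (by simp [hr, h7])) fun st1 h1 => ?_)
  have hf1 := hf.trans h1.2 (c := 20) (U := []) le_rfl (by simp) (by simp) (by simp)
  have e20 : st1.reg 20 = r := by rw [h1.2.1 20 (by simp)]; simp [hr, h7]
  have := SpecL.cons (β := Bool) (κ := PMF.pure) (T' := 1 + (1 + (1 + (1 + 0)) + 1))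
    (L := [.ite 25 (seqs [.instr (.sub 18 18 7), .instr (.store 7 18 8 20)]) skip,
      .instr (.sub 19 19 7)])
    (R' := fun t st' => st'.reg 19 = r ∧ (t = true → st'.reg 18 = i ∧ st'.arr 7 i 0 = r) ∧
        (t = false → st'.reg 18 = i + 1 ∧ st'.arr 7 i 0 = st.arr 7 i 0) ∧
        (∀ x, x ≠ i → st'.arr 7 x 0 = st.arr 7 x 0) ∧ Frame 18 [7] st st')
    (acceptProg_spec (ν := ν) (orc := orc) (hB.frame hf1 (by simp) (by simp) (by simp)) w h1.1)
    fun t st2 h2 => ?_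
  · rwa [PMF.bind_pure] at this
  have hf2 := hf1.trans h2.2 (c := 20) (U := []) le_rfl (by simp) (by simp) (by simp)
  have e20' : st2.reg 20 = r := by rw [h2.2.1 20 (by simp), e20]
  have hB2 := hB.frame hf2 (by simp) (by simp) (by simp)
  have e7 := hB2.r7
  have e8 := hB2.r8
  have e18 : st2.reg 18 = i + 1 := by rw [hf2.1 18 (by simp), h18]
  have e19 : st2.reg 19 = r + 1 := by rw [hf2.1 19 (by simp), hr]
  have ea : st2.arr 7 = st.arr 7 := hf2.2 7 (by simp)
  have hf3 : Frame 18 [7] st st2 := hf2.mono (by simp) (by simp)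
  refine SpecL.ite (fun ht => ?_) fun ht => ?_
  · have ht' : t = true := by
      by_contra h0
      simp only [Bool.not_eq_true] at h0
      exact ht (by rw [h2.1, h0]; simp)
    subst ht'
    refine SpecL.seqs_cons (SpecL.sub (SpecL.store (SpecL.sub (SpecL.nil ⟨?_, ?_, ?_, ?_, ?_⟩))))
    · simp [e19, e7]
    · intro _; simp [e18, e7, e8, e20']
    · intro h; simp at h
    · intro x hx; simp [e18, e7, e8, hx, ea]
    · exact ((hf3.setReg _ (by simp)).setCell _ _ _ (by simp)).setReg _ (by simp)
  · have ht' : t = false := by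
      by_contra h0
      simp only [Bool.not_eq_false] at h0
      rw [h2.1, h0] at ht; simp at ht
    subst ht'
    refine SpecL.time (T := 1 + (1 + 0)) (SpecL.skip_cons (SpecL.sub (SpecL.nil
      ⟨?_, ?_, ?_, ?_, ?_⟩))) (by simp)
    · simp [e19, e7]
    · intro h; simp at h
    · intro _; simp [e18, ea]
    · intro x hx; simp [ea]
    · exact (hf3.setReg _ (by simp)).setReg _ (by simp)

theorem selLoop_spec (hσ : σ ≤ n) : ∀ (r i : ℕ), r ≤ M → ∀ st : Store, Base m k' σ A b st →
    st.reg 18 = i → st.reg 19 = r →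
    Spec ν orc (loop 19 selBody) st (r * (40 * n + 80) + 1)
      (sel (fun x => acceptLaw n σ k' (hammingNorm (fun t => if h : x < M then A ⟨x, h⟩ t else 0)))
        r i) (SelRel st) := by
  intro r
  induction r with
  | zero =>
    intro i _ st hB h18 h19
    cases i with
    | zero =>
      refine SpecL.time (Spec.loop_zero h19 ⟨Frame.refl _ _ _, fun _ _ => rfl, h18, ?_⟩) (by simp)
      intro x; exact x.elim0
    | succ i =>
      refine SpecL.time (Spec.loop_zero h19 ⟨Frame.refl _ _ _, fun _ _ => rfl, ?_⟩) (by simp)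
      simp [h18]
  | succ r ih =>
    intro i hr st hB h18 h19
    cases i with
    -- Nothing is missing any more: `sel` has already stopped, whereas the loop still counts through
    -- the remaining rows without changing the selection.
    | zero =>
      have := Spec.loop_succ (κ := fun _ => PMF.pure (some (Fin.elim0 : Fin 0 → Fin (r + 1))))
        (T' := r * (40 * n + 80) + 1) (R' := SelRel st) (by omega) (selBody_zero (ν := ν) (orc := orc) h18 h19 hB.r7)
        fun _ st1 ⟨h1, h2, h3⟩ => ?_
      · rw [PMF.pure_bind] at this
        refine SpecL.time this (T' := (r + 1) * (40 * n + 80) + 1)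
          (T := 4 + selBody.length + (r * (40 * n + 80) + 1) + 1) ?_
        simp only [selBody, List.length_cons, List.length_nil]
        ring_nf; omega
      · have hB1 := hB.frame h3 (by simp) (by simp) (by simp)
        have h4 := (ih 0 (by omega) st1 hB1 h1 h2).map
          (fun o => Option.map (fun u x => (u x).castSucc) o) (R' := SelRel (r := r + 1) st) ?_
        · have e : sel (fun x => acceptLaw n σ k' (hammingNorm
              (fun t => if h : x < M then A ⟨x, h⟩ t else 0))) r 0 =
              PMF.pure (some Fin.elim0) := by cases r <;> rfl
          rw [e, PMF.pure_map] at h4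
          convert h4 using 3
          simp only [Option.map_some]
          congr 1
          funext x; exact x.elim0
        · rintro o st2 ⟨g1, g2, g3⟩
          refine ⟨h3.trans g1 (by simp) (by simp) (by simp) (by simp), fun x hx => ?_, ?_⟩
          · rw [g2 x hx, h3.2 7 (by simp)]
          · cases o with
            | none => exact g3
            | some u => exact ⟨g3.1, fun x => x.elim0⟩
    | succ i =>
      have hrM : r < M := by omega
      have e : hammingNorm (A ⟨r, hrM⟩) =
          hammingNorm (fun t => if h : r < M then A ⟨r, h⟩ t else 0) := by
        simp [hrM]
      have hb := selBody_succ (ν := ν) (orc := orc) hB hσ hrM h18 h19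
      rw [e] at hb
      refine SpecL.time (Spec.loop_succ (T' := r * (40 * n + 80) + 1) (by omega) hb
        fun t st1 h1 => ?_) ?_
      · obtain ⟨h1, h2, h3, h4, h5⟩ := h1
        have hB1 := hB.frame h5 (by simp) (by simp) (by simp)
        cases t with
        | true =>
          rw [if_pos rfl]
          refine (ih i (by omega) st1 hB1 (h2 rfl).1 h1).map _ ?_
          rintro o st2 ⟨g1, g2, g3⟩
          refine ⟨h5.trans g1 (by simp) (by simp) (by simp) (by simp), fun x hx => ?_, ?_⟩
          · rw [g2 x (by omega), h4 x (by omega)]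
          · cases o with
            | none => exact g3
            | some u =>
              refine ⟨g3.1, fun x => ?_⟩
              refine Fin.lastCases ?_ (fun x => ?_) x
              · beta_reduce
                rw [Fin.snoc_last, Fin.val_last, g2 i le_rfl, (h2 rfl).2, Fin.val_last]
              · beta_reduce
                rw [Fin.snoc_castSucc, Fin.val_castSucc, g3.2 x, Fin.val_castSucc]
        | false =>
          rw [if_neg (by simp)]
          refine (ih (i + 1) (by omega) st1 hB1 (h3 rfl).1 h1).map _ ?_
          rintro o st2 ⟨g1, g2, g3⟩
          refine ⟨h5.trans g1 (by simp) (by simp) (by simp) (by simp), fun x hx => ?_, ?_⟩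
          · rw [g2 x hx, h4 x (by omega)]
          · cases o with
            | none => exact g3
            | some u =>
              refine ⟨g3.1, fun x => ?_⟩
              rw [g3.2 x, Fin.val_castSucc]
      · simp only [selBody, List.length_cons, List.length_nil]
        ring_nf; omega

theorem selProg_spec (hσ : σ ≤ n) {st : Store} (hB : Base m k' σ A b st) :
    Spec ν orc selProg st (M * (40 * n + 80) + 10)
      (sel (fun x => acceptLaw n σ k' (hammingNorm (fun t => if h : x < M then A ⟨x, h⟩ t else 0)))
        M m) (SelRel st) := by
  have hf : Frame 18 [] st ((st.setReg 18 m).setReg 19 M) :=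
    ((Frame.refl _ _ _).setReg _ (by simp)).setReg _ (by simp)
  refine SpecL.time (Spec.seqs (SpecL.add (SpecL.add (T := M * (40 * n + 80) + 1) ?_))) ?_
  · have e1 : st.reg 1 + st.reg 8 = m := by rw [hB.r1, hB.r8, add_zero]
    have e2 : (st.setReg 18 m).reg 4 + (st.setReg 18 m).reg 8 = M := by simp [hB.r4, hB.r8]
    rw [e1, e2]
    refine (selLoop_spec hσ M m le_rfl _ (hB.frame hf (by simp) (by simp) (by simp)) (by simp)
      (by simp)).mono ?_
    rintro o st' ⟨h1, h2, h3⟩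
    exact ⟨hf.trans h1 (by simp) (by simp) (by simp) (by simp), h2, h3⟩
  · simp only [List.length_cons, List.length_nil]; omega

end Routines

section Routines

variable {ν : PMF (ZMod 2)} {orc : RawOracle} {n M m k' σ : ℕ}
  {A : Matrix (Fin M) (Fin n) (ZMod 2)} {b : Fin M → ZMod 2}

/-! ### Noise -/

/-- Add `t` samples of the noise to `e`. -/
def addNoise (ν : PMF (ZMod 2)) (t : ℕ) (e : ZMod 2) : PMF (ZMod 2) :=
  iter (fun _ e => ν.map (e + ·)) t e

/-- Register `32` is not reduced; only its residue modulo `2` is meaningful. The `k'` fresh bits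
together with the noise of the sample itself make `k' + 1` noise bits. -/
def noiseProg : Prog := seqs [.instr (.add 33 10 8), loop 33 [.instr (.noise 34),
  .instr (.add 32 32 34)]]

theorem noiseProg_spec {st : Store} (hB : Base m k' σ A b st) (e : ZMod 2)
    (he : (st.reg 32 : ZMod 2) = e) :
    Spec ν orc noiseProg st (6 * k' + 10) (addNoise ν k' e) fun e' st' =>
      (st'.reg 32 : ZMod 2) = e' ∧ Frame 32 [] st st' := by
  refine SpecL.time (Spec.seqs (SpecL.add (T := k' * (3 + 2 + 1) + 1)
    (SpecL.mono (Spec.loop_iter (T := 3)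
      (I := fun i (e : ZMod 2) st' => st'.reg 33 = i ∧ (st'.reg 32 : ZMod 2) = e ∧
        Frame 32 [] st st')
      (fun i _ st h => h.1) ?_ _ e _ ?_) ?_))) ?_
  · intro i e st' ⟨h1, h2, h3⟩
    have e7 := (hB.frame h3 (by simp) (by simp) (by simp)).r7
    refine SpecL.time (T := 1 + (1 + (1 + 0))) ?_ le_rfl
    refine SpecL.noise fun v => SpecL.add (SpecL.sub (SpecL.nil ⟨?_, ?_, ?_⟩))
    · simp [h1, e7]
    · simp [h2]
    · exact ((h3.setReg _ (by simp)).setReg _ (by simp)).setReg _ (by simp)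
  · refine ⟨by simp [hB.r8, hB.r10], by simpa using he, ?_⟩
    exact (Frame.refl _ _ _).setReg _ (by simp)
  · rintro S st' ⟨h1, h2, h3⟩
    exact ⟨h2, h3⟩
  · simp only [List.length_cons, List.length_nil]; omega

/-! ### Completion of a row -/

/-- The coordinate `c` does not belong to block `j`. -/
def Outside {k n : ℕ} (j : Fin k) (c : Fin (k * n)) : Prop := (finProdFinEquiv.symm c).1 ≠ j

instance {k n : ℕ} (j : Fin k) (c : Fin (k * n)) : Decidable (Outside j c) :=
  inferInstanceAs (Decidable ((finProdFinEquiv.symm c).1 ≠ j))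

/-- The weight outside block `j` of the coordinates from `i` on. -/
def tailWeight {k n : ℕ} (j : Fin k) (v : Fin (k * n) → ZMod 2) (i : ℕ) : ℕ :=
  ∑ c ∈ Finset.univ.filter (fun c : Fin (k * n) => i ≤ c), if Outside j c then (v c).val else 0

/-- The number of coordinates below `i` outside block `j`. -/
def headCount {k : ℕ} (n : ℕ) (j : Fin k) (i : ℕ) : ℕ :=
  (Finset.univ.filter fun c : Fin (k * n) => c.val < i ∧ Outside j c).card

/-- Law of coordinate `c` of a row when block `j` is `a` and the remaining coordinates have total
weight `R`. -/
def fillLaw {k n : ℕ} (j : Fin k) (a : Fin n → ZMod 2) (R : ℕ) (c : Fin (k * n))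
    (v : Fin (k * n) → ZMod 2) : PMF (ZMod 2) :=
  if Outside j c then
    (coin (R - tailWeight j v (c + 1)) (headCount n j c)).map fun t => if t then 1 else 0
  else PMF.pure (a (finProdFinEquiv.symm c).2)

/-- The inner product outside block `j`, restricted to the coordinates from `i` on. -/
def tailDot {k n : ℕ} (j : Fin k) (S v : Fin (k * n) → ZMod 2) (i : ℕ) : ZMod 2 :=
  ∑ c ∈ Finset.univ.filter (fun c : Fin (k * n) => i ≤ c), if Outside j c then S c * v c else 0

theorem headCount_succ {k n : ℕ} (j : Fin k) (c : Fin (k * n)) :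
    headCount n j (c + 1) = (if Outside j c then 1 else 0) + headCount n j c := by
  unfold headCount
  split_ifs with h
  · have : Finset.univ.filter (fun c' : Fin (k * n) => c'.val < c.val + 1 ∧ Outside j c') =
        insert c (Finset.univ.filter (fun c' : Fin (k * n) => c'.val < c ∧ Outside j c')) := by
      ext c'
      simp only [Finset.mem_filter, Finset.mem_univ, true_and, Finset.mem_insert]
      constructor
      · rintro ⟨h1, h2⟩
        rcases Nat.lt_succ_iff_lt_or_eq.1 h1 with h3 | h3
        · exact Or.inr ⟨h3, h2⟩
        · exact Or.inl (Fin.ext h3)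
      · rintro (rfl | ⟨h1, h2⟩)
        · exact ⟨Nat.lt_succ_self _, h⟩
        · exact ⟨Nat.lt_succ_of_lt h1, h2⟩
    rw [this, Finset.card_insert_of_notMem (by simp), add_comm]
  · rw [zero_add]
    congr 1
    ext c'
    simp only [Finset.mem_filter, Finset.mem_univ, true_and]
    constructor
    · rintro ⟨h1, h2⟩
      refine ⟨?_, h2⟩
      rcases Nat.lt_succ_iff_lt_or_eq.1 h1 with h3 | h3
      · exact h3
      · exact absurd ((Fin.ext h3 : c' = c) ▸ h2) h
    · rintro ⟨h1, h2⟩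
      exact ⟨Nat.lt_succ_of_lt h1, h2⟩

theorem headCount_top (j : Fin (k' + 1)) : headCount n j ((k' + 1) * n) = k' * n := by
  unfold headCount
  have : Finset.univ.filter (fun c : Fin ((k' + 1) * n) => c.val < (k' + 1) * n ∧ Outside j c) =
      ((Finset.univ.erase j) ×ˢ (Finset.univ : Finset (Fin n))).map
        finProdFinEquiv.toEmbedding := by
    ext c
    simp only [Finset.mem_filter, Finset.mem_univ, true_and, c.2, Finset.mem_map_equiv,
      Finset.mem_product, Finset.mem_erase, and_true]
    rfl
  rw [this, Finset.card_map, Finset.card_product, Finset.card_erase_of_mem (Finset.mem_univ _)]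
  simp

theorem outside_iff {k n : ℕ} (j : Fin k) (c : Fin (k * n)) :
    Outside j c ↔ ¬ (j.val * n ≤ c ∧ c.val < j * n + n) := by
  have hn : 0 < n := by
    rcases Nat.eq_zero_or_pos n with rfl | h
    · exact absurd c.2 (by simp)
    · exact h
  have h1 : (finProdFinEquiv.symm c).1.val = c.val / n := rfl
  rw [Outside, ne_eq, Fin.ext_iff, h1, Nat.div_eq_iff hn]
  omega

/-- Coordinate `c = (register 37) - 1` of the row with index in register `18`: copied from row
(register `20`) of the instance inside block `j`, drawn outside. -/
def fillBody : List Prog :=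
  [.instr (.sub 38 37 7), .instr (.sub 40 38 17), .instr (.add 41 38 7), .instr (.sub 41 41 17),
    .instr (.sub 42 0 40), .ite 41 (.ite 42 inBlock outBlock) outBlock]
where
  inBlock : Prog := seqs [.instr (.load 43 0 20 40), .instr (.store 2 18 38 43)]
  outBlock : Prog := seqs [.instr (.sub 44 36 7), .instr (.rand 45 44), .instr (.sub 46 35 45),
    .ite 46 (.instr (.const 43 1)) (.instr (.const 43 0)), .instr (.sub 36 36 7),
    .instr (.sub 35 35 43), .instr (.load 47 6 38 8), .ite 43 (.instr (.add 32 32 47)) skip,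
    .instr (.store 2 18 38 43)]

/-- Invariant of the completion of row `i₀`. -/
structure FillInv (j : Fin (k' + 1)) (S : Fin ((k' + 1) * n) → ZMod 2) (R i₀ : ℕ) (e : ZMod 2)
    (st : Store) (i : ℕ) (v : Fin ((k' + 1) * n) → ZMod 2) (st' : Store) : Prop where
  cnt : st'.reg 37 = i
  le : i ≤ (k' + 1) * n
  bit : (st'.reg 32 : ZMod 2) = e + tailDot j S v i
  ones : st'.reg 35 = R - tailWeight j v i
  left : st'.reg 36 = headCount n j i
  row : ∀ c : Fin ((k' + 1) * n), i ≤ c → st'.arr 2 i₀ c = (v c).val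
  other : ∀ x, x ≠ i₀ → ∀ c, st'.arr 2 x c = st.arr 2 x c
  frame : Frame 32 [2] st st'

theorem tailWeight_update {k n : ℕ} (j : Fin k) (v : Fin (k * n) → ZMod 2) {i : ℕ}
    (hi : i < k * n) (x : ZMod 2) : tailWeight j (Function.update v ⟨i, hi⟩ x) i =
      (if Outside j ⟨i, hi⟩ then x.val else 0) + tailWeight j v (i + 1) :=
  sum_filter_le_update (fun c (x : ZMod 2) => if Outside j c then x.val else 0) v hi x

theorem tailDot_update {k n : ℕ} (j : Fin k) (S v : Fin (k * n) → ZMod 2) {i : ℕ}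
    (hi : i < k * n) (x : ZMod 2) : tailDot j S (Function.update v ⟨i, hi⟩ x) i =
      (if Outside j ⟨i, hi⟩ then S ⟨i, hi⟩ * x else 0) + tailDot j S v (i + 1) :=
  sum_filter_le_update (fun c (x : ZMod 2) => if Outside j c then S c * x else 0) v hi x

theorem fill_inBlock {st st' : Store} (hB : Base m k' σ A b st) {j : Fin (k' + 1)}
    {S : Fin ((k' + 1) * n) → ZMod 2} {R i₀ : ℕ} {e : ZMod 2} {i : ℕ}
    {v : Fin ((k' + 1) * n) → ZMod 2} (h : FillInv j S R i₀ e st (i + 1) v st') (r : Fin M)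
    (h18 : st.reg 18 = i₀) (h20 : st.reg 20 = r) (hi : i < (k' + 1) * n)
    (hout : ¬ Outside j ⟨i, hi⟩) {s : Store} (hs : Frame 37 [] st' s) (h37 : s.reg 37 = i + 1)
    (h38 : s.reg 38 = i) (h40 : s.reg 40 = (finProdFinEquiv.symm (⟨i, hi⟩ : Fin _)).2.val) :
    SpecL ν orc [fillBody.inBlock, .instr (.sub 37 37 7)] s 25
      ((fillLaw j (A r) R ⟨i, hi⟩ v).map (Function.update v ⟨i, hi⟩))
      (FillInv j S R i₀ e st i) := by
  have hfr := h.frame.trans hs (c := 32) (U := [2]) (by simp) (by simp) (by simp) (by simp)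
  have hB' := hB.frame hfr (by simp) (by simp) (by simp)
  have e7 := hB'.r7
  have e18 : s.reg 18 = i₀ := by rw [hfr.1 18 (by simp), h18]
  have e20 : s.reg 20 = r := by rw [hfr.1 20 (by simp), h20]
  have ea : s.arr 2 = st'.arr 2 := hs.2 2 (by simp)
  rw [fillLaw, if_neg hout, PMF.pure_map]
  refine SpecL.time (SpecL.seqs_cons (SpecL.load (SpecL.store (SpecL.sub (SpecL.nil ?_))))) (by simp)
  set t := (finProdFinEquiv.symm (⟨i, hi⟩ : Fin ((k' + 1) * n))).2
  have hA : s.arr 0 r t = (A r t).val := hB'.a0 r t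
  constructor
  · simp [h37, e7]
  · omega
  · rw [tailDot_update, if_neg hout, zero_add]
    simp [hs.1 32 (by simp), h.bit]
  · rw [tailWeight_update, if_neg hout, zero_add]
    simp [hs.1 35 (by simp), h.ones]
  · have := headCount_succ j (⟨i, hi⟩ : Fin ((k' + 1) * n))
    rw [if_neg hout, zero_add] at this
    simp [hs.1 36 (by simp), h.left, this]
  · intro c hc
    by_cases hci : c.val = i
    · have : c = ⟨i, hi⟩ := Fin.ext hci
      rw [this, Function.update_self]
      simp [e18, e20, h38, h40, hA]
    · have : c ≠ ⟨i, hi⟩ := fun h => hci (by rw [h])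
      rw [Function.update_of_ne this]
      simp [e18, h38, hci, ea, h.row c (by omega)]
  · intro x hx c
    simp [e18, hx, ea, h.other x hx c]
  · exact ((hfr.setReg _ (by simp)).setCell _ _ _ (by simp)).setReg _ (by simp)

theorem fill_outBlock {st st' : Store} (hB : Base m k' σ A b st) {j : Fin (k' + 1)}
    {S : Fin ((k' + 1) * n) → ZMod 2} {R i₀ : ℕ} {e : ZMod 2} {i : ℕ}
    {v : Fin ((k' + 1) * n) → ZMod 2} (h : FillInv j S R i₀ e st (i + 1) v st') (a : Fin n → ZMod 2)
    (h18 : st.reg 18 = i₀) (hS : ∀ c : Fin ((k' + 1) * n), st.arr 6 c 0 = (S c).val)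
    (hi : i < (k' + 1) * n)
    (hout : Outside j ⟨i, hi⟩) {s : Store} (hs : Frame 37 [] st' s) (h37 : s.reg 37 = i + 1)
    (h38 : s.reg 38 = i) :
    SpecL ν orc [fillBody.outBlock, .instr (.sub 37 37 7)] s 25
      ((fillLaw j a R ⟨i, hi⟩ v).map (Function.update v ⟨i, hi⟩))
      (FillInv j S R i₀ e st i) := by
  have hfr := h.frame.trans hs (c := 32) (U := [2]) (by simp) (by simp) (by simp) (by simp)
  have hB' := hB.frame hfr (by simp) (by simp) (by simp)
  have e7 := hB'.r7
  have e8 := hB'.r8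
  have e18 : s.reg 18 = i₀ := by rw [hfr.1 18 (by simp), h18]
  have ea : s.arr 2 = st'.arr 2 := hs.2 2 (by simp)
  have ea6 : s.arr 6 i 0 = (S ⟨i, hi⟩).val := by rw [hfr.2 6 (by simp)]; exact hS ⟨i, hi⟩
  have e32 : (s.reg 32 : ZMod 2) = e + tailDot j S v (i + 1) := by
    rw [hs.1 32 (by simp), h.bit]
  have e35 : s.reg 35 = R - tailWeight j v (i + 1) := by rw [hs.1 35 (by simp), h.ones]
  have e36 : s.reg 36 = headCount n j i + 1 := by
    have := headCount_succ j (⟨i, hi⟩ : Fin ((k' + 1) * n))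
    rw [if_pos hout] at this
    rw [hs.1 36 (by simp), h.left, this, add_comm]
  have fin : ∀ (s' : Store) (x : ZMod 2), Frame 32 [2] st s' → s'.reg 37 = i →
      (s'.reg 32 : ZMod 2) = e + (S ⟨i, hi⟩ * x + tailDot j S v (i + 1)) →
      s'.reg 35 = R - tailWeight j v (i + 1) - x.val → s'.reg 36 = headCount n j i →
      (∀ y c, s'.arr 2 y c = if y = i₀ ∧ c = i then x.val else st'.arr 2 y c) →
      FillInv j S R i₀ e st i (Function.update v ⟨i, hi⟩ x) s' := by
    intro s' x g0 g1 g2 g3 g4 g5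
    constructor
    · exact g1
    · omega
    · rw [tailDot_update, if_pos hout, g2]
    · rw [tailWeight_update, if_pos hout, g3, Nat.sub_sub, add_comm x.val]
    · exact g4
    · intro c hc
      rw [g5]
      by_cases hci : c.val = i
      · have : c = ⟨i, hi⟩ := Fin.ext hci
        rw [this, Function.update_self, if_pos (by simp)]
      · have : c ≠ ⟨i, hi⟩ := fun h => hci (by rw [h])
        rw [Function.update_of_ne this, if_neg (by simp [hci]), h.row c (by omega)]
    · intro x hx c
      rw [g5, if_neg (by simp [hx]), h.other x hx c]
    · exact g0
  rw [fillLaw, if_pos hout, PMF.map_comp, coin, PMF.map_comp]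
  refine SpecL.time (SpecL.seqs_cons (SpecL.sub (SpecL.rand (r := headCount n j i) ?_
    fun t => SpecL.sub (SpecL.ite (T := 1 + (1 + (1 + (1 + (1 + (1 + (1 + (1 + 0)))))))) ?_ ?_)))) ?_
  · simp [e36, e7]
  · intro ht
    have ht' : t.val < R - tailWeight j v (i + 1) := by
      simp [e35] at ht; omega
    refine SpecL.const (SpecL.sub (SpecL.sub (SpecL.load (SpecL.ite (fun _ => SpecL.add
      (SpecL.store (SpecL.sub (SpecL.nil ?_)))) fun h => absurd h (by simp)))))
    simp only [Function.comp_apply, ht', decide_true, if_true]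
    refine fin _ 1 ?_ ?_ ?_ ?_ ?_ ?_
    · exact (((((((((hfr.setReg _ (by simp)).setReg _ (by simp)).setReg _ (by simp)).setReg _
        (by simp)).setReg _ (by simp)).setReg _ (by simp)).setReg _ (by simp)).setReg _
        (by simp)).setCell _ _ _ (by simp)).setReg _ (by simp)
    · simp [h37, e7]
    · simp [h38, e8, ea6, e32]; ring
    · simp [e35]; rfl
    · simp [e36, e7]
    · intro y c; simp [e18, h38, ea]; rfl
  · intro ht
    have ht' : ¬ t.val < R - tailWeight j v (i + 1) := by
      simp [e35] at ht; omega
    refine SpecL.const (SpecL.sub (SpecL.sub (SpecL.load (SpecL.ite (fun h => absurd h (by simp))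
      fun _ => SpecL.skip_cons (SpecL.store (SpecL.sub (SpecL.nil ?_)))))))
    simp only [Function.comp_apply, ht', decide_false, Bool.false_eq_true, if_false]
    refine fin _ 0 ?_ ?_ ?_ ?_ ?_ ?_
    · exact (((((((((hfr.setReg _ (by simp)).setReg _ (by simp)).setReg _ (by simp)).setReg _
        (by simp)).setReg _ (by simp)).setReg _ (by simp)).setReg _ (by simp)).setReg _
        (by simp)).setCell _ _ _ (by simp)).setReg _ (by simp)
    · simp [h37, e7]
    · simp [e32]
    · simp [e35]
    · simp [e36, e7]
    · intro y c; simp [e18, h38, ea]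
  · simp

theorem fillBody_spec {st st' : Store} (hB : Base m k' σ A b st) {j : Fin (k' + 1)}
    {S : Fin ((k' + 1) * n) → ZMod 2} {R i₀ : ℕ} {e : ZMod 2} {i : ℕ}
    {v : Fin ((k' + 1) * n) → ZMod 2} (h : FillInv j S R i₀ e st (i + 1) v st') (r : Fin M)
    (h17 : st.reg 17 = j * n)
    (h18 : st.reg 18 = i₀) (h20 : st.reg 20 = r)
    (hS : ∀ c : Fin ((k' + 1) * n), st.arr 6 c 0 = (S c).val) (hi : i < (k' + 1) * n) :
    SpecL ν orc (fillBody ++ [.instr (.sub 37 37 7)]) st' 40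
      ((fillLaw j (A r) R ⟨i, hi⟩ v).map (Function.update v ⟨i, hi⟩))
      (FillInv j S R i₀ e st i) := by
  have hB' := hB.frame h.frame (by simp) (by simp) (by simp)
  have e0 := hB'.r0
  have e7 := hB'.r7
  have e17 : st'.reg 17 = j * n := by rw [h.frame.1 17 (by simp), h17]
  have e37 := h.cnt
  have hiff := outside_iff j (⟨i, hi⟩ : Fin ((k' + 1) * n))
  have ht : (finProdFinEquiv.symm (⟨i, hi⟩ : Fin ((k' + 1) * n))).2.val = i % n := rfl
  refine SpecL.time (T := 1 + (1 + (1 + (1 + (1 + (1 + (1 + 25))))))) ?_ (by simp)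
  refine SpecL.sub (SpecL.sub (SpecL.add (SpecL.sub (SpecL.sub ?_))))
  have hs : Frame 37 [] st' (((((st'.setReg 38 i).setReg 40 (i - j * n)).setReg 41 (i + 1)).setReg
      41 (i + 1 - j * n)).setReg 42 (n - (i - j * n))) :=
    (((((Frame.refl _ _ _).setReg _ (by simp)).setReg _ (by simp)).setReg _ (by simp)).setReg _
      (by simp)).setReg _ (by simp)
  simp only [Store.reg_setReg, e37, e7, e17, e0, Nat.add_sub_cancel, Nat.reduceEqDiff, if_true,
    if_false]
  have out : ∀ {T : ℕ}, 25 ≤ T → Outside j (⟨i, hi⟩ : Fin ((k' + 1) * n)) → SpecL ν orc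
      [fillBody.outBlock, .instr (.sub 37 37 7)] (((((st'.setReg 38 i).setReg 40
      (i - j * n)).setReg 41 (i + 1)).setReg 41 (i + 1 - j * n)).setReg 42 (n - (i - j * n))) T
      ((fillLaw j (A r) R ⟨i, hi⟩ v).map (Function.update v ⟨i, hi⟩))
      (FillInv j S R i₀ e st i) := fun hT hout =>
    (fill_outBlock hB h (A r) h18 hS hi hout hs (by simp [e37]) (by simp)).time hT
  -- Registers `41` and `42` hold `i + 1 - jn` and `n - (i - jn)`. The first is nonzero exactly when
  -- `jn ≤ i`, and then the second exactly when `i < jn + n`; together they test membership in block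
  -- `j`.
  refine SpecL.ite (fun h1 => SpecL.ite (fun h2 => ?_) fun h2 => ?_) fun h1 => ?_
  · simp at h1 h2
    have hin : ¬ Outside j (⟨i, hi⟩ : Fin ((k' + 1) * n)) := by
      rw [hiff]; simp only [not_not]; omega
    refine fill_inBlock hB h r h18 h20 hi hin hs (by simp [e37]) (by simp) ?_
    rw [ht]
    simp only [Store.reg_setReg, Nat.reduceEqDiff, if_true, if_false]
    have h3 : j.val * n ≤ i := by omega
    have : i = i - j * n + n * j := by rw [mul_comm n]; exact (Nat.sub_add_cancel h3).symm
    conv_rhs => rw [this]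
    rw [Nat.add_mul_mod_self_left, Nat.mod_eq_of_lt (by omega)]
  · simp at h2
    exact out le_rfl (by rw [hiff]; simp only [not_and, not_lt]; omega)
  · simp at h1
    exact out (by simp) (by rw [hiff]; simp only [not_and, not_lt]; omega)

end Routines

/-! ### The rows and labels of the query -/

section Routines

variable {ν : PMF (ZMod 2)} {orc : RawOracle} {n M m k' σ : ℕ}
  {A : Matrix (Fin M) (Fin n) (ZMod 2)} {b : Fin M → ZMod 2}

/-- Law of a row of the query, with its label, that contains the sample `(a, b)` in block `j`; the
secret is `S` outside this block. -/
def rowLaw (ν : PMF (ZMod 2)) {n : ℕ} (k' σ : ℕ) (j : Fin (k' + 1))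
    (S : Fin ((k' + 1) * n) → ZMod 2) (a : Fin n → ZMod 2) (b : ZMod 2) :
    PMF ((Fin ((k' + 1) * n) → ZMod 2) × ZMod 2) :=
  (addNoise ν k' b).bind fun e =>
    (drawAll (fillLaw j a ((k' + 1) * σ - hammingNorm a)) ((k' + 1) * n) 0).map
      fun v => (v, e + tailDot j S v 0)

/-- Register `32` accumulates the label: the label of the sample, the additional noise, and the
inner product with the random secret outside the planted block. -/
def rowProg : List Prog :=
  [.instr (.load 20 7 18 8), weightProg, .instr (.load 32 1 20 8), noiseProg,
    .instr (.sub 35 12 21), .instr (.add 36 14 8), .instr (.add 37 9 8), loop 37 fillBody,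
    .instr (.store 3 18 8 32)]

/-- Row `i` of the query in the store. -/
def HoldsRow {d : ℕ} (st : Store) (i : ℕ) (q : (Fin d → ZMod 2) × ZMod 2) : Prop :=
  (∀ c : Fin d, st.arr 2 i c = (q.1 c).val) ∧ (st.arr 3 i 0 : ZMod 2) = q.2

theorem rowProg_spec {st : Store} (hB : Base m k' σ A b st) {j : Fin (k' + 1)}
    {S : Fin ((k' + 1) * n) → ZMod 2} {i₀ : ℕ} (r : Fin M) (h17 : st.reg 17 = j * n)
    (h18 : st.reg 18 = i₀) (h7 : st.arr 7 i₀ 0 = r)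
    (hS : ∀ c : Fin ((k' + 1) * n), st.arr 6 c 0 = (S c).val) (L : List Prog)
    (hL : L = [.instr (.sub 19 19 7)]) :
    SpecL ν orc (rowProg ++ L) st (60 * ((k' + 1) * n) + 8 * n + 6 * k' + 100)
      (rowLaw ν k' σ j S (A r) (b r)) fun q st' => HoldsRow st' i₀ q ∧
        (∀ x, x ≠ i₀ → (∀ c, st'.arr 2 x c = st.arr 2 x c) ∧ st'.arr 3 x 0 = st.arr 3 x 0) ∧
        st'.reg 19 = st.reg 19 - 1 ∧ Frame 19 [2, 3] st st' := by
  subst hL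
  have e8 := hB.r8
  refine SpecL.time (T := 1 + ((8 * n + 10) + (1 + ((6 * k' + 10) + (1 + (1 + (1 +
    (((k' + 1) * n * (40 + fillBody.length + 1) + 1) + (1 + (1 + 0)))))))))) ?_ ?_
  rotate_left
  · simp only [fillBody, List.length_cons, List.length_nil]; omega
  refine SpecL.load ?_
  rw [h18, e8, h7]
  have hf1 : Frame 20 [] st (st.setReg 20 r) := (Frame.refl _ _ _).setReg _ (by simp)
  refine SpecL.det_cons (weightProg_spec (hB.frame hf1 (by simp) (by simp) (by simp)) r (by simp))
    fun st2 h2 => ?_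
  have hf2 := hf1.trans h2.2 (c := 20) (U := []) le_rfl (by simp) (by simp) (by simp)
  have hB2 := hB.frame hf2 (by simp) (by simp) (by simp)
  have g20 : st2.reg 20 = r := by rw [h2.2.1 20 (by simp)]; simp
  refine SpecL.load ?_
  rw [g20, hB2.r8, hB2.a1]
  have hf3 := hf2.setReg (x := 32) (b r).val (by simp)
  have hf23 : Frame 22 [] st2 (st2.setReg 32 (b r).val) := (Frame.refl _ _ _).setReg _ (by simp)
  refine SpecL.cons (noiseProg_spec (hB.frame hf3 (by simp) (by simp) (by simp)) (b r) (by simp))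
    fun e st4 h4 => ?_
  have hf24 := hf23.trans h4.2 (c := 22) (U := []) le_rfl (by simp) (by simp) (by simp)
  have hf4 := hf2.trans hf24 (c := 20) (U := []) le_rfl (by simp) (by simp) (by simp)
  have hB4 := hB.frame hf4 (by simp) (by simp) (by simp)
  have g21 : st4.reg 21 = hammingNorm (A r) := by rw [hf24.1 21 (by simp), h2.1]
  have g20' : st4.reg 20 = r := by rw [hf24.1 20 (by simp), g20]
  refine SpecL.sub (SpecL.add (SpecL.add ?_))
  have e1 : st4.reg 12 - st4.reg 21 = (k' + 1) * σ - hammingNorm (A r) := by rw [hB4.r12, g21]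
  set R := (k' + 1) * σ - hammingNorm (A r)
  have e2 : (st4.setReg 35 R).reg 14 + (st4.setReg 35 R).reg 8 = k' * n := by
    simp [hB4.r14, hB4.r8]
  have e3 : ((st4.setReg 35 R).setReg 36 (k' * n)).reg 9 +
      ((st4.setReg 35 R).setReg 36 (k' * n)).reg 8 = (k' + 1) * n := by
    simp [hB4.r9, hB4.r8]
  rw [e1, e2, e3]
  set st5 := ((st4.setReg 35 R).setReg 36 (k' * n)).setReg 37 ((k' + 1) * n) with hst5
  have hf45 : Frame 33 [] st4 st5 :=
    (((Frame.refl _ _ _).setReg _ (by simp)).setReg _ (by simp)).setReg _ (by simp)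
  have hf5 := hf4.trans hf45 (c := 20) (U := []) le_rfl (by simp) (by simp) (by simp)
  have hB5 := hB.frame hf5 (by simp) (by simp) (by simp)
  have key : Spec ν orc (loop 37 fillBody) st5 ((k' + 1) * n * (40 + fillBody.length + 1) + 1)
      (drawAll (fillLaw j (A r) R) ((k' + 1) * n) 0) (FillInv j S R i₀ e st5 0) := by
    refine Spec.loop_iter (I := fun i v st' => FillInv j S R i₀ e st5 i v st')
      (fun i v st' h => h.cnt) (fun i v st' h => ?_) _ _ _ ?_
    · have hi : i < (k' + 1) * n := by have := h.le; omega
      rw [dif_pos hi]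
      exact fillBody_spec hB5 h r (by rw [hf5.1 17 (by simp), h17])
        (by rw [hf5.1 18 (by simp), h18]) (by rw [hf45.1 20 (by simp), g20'])
        (fun c => by rw [hf5.2 6 (by simp)]; exact hS c) hi
    · constructor
      · simp [hst5]
      · exact le_rfl
      · rw [tailDot, sum_filter_ge_eq_zero]
        simp [hst5, h4.1]
      · rw [tailWeight, sum_filter_ge_eq_zero]; simp [hst5]
      · rw [headCount_top]; simp [hst5]
      · intro c hc; exact absurd c.2 (by omega)
      · intro x _ c; rfl
      · exact Frame.refl _ _ _
  have := SpecL.cons (κ := fun v => PMF.pure (v, e + tailDot j S v 0)) (T' := 1 + (1 + 0))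
    (L := [.instr (.store 3 18 8 32), .instr (.sub 19 19 7)])
    (R' := fun q st' => HoldsRow st' i₀ q ∧
        (∀ x, x ≠ i₀ → (∀ c, st'.arr 2 x c = st.arr 2 x c) ∧ st'.arr 3 x 0 = st.arr 3 x 0) ∧
        st'.reg 19 = st.reg 19 - 1 ∧ Frame 19 [2, 3] st st') key fun v st6 h6 => ?_
  · exact this
  · have hf6 := hf5.trans h6.frame (c := 20) (U := [2, 3]) le_rfl (by simp) (by simp) (by simp)
    have hB6 := hB.frame hf6 (by simp) (by simp) (by simp)
    have g18 : st6.reg 18 = i₀ := by rw [hf6.1 18 (by simp), h18]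
    have g8 := hB6.r8
    have g7 := hB6.r7
    have g3 : st6.arr 3 = st.arr 3 := by
      rw [h6.frame.2 3 (by simp), hf5.2 3 (by simp)]
    refine SpecL.store (SpecL.sub (SpecL.nil ⟨⟨?_, ?_⟩, fun x hx => ⟨fun c => ?_, ?_⟩, ?_, ?_⟩))
    · intro c; simp [h6.row c (Nat.zero_le _)]
    · simp [g18, g8, h6.bit]
    · simp [h6.other x hx c, hf5.2 2 (by simp)]
    · simp [g18, g8, hx, g3]
    · simp [g7, hf6.1 19 (by simp)]
    · exact ((hf6.mono (c := 19) (by simp) (by simp)).setCell _ _ _ (by simp)).setReg _ (by simp)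

/-- Produce all rows of the query. -/
def rowsProg : Prog :=
  seqs [.instr (.add 19 1 8), loop 19 (.instr (.sub 18 19 7) :: rowProg)]

theorem rowsProg_spec {st : Store} (hB : Base m k' σ A b st) {j : Fin (k' + 1)}
    {S : Fin ((k' + 1) * n) → ZMod 2} (u : Fin m → Fin M) (h17 : st.reg 17 = j * n)
    (h7 : ∀ x : Fin m, st.arr 7 x 0 = u x)
    (hS : ∀ c : Fin ((k' + 1) * n), st.arr 6 c 0 = (S c).val) :
    Spec ν orc rowsProg st (m * (60 * ((k' + 1) * n) + 8 * n + 6 * k' + 120) + 10)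
      (drawAll (fun i _ => rowLaw ν k' σ j S (A (u i)) (b (u i))) m 0) fun Q st' =>
        (∀ i : Fin m, HoldsRow st' i (Q i)) ∧ Frame 18 [2, 3] st st' := by
  refine SpecL.time (Spec.seqs (SpecL.add (T := m * (1 + (60 * ((k' + 1) * n) + 8 * n + 6 * k' + 100)
      + 10 + 1) + 1)
    (SpecL.mono (Spec.loop_iter (T := 1 + (60 * ((k' + 1) * n) + 8 * n + 6 * k' + 100))
      (I := fun i (Q : Fin m → (Fin ((k' + 1) * n) → ZMod 2) × ZMod 2) st' => st'.reg 19 = i ∧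
        i ≤ m ∧ (∀ x : Fin m, i ≤ x → HoldsRow st' x (Q x)) ∧ Frame 18 [2, 3] st st')
      (fun i _ st h => h.1) ?_ _ 0 _ ?_) ?_))) ?_
  · intro i Q st' ⟨h1, h2, h3, h4⟩
    have hB' := hB.frame h4 (by simp) (by simp) (by simp)
    rw [dif_pos (by omega : i < m)]
    refine SpecL.sub ?_
    rw [h1, hB'.r7, Nat.add_sub_cancel]
    have hf := (Frame.refl 18 [] st').setReg (x := 18) i le_rfl
    have hf' := h4.trans hf (c := 18) (U := [2, 3]) le_rfl le_rfl (by simp) (by simp)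
    refine (rowProg_spec (i₀ := i) (j := j) (S := S) (hB'.frame hf (by simp) (by simp) (by simp)) (u ⟨i, by omega⟩) ?_ (by simp)
      ?_ ?_ _ rfl).map _ ?_
    · rw [hf'.1 17 (by simp), h17]
    · rw [hf'.2 7 (by simp)]; exact h7 ⟨i, by omega⟩
    · intro c; rw [hf'.2 6 (by simp)]; exact hS c
    · rintro q st2 ⟨g1, g2, g3, g4⟩
      refine ⟨?_, by omega, fun x hx => ?_, ?_⟩
      · rw [g3]; simp [h1]
      · by_cases hxi : x.val = i
        · have : x = ⟨i, by omega⟩ := Fin.ext hxi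
          rw [this, Function.update_self]
          exact g1
        · have hne : x ≠ ⟨i, by omega⟩ := fun h => hxi (by rw [h])
          rw [Function.update_of_ne hne]
          have h5 := h3 x (by omega)
          obtain ⟨p1, p2⟩ := g2 x hxi
          refine ⟨fun c => ?_, ?_⟩
          · rw [p1 c]; exact h5.1 c
          · rw [p2]; exact h5.2
      · exact hf'.trans g4 le_rfl (by simp) (by simp) (by simp)
  · refine ⟨by simp [hB.r8, hB.r1], le_rfl, fun c hc => absurd c.2 (by omega), ?_⟩
    exact (Frame.refl _ _ _).setReg _ (by simp)
  · rintro Q st' ⟨h1, h2, h3, h4⟩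
    exact ⟨fun i => h3 i (Nat.zero_le _), h4⟩
  · have := Nat.mul_le_mul_left m (show 1 + (60 * ((k' + 1) * n) + 8 * n + 6 * k' + 100) + 10 + 1 ≤
      60 * ((k' + 1) * n) + 8 * n + 6 * k' + 120 by omega)
    simp only [List.length_cons, List.length_nil]; omega

/-! ### The oracle call -/

theorem query_spec {d : ℕ} (O : Solver m d) (st : Store) (Q : Fin m → (Fin d → ZMod 2) × ZMod 2)
    (hQ : ∀ i : Fin m, HoldsRow st i (Q i)) :
    Spec ν (rawOracle O) (.instr .query) st 1 (O (Matrix.of fun i => (Q i).1) fun i => (Q i).2)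
      fun g st' => (∀ c : Fin d, st'.arr 4 c 0 = (g c).val) ∧ Frame 60 [4] st st' := by
  refine Spec.instr (fun g => { st with arr := fun a i j =>
    if a = 4 ∧ j = 0 then (if h : i < d then (g ⟨i, h⟩).val else 0) else st.arr a i j }) ?_ ?_
  · simp only [Instr.exec, rawOracle]
    rw [PMF.map_comp]
    have e1 : (Matrix.of fun (i : Fin m) (c : Fin d) => (st.arr 2 i c : ZMod 2)) =
        Matrix.of fun i => (Q i).1 := by
      ext i c
      simp [(hQ i).1 c]
    have e2 : (fun i : Fin m => (st.arr 3 i 0 : ZMod 2)) = fun i => (Q i).2 := by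
      funext i; exact (hQ i).2
    rw [e1, e2]
    rfl
  · intro g
    refine ⟨fun c => by simp, fun _ _ => rfl, fun a ha => ?_⟩
    funext i j
    have : a ≠ 4 := by simpa using ha
    simp [this]

/-! ### Verification of a candidate -/

/-- Toggle the bit in register `24` if both factors are nonzero. -/
def dotBody : List Prog :=
  [.instr (.sub 26 25 7), .instr (.load 27 0 23 26), .instr (.add 28 17 26),
    .instr (.load 29 4 28 8), .ite 27 (.ite 29 (.instr (.sub 24 7 24)) skip) skip]

def distBody : List Prog :=
  [.instr (.sub 23 22 7), .instr (.load 24 1 23 8), .instr (.add 25 0 8), loop 25 dotBody,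
    .instr (.add 21 21 24)]

/-- Register `21` becomes the distance of the candidate from the labels. -/
def distProg : Prog := seqs [.instr (.const 21 0), .instr (.add 22 4 8), loop 22 distBody]

theorem dot_spec {st : Store} (hB : Base m k' σ A b st) (r : Fin M) (h23 : st.reg 23 = r)
    {o : ℕ} (h17 : st.reg 17 = o) (g : Fin n → ZMod 2)
    (hg : ∀ t : Fin n, st.arr 4 (o + t) 0 = (g t).val) (e : ZMod 2) (he : st.reg 24 = e.val)
    (h25 : st.reg 25 = n) :
    Det ν orc (loop 25 dotBody) st (n * (9 + dotBody.length + 1) + 1) fun st' =>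
      st'.reg 24 = (A r ⬝ᵥ g + e).val ∧ Frame 24 [] st st' := by
  refine SpecL.mono (Spec.loop_det (T := 9)
      (I := fun i st' => st'.reg 25 = i ∧ i ≤ n ∧
        st'.reg 24 = (∑ t ∈ Finset.univ.filter (fun t : Fin n => i ≤ t), A r t * g t + e).val ∧
        Frame 24 [] st st')
      (fun i st h => h.1) ?_ n _ ?_) ?_
  · intro i st' ⟨h1, h2, h3, h4⟩
    have hB' := hB.frame h4 (by simp) (by simp) (by simp)
    have e7 := hB'.r7
    have e8 := hB'.r8
    have hi : i < n := by omega
    have eA : st'.arr 0 r i = (A r ⟨i, hi⟩).val := hB'.a0 r ⟨i, hi⟩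
    have eg : st'.arr 4 (o + i) 0 = (g ⟨i, hi⟩).val := by
      rw [h4.2 4 (by simp)]; exact hg ⟨i, hi⟩
    have e23 : st'.reg 23 = r := by rw [h4.1 23 (by simp), h23]
    have e17 : st'.reg 17 = o := by rw [h4.1 17 (by simp), h17]
    have hfin : ∀ s : Store, s.reg 25 = i → Frame 24 [] st' s →
        s.reg 24 = (A r ⟨i, hi⟩ * g ⟨i, hi⟩ +
          (∑ t ∈ Finset.univ.filter (fun t : Fin n => i + 1 ≤ t), A r t * g t + e)).val →
        (s.reg 25 = i ∧ i ≤ n ∧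
        s.reg 24 = (∑ t ∈ Finset.univ.filter (fun t : Fin n => i ≤ t), A r t * g t + e).val ∧
        Frame 24 [] st s) := by
      intro s g1 g2 g3
      refine ⟨g1, by omega, ?_, h4.trans g2 le_rfl le_rfl (by simp) (by simp)⟩
      rw [sum_filter_le_eq_add _ hi, add_assoc]
      exact g3
    set x := A r ⟨i, hi⟩
    set y := g ⟨i, hi⟩
    set z := ∑ t ∈ Finset.univ.filter (fun t : Fin n => i + 1 ≤ t), A r t * g t + e
    have hx : ∀ x : ZMod 2, x.val ≠ 0 → x = 1 := by decide
    have hz : ∀ z : ZMod 2, (1 + z).val = 1 - z.val := by decide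
    refine SpecL.time (T := 1 + (1 + (1 + (1 + (1 + (1 + (1 + (1 + 0)))))))) ?_ (by simp)
    refine SpecL.sub (SpecL.load (SpecL.add (SpecL.load (SpecL.ite (fun g1 =>
      SpecL.ite (fun g2 => ?_) fun g2 => ?_) fun g1 => ?_))))
    · simp [h1, e7, e8, e17, e23, eA, eg] at g1 g2
      refine SpecL.sub (SpecL.sub (SpecL.nil (hfin _ ?_ ?_ ?_)))
      · simp [h1, e7]
      · exact ((((((Frame.refl _ _ _).setReg _ (by simp)).setReg _ (by simp)).setReg _
          (by simp)).setReg _ (by simp)).setReg _ (by simp)).setReg _ (by simp)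
      · rw [hx x (by simpa using g1), hx y (by simpa using g2), mul_one, hz]
        simp [h3, e7]
    · simp [h1, e7, e8, e17, e23, eA, eg] at g2
      refine SpecL.skip_cons (SpecL.sub (SpecL.nil (hfin _ ?_ ?_ ?_)))
      · simp [h1, e7]
      · exact ((((((Frame.refl _ _ _).setReg _ (by simp)).setReg _ (by simp)).setReg _
          (by simp)).setReg _ (by simp)).setReg _ (by simp)).setReg _ (by simp)
      · rw [show y = 0 by simpa using g2, mul_zero, zero_add]
        simp [h3]
    · simp [h1, e7, e8, e17, e23, eA, eg] at g1
      refine SpecL.time (T := 1 + (1 + 0)) (SpecL.skip_cons (SpecL.sub (SpecL.nil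
        (hfin _ ?_ ?_ ?_)))) (by simp)
      · simp [h1, e7]
      · exact ((((((Frame.refl _ _ _).setReg _ (by simp)).setReg _ (by simp)).setReg _
          (by simp)).setReg _ (by simp)).setReg _ (by simp)).setReg _ (by simp)
      · rw [show x = 0 by simpa using g1, zero_mul, zero_add]
        simp [h3]
  · refine ⟨h25, le_rfl, ?_, Frame.refl _ _ _⟩
    rw [sum_filter_ge_eq_zero, zero_add, he]
  · rintro _ st' ⟨h1, h2, h3, h4⟩
    refine ⟨?_, h4⟩
    rw [h3]
    simp [dotProduct]

theorem distProg_spec {st : Store} (hB : Base m k' σ A b st)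
    {o : ℕ} (h17 : st.reg 17 = o) (g : Fin n → ZMod 2)
    (hg : ∀ t : Fin n, st.arr 4 (o + t) 0 = (g t).val) :
    Det ν orc distProg st (M * (15 * n + 20) + 10) fun st' =>
      st'.reg 21 = hammingNorm (A *ᵥ g + b) ∧ Frame 21 [] st st' := by
  refine SpecL.time (Spec.seqs (SpecL.const (SpecL.add (T := M * (1 + (1 + (1 +
      ((n * (9 + dotBody.length + 1) + 1) + (1 + (1 + 0))))) + distBody.length + 1) + 1)
    (SpecL.mono (Spec.loop_det (T := 1 + (1 + (1 +
      ((n * (9 + dotBody.length + 1) + 1) + (1 + (1 + 0))))))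
      (I := fun i st' => st'.reg 22 = i ∧ i ≤ M ∧
        st'.reg 21 = ∑ r ∈ Finset.univ.filter (fun r : Fin M => i ≤ r), ((A *ᵥ g + b) r).val ∧
        Frame 21 [] st st')
      (fun i st h => h.1) ?_ M _ ?_) ?_)))) ?_
  · intro i st' ⟨h1, h2, h3, h4⟩
    have hB' := hB.frame h4 (by simp) (by simp) (by simp)
    have e7 := hB'.r7
    have e8 := hB'.r8
    have e0 := hB'.r0
    have hi : i < M := by omega
    refine SpecL.sub (SpecL.load (SpecL.add ?_))
    rw [h1, e7, Nat.add_sub_cancel]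
    have e1 : (st'.setReg 23 i).arr 1 ((st'.setReg 23 i).reg 23) ((st'.setReg 23 i).reg 8) =
        (b ⟨i, hi⟩).val := by
      have := hB'.a1 ⟨i, hi⟩
      simpa [e8] using this
    rw [e1]
    set s := (st'.setReg 23 i).setReg 24 (b ⟨i, hi⟩).val with hs
    have hfs : Frame 22 [] st' (s.setReg 25 (s.reg 0 + s.reg 8)) :=
      (((Frame.refl _ _ _).setReg _ (by simp)).setReg _ (by simp)).setReg _ (by simp)
    have hf2 := h4.trans hfs (c := 21) (U := []) le_rfl (by simp) (by simp) (by simp)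
    refine SpecL.det_cons (dot_spec (hB.frame hf2 (by simp) (by simp) (by simp)) ⟨i, hi⟩
      (by simp [hs]) (by rw [hf2.1 17 (by simp), h17]) g
      (fun t => by rw [hf2.2 4 (by simp)]; exact hg t) (b ⟨i, hi⟩) (by simp [hs])
      (by simp [hs, e0, e8])) fun s2 h5 => ?_
    have hf3 := hfs.trans h5.2 (c := 22) (U := []) le_rfl (by simp) (by simp) (by simp)
    have g7 : s2.reg 7 = 1 := by rw [hf3.1 7 (by simp), e7]
    have g21 : s2.reg 21 = st'.reg 21 := by rw [hf3.1 21 (by simp)]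
    have g22 : s2.reg 22 = i + 1 := by rw [h5.2.1 22 (by simp)]; simp [hs, h1]
    refine SpecL.add (SpecL.sub (SpecL.nil ⟨?_, by omega, ?_, ?_⟩))
    · simp [g22, g7]
    · rw [sum_filter_le_eq_add _ hi]
      simp [g21, h3, h5.1, Matrix.mulVec, add_comm]
    · have := h4.trans hf3 (c := 21) (U := []) le_rfl (by simp) (by simp) (by simp)
      exact (this.setReg _ (by simp)).setReg _ (by simp)
  · refine ⟨by simp [hB.r8, hB.r4], le_rfl, ?_, ?_⟩
    · rw [sum_filter_ge_eq_zero]; simp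
    · exact ((Frame.refl _ _ _).setReg _ (by simp)).setReg _ (by simp)
  · rintro _ st' ⟨h1, h2, h3, h4⟩
    refine ⟨?_, h4⟩
    rw [h3, ← sum_val_eq_hammingNorm]
    simp
  · simp only [dotBody, distBody, List.length_cons, List.length_nil]
    ring_nf; omega

/-- Replace the output by the candidate if its distance is smaller. -/
def updateProg : Prog :=
  seqs [.instr (.sub 30 16 21), .ite 30 (seqs [.instr (.add 16 21 8), .instr (.add 31 0 8),
    loop 31 [.instr (.sub 32 31 7), .instr (.add 33 17 32), .instr (.load 34 4 33 8),
      .instr (.store 5 32 8 34)]]) skip]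

/-- The store holds the vector `g` as its output, and its distance as the best one so far. -/
def HoldsOutput (st : Store) (g : Fin n → ZMod 2) (D : ℕ) : Prop :=
  (∀ t : Fin n, st.arr 5 t 0 = (g t).val) ∧ st.reg 16 = D

theorem updateProg_spec {st : Store} (hB : Base m k' σ A b st)
    {o D : ℕ} (h17 : st.reg 17 = o) (g : Fin n → ZMod 2)
    (hg : ∀ t : Fin n, st.arr 4 (o + t) 0 = (g t).val) (h21 : st.reg 21 = D) :
    Det ν orc updateProg st (10 * n + 20) fun st' =>
      (D < st.reg 16 → HoldsOutput st' g D) ∧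
      (st.reg 16 ≤ D → st'.reg 16 = st.reg 16 ∧ st'.arr 5 = st.arr 5) ∧ Frame 16 [5] st st' := by
  have e8 := hB.r8
  refine SpecL.time (T := 1 + (1 + (1 + (1 + (n * (5 + 4 + 1) + 1) + 2))) + 1) (Spec.seqs
    (SpecL.sub (SpecL.ite (fun h => ?_) fun h => ?_))) (by omega)
  · simp [h21] at h
    refine SpecL.seqs_cons (SpecL.add (SpecL.add ?_))
    set s := (st.setReg 30 (st.reg 16 - st.reg 21)).setReg 16
      ((st.setReg 30 (st.reg 16 - st.reg 21)).reg 21 +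
        (st.setReg 30 (st.reg 16 - st.reg 21)).reg 8) with hs
    have hf : Frame 16 [5] st (s.setReg 31 (s.reg 0 + s.reg 8)) :=
      (((Frame.refl _ _ _).setReg _ (by simp)).setReg _ (by simp)).setReg _ (by simp)
    refine SpecL.mono (Spec.loop_det (T := 5)
      (I := fun i st' => st'.reg 31 = i ∧ i ≤ n ∧
        (∀ t : Fin n, i ≤ t → st'.arr 5 t 0 = (g t).val) ∧ st'.reg 16 = D ∧ st'.reg 17 = o ∧
        Frame 16 [5] st st')
      (fun i st h => h.1) ?_ n _ ?_) ?_
    · intro i st' ⟨h1, h2, h3, h4, h5, h6⟩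
      have hB' := hB.frame h6 (by simp) (by simp) (by simp)
      have g7 := hB'.r7
      have g8 := hB'.r8
      have hi : i < n := by omega
      have eg : st'.arr 4 (o + i) 0 = (g ⟨i, hi⟩).val := by
        rw [h6.2 4 (by simp)]; exact hg ⟨i, hi⟩
      refine SpecL.time (T := 1 + (1 + (1 + (1 + (1 + 0))))) ?_ le_rfl
      refine SpecL.sub (SpecL.add (SpecL.load (SpecL.store (SpecL.sub (SpecL.nil
        ⟨?_, by omega, ?_, ?_, ?_, ?_⟩)))))
      · simp [h1, g7]
      · intro t ht
        by_cases hti : t.val = i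
        · have : t = ⟨i, hi⟩ := Fin.ext hti
          rw [this]
          simp [h1, g7, g8, h5, eg]
        · simp [h1, g7, hti, h3 t (by omega)]
      · simp [h4]
      · simp [h5]
      · exact ((((h6.setReg _ (by simp)).setReg _ (by simp)).setReg _ (by simp)).setCell _ _ _
          (by simp)).setReg _ (by simp)
    · refine ⟨by simp [hs, hB.r0, e8], le_rfl, fun c hc => absurd c.2 (by omega), ?_, ?_, hf⟩
      · simp [hs, h21, e8]
      · simp [hs, h17]
    · rintro _ st' ⟨h1, h2, h3, h4, h5, h6⟩
      exact ⟨fun _ => ⟨fun t => h3 t (Nat.zero_le _), h4⟩, fun h' => absurd h' (by omega), h6⟩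
  · simp [h21] at h
    refine SpecL.time (T := 1 + 0) (SpecL.skip_cons (SpecL.nil ⟨fun h' => absurd h' (by omega),
      fun _ => ⟨by simp, by simp⟩, ?_⟩)) (by omega)
    exact (((Frame.refl _ _ _).setReg _ (by simp)).setReg _ (by simp))

end Routines

/-! ### One trial -/

/-- The result of one trial: a random block of the answer of the oracle, if enough rows were
selected. -/
def trial {n M m k' : ℕ} (ν : PMF (ZMod 2)) (σ : ℕ) (O : Solver m ((k' + 1) * n))
    (A : Matrix (Fin M) (Fin n) (ZMod 2)) (b : Fin M → ZMod 2) :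
    PMF (Option (Fin n → ZMod 2)) :=
  (PMF.uniformOfFintype (Fin (k' + 1))).bind fun j =>
    (drawAll (fun _ _ => PMF.uniformOfFintype (ZMod 2)) ((k' + 1) * n) 0).bind fun S =>
      (sel (fun x => acceptLaw n σ k' (hammingNorm (fun t => if h : x < M then A ⟨x, h⟩ t else 0)))
        M m).bind fun o => o.elim (PMF.pure none) fun u =>
          (drawAll (fun i _ => rowLaw ν k' σ j S (A (u i)) (b (u i))) m 0).bind fun Q =>
            (O (Matrix.of fun i => (Q i).1) fun i => (Q i).2).map fun g => some (block j g)

def trialBody : List Prog :=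
  [.instr (.rand 21 10), mulProg 22 0 21 23, .instr (.add 17 22 8), secretProg, selProg,
    .ite 18 skip (seqs [rowsProg, .instr .query, distProg, updateProg])]

/-- How the best candidate so far changes. -/
def Updates {n M : ℕ} (A : Matrix (Fin M) (Fin n) (ZMod 2)) (b : Fin M → ZMod 2) (st : Store)
    (o : Option (Fin n → ZMod 2)) (st' : Store) : Prop :=
  match o with
  | none => st'.reg 16 = st.reg 16 ∧ st'.arr 5 = st.arr 5
  | some g => (hammingNorm (A *ᵥ g + b) < st.reg 16 →
        HoldsOutput st' g (hammingNorm (A *ᵥ g + b))) ∧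
      (st.reg 16 ≤ hammingNorm (A *ᵥ g + b) → st'.reg 16 = st.reg 16 ∧ st'.arr 5 = st.arr 5)

/-- A bound for the number of steps of a trial. -/
def trialTime (n m k' M : ℕ) : ℕ :=
  4 * k' + 8 * ((k' + 1) * n) + M * (40 * n + 80) +
    m * (60 * ((k' + 1) * n) + 8 * n + 6 * k' + 120) + M * (15 * n + 20) + 10 * n + 100

section Routines

variable {ν : PMF (ZMod 2)} {n M m k' σ : ℕ}
  {A : Matrix (Fin M) (Fin n) (ZMod 2)} {b : Fin M → ZMod 2}

theorem trialBody_spec (O : Solver m ((k' + 1) * n)) (hσ : σ ≤ n) {st : Store}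
    (hB : Base m k' σ A b st) :
    SpecL ν (rawOracle O) (trialBody ++ [.instr (.sub 15 15 7)]) st (trialTime n m k' M)
      (trial ν σ O A b) fun o st' => Updates A b st o st' ∧ st'.reg 15 = st.reg 15 - 1 ∧
        Frame 15 [2, 3, 4, 5, 6, 7] st st' := by
  refine SpecL.time (T := 1 + ((4 * k' + 10) + (1 + ((8 * ((k' + 1) * n) + 10) +
    ((M * (40 * n + 80) + 10) + (1 + ((m * (60 * ((k' + 1) * n) + 8 * n + 6 * k' + 120) + 10) +
    (1 + ((M * (15 * n + 20) + 10) + ((10 * n + 20) + (1 + 0)))) + 3))))))) ?_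
    (by unfold trialTime; omega)
  refine SpecL.rand hB.r10 fun j => ?_
  -- Multiplication is repeated addition, so its cost depends on the drawn position `j ≤ k'`.
  refine SpecL.time (T := 4 * j + 10 + (1 + ((8 * ((k' + 1) * n) + 10) +
    ((M * (40 * n + 80) + 10) + (1 + ((m * (60 * ((k' + 1) * n) + 8 * n + 6 * k' + 120) + 10) +
    (1 + ((M * (15 * n + 20) + 10) + ((10 * n + 20) + (1 + 0)))) + 3)))))) ?_
    (by have := j.2; omega)
  refine SpecL.mul (by simp) (by simp) (by simp) (by simp) (by simp [hB.r7]) (by simp [hB.r8])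
    (p := n) (by simp [hB.r0]) (by simp) (SpecL.add ?_)
  set st1 := ((st.setReg 21 j).setReg 22 (n * j)).setReg 23 0 with hst1
  have e17 : st1.reg 22 + st1.reg 8 = j * n := by simp [hst1, hB.r8, mul_comm]
  rw [e17]
  have hf2 : Frame 17 [] st (st1.setReg 17 (j * n)) :=
    ((((Frame.refl _ _ _).setReg _ (by simp)).setReg _ (by simp)).setReg _ (by simp)).setReg _
      (by simp)
  have hB2 := hB.frame hf2 (by simp) (by simp) (by simp)
  have h17 : (st1.setReg 17 (j * n)).reg 17 = j * n := by simp
  set st2 := st1.setReg 17 (j * n)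
  refine SpecL.cons (secretProg_spec hB2) fun S st3 h3 => ?_
  have hf3 := hf2.trans h3.2 (c := 17) (U := [6]) (by simp) (by simp) (by simp) (by simp)
  have hB3 := hB.frame hf3 (by simp) (by simp) (by simp)
  refine SpecL.cons (selProg_spec hσ hB3) fun o st4 h4 => ?_
  obtain ⟨h4f, -, h4⟩ := h4
  have hf4 := hf3.trans h4f (c := 17) (U := [6, 7]) (by simp) (by simp) (by simp) (by simp)
  have hB4 := hB.frame hf4 (by simp) (by simp) (by simp)
  have e4 : st4.reg 17 = j * n := by
    rw [h4f.1 17 (by simp), h3.2.1 17 (by simp), h17]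
  cases o with
  | none =>
    refine SpecL.ite (fun _ => ?_) fun h => absurd h h4
    refine SpecL.time (T := 1 + (1 + 0)) (SpecL.skip_cons (SpecL.sub (SpecL.nil ⟨⟨?_, ?_⟩, ?_, ?_⟩)))
      (by omega)
    · simp [hf4.1 16 (by simp)]
    · simp [hf4.2 5 (by simp)]
    · simp [hf4.1 15 (by simp), hB4.r7]
    · exact ((hf4.mono (by simp) (by simp)).setReg _ (by simp)).setReg _ (by simp)
  | some u =>
    refine SpecL.ite (fun h => absurd h4.1 h) fun _ => ?_
    refine SpecL.seqs_cons (SpecL.cons (rowsProg_spec hB4 u e4 h4.2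
      fun c => by rw [h4f.2 6 (by simp)]; exact h3.1 c) fun Q st5 h5 => ?_)
    have hf5 := hf4.trans h5.2 (c := 17) (U := [2, 3, 6, 7]) (by simp) (by simp) (by simp) (by simp)
    rw [← PMF.bind_pure_comp]
    refine SpecL.cons (query_spec O st5 Q h5.1) fun g st6 h6 => ?_
    have hf6 := hf5.trans h6.2 (c := 17) (U := [2, 3, 4, 6, 7]) (by simp) (by simp) (by simp)
      (by simp)
    have e6 : st6.reg 17 = j * n := by
      rw [h6.2.1 17 (by simp), h5.2.1 17 (by simp), e4]
    have hg : ∀ (st : Store), st.arr 4 = st6.arr 4 → ∀ t : Fin n,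
        st.arr 4 (j * n + t) 0 = (block j g t).val := by
      intro st hst t
      have := h6.1 (finProdFinEquiv (j, t))
      rw [finProdFinEquiv_apply_val] at this
      rw [hst, show (j : ℕ) * n + t = t + n * j by ring]
      exact this
    refine SpecL.det_cons (distProg_spec (hB.frame hf6 (by simp) (by simp) (by simp)) e6
      (block j g) (hg _ rfl)) fun st7 h7 => ?_
    have hf7 := hf6.trans h7.2 (c := 17) (U := [2, 3, 4, 6, 7]) (by simp) (by simp) (by simp)
      (by simp)
    have e7 : st7.reg 17 = j * n := by rw [h7.2.1 17 (by simp), e6]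
    refine SpecL.det_cons (updateProg_spec (hB.frame hf7 (by simp) (by simp) (by simp)) e7
      (block j g) (hg _ (h7.2.2 4 (by simp))) h7.1) fun st8 h8 => ?_
    have hf8 := hf7.trans h8.2.2 (c := 16) (U := [2, 3, 4, 5, 6, 7]) (by simp) (by simp) (by simp)
      (by simp)
    refine SpecL.sub (SpecL.nil ⟨⟨fun h => ?_, fun h => ?_⟩, ?_, ?_⟩)
    · have := h8.1 (by rwa [hf7.1 16 (by simp)])
      exact ⟨fun t => by simpa using this.1 t, by simpa using this.2⟩
    · have := h8.2.1 (by rwa [hf7.1 16 (by simp)])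
      rw [hf7.1 16 (by simp), hf7.2 5 (by simp)] at this
      simpa using this
    · simp [hf8.1 15 (by simp), hf8.1 7 (by simp), hB.r7]
    · exact (hf8.mono (by simp) (by simp)).setReg _ (by simp)

/-! ### The whole program -/

/-- The law of the flag that says whether `s` has been seen, for `L` trials. -/
def seenLaw (ν : PMF (ZMod 2)) (σ : ℕ) (O : Solver m ((k' + 1) * n))
    (A : Matrix (Fin M) (Fin n) (ZMod 2)) (b : Fin M → ZMod 2) (s : Fin n → ZMod 2) (L : ℕ) :
    PMF Bool :=
  iter (fun _ flag => (trial ν σ O A b).map fun o => flag || decide (o = some s)) L false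

/-- The best candidate so far is in array `5`, and it is at least as good as `s` if `s` has been
seen. -/
def BestSoFar (A : Matrix (Fin M) (Fin n) (ZMod 2)) (b : Fin M → ZMod 2) (s : Fin n → ZMod 2)
    (flag : Bool) (st : Store) : Prop :=
  (st.reg 16 ≤ M → ∃ g, HoldsOutput st g (hammingNorm (A *ᵥ g + b))) ∧
    (flag = true → st.reg 16 ≤ hammingNorm (A *ᵥ s + b))

theorem BestSoFar.update {s : Fin n → ZMod 2} {flag : Bool} {st st' : Store}
    (h : BestSoFar A b s flag st) {o : Option (Fin n → ZMod 2)} (hu : Updates A b st o st') :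
    BestSoFar A b s (flag || decide (o = some s)) st' := by
  have same : st'.reg 16 = st.reg 16 ∧ st'.arr 5 = st.arr 5 → BestSoFar A b s flag st' := by
    rintro ⟨h1, h2⟩
    refine ⟨fun h' => ?_, fun hf => ?_⟩
    · rw [h1] at h'
      obtain ⟨g, hg1, hg2⟩ := h.1 h'
      exact ⟨g, fun t => by rw [h2, hg1 t], by rw [h1, hg2]⟩
    · rw [h1]; exact h.2 hf
  cases o with
  | none => simpa using same hu
  | some g =>
    by_cases hlt : hammingNorm (A *ᵥ g + b) < st.reg 16
    · have h1 := hu.1 hlt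
      refine ⟨fun _ => ⟨g, h1.1, h1.2⟩, fun hf => ?_⟩
      rw [h1.2]
      simp only [Option.some.injEq, Bool.or_eq_true, decide_eq_true_eq] at hf
      rcases hf with hf | rfl
      · exact hlt.le.trans (h.2 hf)
      · exact le_rfl
    · have h1 := same (hu.2 (not_lt.1 hlt))
      refine ⟨h1.1, fun hf => ?_⟩
      simp only [Option.some.injEq, Bool.or_eq_true, decide_eq_true_eq] at hf
      rcases hf with hf | rfl
      · exact h1.2 hf
      · rw [(hu.2 (not_lt.1 hlt)).1]; exact not_lt.1 hlt

def trialsProg : Prog := loop 15 trialBody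

theorem trialsProg_spec (O : Solver m ((k' + 1) * n)) (hσ : σ ≤ n) {st : Store}
    (hB : Base m k' σ A b st) (s : Fin n → ZMod 2) {L : ℕ} (h15 : st.reg 15 = L)
    (h16 : st.reg 16 = M + 1) :
    Spec ν (rawOracle O) trialsProg st (L * (trialTime n m k' M + 7) + 1)
      (seenLaw ν σ O A b s L) (BestSoFar A b s) := by
  refine (Spec.loop_iter (T := trialTime n m k' M) (I := fun i flag st' => st'.reg 15 = i ∧
    Base m k' σ A b st' ∧ BestSoFar A b s flag st') (fun i _ _ h => h.1) ?_ L false st ?_).mono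
    fun _ _ h => h.2.2
  · rintro i flag st' ⟨h1, h2, h3⟩
    refine (trialBody_spec O hσ h2).map _ ?_
    rintro o st'' ⟨g1, g2, g3⟩
    exact ⟨by omega, h2.frame g3 le_rfl (by simp) (by simp), h3.update g1⟩
  · exact ⟨h15, hB, fun h => by omega, fun h => by simp at h⟩

/-- Registers `5` and `6` hold the rounded values of `1/δ` and `1/ε`, and register `15` becomes
`128` times their product, the number of trials. Register `16` starts at `M + 1`, above every
possible distance, so that the first candidate is always stored. -/
def reduction : Prog :=
  seqs [.instr (.const 7 1), .instr (.sub 10 2 7), .instr (.sub 11 0 3), mulProg 9 2 0 20,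
    mulProg 12 2 3 20, mulProg 21 10 3 22, mulProg 23 21 11 24, .instr (.add 13 23 8),
    mulProg 14 10 0 20, .instr (.const 21 128), mulProg 22 21 5 23, mulProg 24 22 6 25,
    .instr (.add 15 24 8), .instr (.add 16 4 7), trialsProg]

theorem reduction_spec (O : Solver m ((k' + 1) * n)) (hσ : σ ≤ n) (D E : ℕ)
    (A : Matrix (Fin M) (Fin n) (ZMod 2)) (b : Fin M → ZMod 2) (s : Fin n → ZMod 2) :
    Spec ν (rawOracle O) reduction (startStore [n, m, k' + 1, σ, M, D, E] A b)
      (128 * D * E * (trialTime n m k' M + 7) + 20 * n + 4 * D + 4 * E + 200)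
      (seenLaw ν σ O A b s (128 * D * E)) (BestSoFar A b s) := by
  refine SpecL.time (T := 1 + (1 + (1 + ((4 * n + 10) + ((4 * σ + 10) + ((4 * σ + 10) +
    ((4 * (n - σ) + 10) + (1 + ((4 * n + 10) + (1 + ((4 * D + 10) + ((4 * E + 10) + (1 + (1 +
    (128 * D * E * (trialTime n m k' M + 7) + 1)))))))))))))) + 14) (Spec.seqs ?_) (by omega)
  refine SpecL.const (SpecL.sub (SpecL.sub ?_))
  refine SpecL.mul (by simp) (by simp) (by simp) (by simp) rfl rfl (p := k' + 1) (q := n) rfl rfl ?_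
  refine SpecL.mul (by simp) (by simp) (by simp) (by simp) rfl rfl (p := k' + 1) (q := σ) rfl rfl ?_
  refine SpecL.mul (by simp) (by simp) (by simp) (by simp) rfl rfl (p := k') (q := σ) rfl rfl ?_
  refine SpecL.mul (by simp) (by simp) (by simp) (by simp) rfl rfl (p := k' * σ) (q := n - σ) rfl rfl ?_
  refine SpecL.add ?_
  refine SpecL.mul (by simp) (by simp) (by simp) (by simp) rfl rfl (p := k') (q := n) rfl rfl ?_
  refine SpecL.const ?_
  refine SpecL.mul (by simp) (by simp) (by simp) (by simp) rfl rfl (p := 128) (q := D) rfl rfl ?_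
  refine SpecL.mul (by simp) (by simp) (by simp) (by simp) rfl rfl (p := 128 * D) (q := E) rfl rfl ?_
  refine SpecL.add (SpecL.add ?_)
  refine trialsProg_spec O hσ ?_ s rfl rfl
  constructor
  all_goals first | rfl | skip
  · intro i j; simp [startStore]
  · intro i; simp [startStore]

end Routines

/-! ### The program as a solver: halting and success probability -/

theorem run_nil (ν : PMF (ZMod 2)) (orc : RawOracle) (st : Store) (T : ℕ) :
    run ν orc T ([], st) = PMF.pure ([], st) := by
  induction T with
  | zero => rfl
  | succ T ih => simp [run, step, ih]

section

variable {ν : PMF (ZMod 2)} {orc : RawOracle} {α : Type}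

/-- A halted configuration stays put, so steps left over after termination have no effect and the
varying number of steps disappears. -/
theorem Spec.exists_run {P : Prog} {st : Store} {T : ℕ} {μ : PMF α} {R : α → Store → Prop}
    (h : Spec ν orc P st T μ R) : ∃ D : PMF (α × Store), D.map Prod.fst = μ ∧
      (∀ x ∈ D.support, R x.1 x.2) ∧ run ν orc T ([P], st) = D.map fun x => ([], x.2) := by
  obtain ⟨D, h1, h2, h3⟩ := h
  refine ⟨D.map fun x => (x.1, x.2.1), ?_, ?_, ?_⟩
  · rw [PMF.map_comp, ← h1]; rfl
  · intro x hx
    rw [PMF.support_map] at hx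
    obtain ⟨y, hy, rfl⟩ := hx
    exact (h2 y hy).1
  · have := h3 [] T le_rfl
    simp only [run_nil, List.append_nil] at this
    rw [this, PMF.map_comp]; rfl

end

/-- The number of steps of the reduction. -/
def reductionTime (n m k' M D E : ℕ) : ℕ :=
  128 * D * E * (trialTime n m k' M + 7) + 20 * n + 4 * D + 4 * E + 200

section Reduction

variable {n M m k' σ : ℕ}

theorem reduction_halts (O : Solver m ((k' + 1) * n)) (hσ : σ ≤ n) (η : ℝ) (D E : ℕ) :
    HaltsWithin reduction [n, m, k' + 1, σ, M, D, E] M n η O (reductionTime n m k' M D E) := by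
  intro A b c hc
  obtain ⟨μ, -, -, h3⟩ := (reduction_spec (ν := ber η) O hσ D E A b 0).exists_run
  rw [runOn, reductionTime, h3, PMF.support_map] at hc
  obtain ⟨x, -, rfl⟩ := hc
  rfl

theorem hammingNorm_le {d : ℕ} (v : Fin d → ZMod 2) : hammingNorm v ≤ d := by
  simpa using hammingNorm_le_card_fintype (x := v)

/-- The flag and the store are coupled. If `s` has been seen, the stored candidate is at least as
close as `s`; as `s` is strictly closest, the output is `s`. -/
theorem seenLaw_le_programSolver (O : Solver m ((k' + 1) * n)) (hσ : σ ≤ n) (η : ℝ) (D E : ℕ)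
    (A : Matrix (Fin M) (Fin n) (ZMod 2)) (b : Fin M → ZMod 2) (s : Fin n → ZMod 2)
    (hs : ∀ g, g ≠ s → hammingNorm (A *ᵥ s + b) < hammingNorm (A *ᵥ g + b)) :
    seenLaw (ber η) σ O A b s (128 * D * E) true ≤
      programSolver reduction [n, m, k' + 1, σ, M, D, E] M n η O (reductionTime n m k' M D E)
        A b s := by
  classical
  obtain ⟨μ, h1, h2, h3⟩ := (reduction_spec (ν := ber η) O hσ D E A b s).exists_run
  rw [programSolver, runOn, reductionTime, h3, PMF.map_comp, ← h1, PMF.map_apply, PMF.map_apply]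
  refine ENNReal.tsum_le_tsum fun x => ?_
  by_cases hx : x ∈ μ.support
  swap
  · rw [PMF.mem_support_iff, not_not] at hx
    simp [hx]
  by_cases hf : true = x.1
  swap
  · rw [if_neg hf]; exact zero_le
  have hR := h2 x hx
  rw [if_pos hf, if_pos]
  have h16 := hR.2 hf.symm
  obtain ⟨g, hg1, hg2⟩ := hR.1 (h16.trans (hammingNorm_le _))
  have hgs : g = s := by
    by_contra hne
    have := hs g hne
    omega
  subst hgs
  funext t
  simp only [readOutput, Function.comp_apply]
  rw [hg1 t]
  simp

theorem iter_or_apply {α : Type} [Fintype α] (μ : PMF α) (f : α → Bool) (L : ℕ) :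
    (iter (fun _ flag => μ.map fun o => flag || f o) L false true).toReal =
      1 - (1 - Ex μ fun o => if f o then 1 else 0) ^ L := by
  set p := Ex μ fun o => if f o then (1 : ℝ) else 0
  have hE : ∀ q : PMF Bool, (q true).toReal = Ex q fun t => if t then 1 else 0 := fun q => by
    rw [Ex_eq_bool]; simp
  have key : ∀ (L : ℕ) (flag : Bool), Ex (iter (fun _ flag => μ.map fun o => flag || f o) L flag)
      (fun t => if t then (1 : ℝ) else 0) = if flag then 1 else 1 - (1 - p) ^ L := by
    intro L
    induction L with
    | zero => intro flag; simp [iter, Ex_pure]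
    | succ L ih =>
      intro flag
      rw [iter, Ex_bind, Ex_map]
      simp only [ih]
      cases flag with
      | true => simp [Ex_const]
      | false =>
        have e : ∀ o, (if (false || f o) = true then (1 : ℝ) else 1 - (1 - p) ^ L) =
            (1 - (1 - p) ^ L) + (1 - p) ^ L * (if f o then (1 : ℝ) else 0) := by
          intro o; cases f o <;> simp
        simp only [e]
        rw [Ex_add, Ex_const, Ex_mul_left]
        simp only [Bool.false_eq_true, if_false]
        change 1 - (1 - p) ^ L + (1 - p) ^ L * p = _
        ring
  rw [hE, key]; simp

theorem seenLaw_true (ν : PMF (ZMod 2)) (O : Solver m ((k' + 1) * n))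
    (A : Matrix (Fin M) (Fin n) (ZMod 2)) (b : Fin M → ZMod 2) (s : Fin n → ZMod 2) (L : ℕ) :
    (seenLaw ν σ O A b s L true).toReal = 1 - (1 - (trial ν σ O A b (some s)).toReal) ^ L := by
  classical
  rw [seenLaw, iter_or_apply, ← Ex_indicator_eq]
  simp only [decide_eq_true_eq]

theorem successProb_eq_Ex {row : PMF (Fin n → ZMod 2)} {η : ℝ} (S : Solver M n) :
    successProb row η S = Ex (PMF.uniformOfFintype (Fin n → ZMod 2)) fun s =>
      Ex (iid (Fin M) row) fun A => Ex (iid (Fin M) (ber η)) fun e =>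
        (S (Matrix.of A) (Matrix.of A *ᵥ s + e) s).toReal := by
  classical
  have h1 : successProb row η S = Ex (searchExperiment row η S) fun p =>
      if p.2 = p.1 then 1 else 0 := by
    rw [successProb, PMF.toOuterMeasure_apply_fintype, ENNReal.toReal_sum]
    · refine Finset.sum_congr rfl fun p _ => ?_
      by_cases h : p.2 = p.1 <;> simp [Set.indicator, h]
    · intro p _
      by_cases h : p.2 = p.1 <;> simp [Set.indicator, h, PMF.apply_ne_top]
  rw [h1, searchExperiment]
  simp only [Ex_bind, Ex_map, Ex_indicator_eq]

end Reduction

/-! ### Sequential sampling -/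

section drawAll

variable {d : ℕ} {β : Type}

/-- The law of a coordinate depends only on later coordinates, and these are final when it is drawn.
Each conditional law may therefore be evaluated at the final vector `w`. -/
theorem drawAll_apply {p : Fin d → (Fin d → β) → PMF β}
    (hp : ∀ c v v', (∀ c', c < c' → v c' = v' c') → p c v = p c v') (w : Fin d → β) :
    ∀ (i : ℕ), i ≤ d → ∀ v : Fin d → β, (∀ c : Fin d, i ≤ c → w c = v c) →
      drawAll p i v w = ∏ c ∈ Finset.univ.filter (fun c : Fin d => c < i), p c w (w c) := by
  classical
  intro i
  induction i with
  | zero =>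
    intro _ v hv
    have : w = v := funext fun c => hv c (Nat.zero_le _)
    subst this
    simp [drawAll, iter]
  | succ i ih =>
    intro hi v hv
    have hi' : i < d := hi
    have e : drawAll p (i + 1) v =
        (p ⟨i, hi'⟩ v).bind fun x => drawAll p i (Function.update v ⟨i, hi'⟩ x) := by
      simp only [drawAll, iter, dif_pos hi', PMF.bind_map]; rfl
    have hset : Finset.univ.filter (fun c : Fin d => c.val < i + 1) =
        insert ⟨i, hi'⟩ (Finset.univ.filter (fun c : Fin d => c.val < i)) := by
      ext c
      simp only [Finset.mem_filter, Finset.mem_univ, true_and, Finset.mem_insert, Fin.ext_iff]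
      omega
    rw [e, PMF.bind_apply, tsum_eq_single (w ⟨i, hi'⟩), hset, Finset.prod_insert (by simp),
      ih hi'.le]
    · congr 2
      refine hp _ _ _ fun c hc => (hv c ?_).symm
      exact hc
    · intro c hc
      by_cases hci : c = ⟨i, hi'⟩
      · subst hci; simp
      · rw [Function.update_of_ne hci, hv c]
        have : c.val ≠ i := fun h => hci (Fin.ext h)
        omega
    · intro x hx
      have hne : drawAll p i (Function.update v ⟨i, hi'⟩ x) w = 0 := by
        -- Coordinates that have been drawn are never changed, so only the draw `w ⟨i, hi'⟩` can
        -- lead to `w`.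
        have hkeep : ∀ (i : ℕ) (v : Fin d → β) (c : Fin d), i ≤ c →
            ∀ u ∈ (drawAll p i v).support, u c = v c := by
          intro i
          induction i with
          | zero =>
            intro v c _ u hu
            simp only [drawAll, iter, PMF.support_pure, Set.mem_singleton_iff] at hu
            rw [hu]
          | succ i ih =>
            intro v c hc u hu
            simp only [drawAll, iter] at hu ih
            rw [PMF.mem_support_bind_iff] at hu
            obtain ⟨v', hv', hu⟩ := hu
            rw [ih v' c (by omega) u hu]
            split_ifs at hv' with h
            · rw [PMF.support_map] at hv'
              obtain ⟨y, -, rfl⟩ := hv'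
              rw [Function.update_of_ne]
              intro h'
              rw [h'] at hc
              simp at hc
            · rw [PMF.support_pure, Set.mem_singleton_iff] at hv'
              rw [hv']
        by_contra h0
        have := hkeep i _ ⟨i, hi'⟩ le_rfl w ((PMF.mem_support_iff _ _).2 h0)
        rw [Function.update_self] at this
        exact hx this.symm
      rw [hne, mul_zero]

theorem drawAll_full {p : Fin d → (Fin d → β) → PMF β}
    (hp : ∀ c v v', (∀ c', c < c' → v c' = v' c') → p c v = p c v') (v w : Fin d → β) :
    drawAll p d v w = ∏ c, p c w (w c) := by
  rw [drawAll_apply hp w d le_rfl v fun c hc => absurd c.2 (by omega)]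
  rw [Finset.filter_true_of_mem fun c _ => c.2]

theorem drawAll_eq_indep [Fintype β] (p : Fin d → PMF β) (v : Fin d → β) :
    drawAll (fun c _ => p c) d v = indep p := by
  ext w
  rw [drawAll_full (fun _ _ _ _ => rfl), indep_apply]

end drawAll

/-! ### Bernoulli noise -/

theorem ber_one {p : ℝ} (h0 : 0 ≤ p) (h1 : p ≤ 1) : (ber p 1).toReal = p := by
  simp [ber, min_eq_left h1, ENNReal.toReal_ofReal h0]

theorem ber_zero {p : ℝ} (h0 : 0 ≤ p) (h1 : p ≤ 1) : (ber p 0).toReal = 1 - p := by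
  have : (ENNReal.ofReal p) ≤ 1 := ENNReal.ofReal_le_one.2 h1
  simp [ber, min_eq_left h1, ENNReal.toReal_sub_of_le this, ENNReal.toReal_ofReal h0]

theorem Ex_ber {p : ℝ} (h0 : 0 ≤ p) (h1 : p ≤ 1) (f : ZMod 2 → ℝ) :
    Ex (ber p) f = (1 - p) * f 0 + p * f 1 := by
  have h : (Finset.univ : Finset (ZMod 2)) = {0, 1} := by decide
  rw [Ex, h, Finset.sum_pair (by decide), ber_zero h0 h1, ber_one h0 h1]

/-- The noise rate of the sum of `t` bits. -/
def sumRate (η : ℝ) (t : ℕ) : ℝ := (1 - (1 - 2 * η) ^ t) / 2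

theorem sumRate_mem {η : ℝ} (h0 : 0 ≤ η) (h1 : η ≤ 1) (t : ℕ) :
    0 ≤ sumRate η t ∧ sumRate η t ≤ 1 := by
  have : |(1 - 2 * η) ^ t| ≤ 1 := by
    rw [abs_pow]
    exact pow_le_one₀ (abs_nonneg _) (abs_le.2 ⟨by linarith, by linarith⟩)
  obtain ⟨h2, h3⟩ := abs_le.1 this
  unfold sumRate
  constructor <;> linarith

theorem Ex_iid_succ {α : Type} [Fintype α] (p : PMF α) (t : ℕ) (F : (Fin (t + 1) → α) → ℝ) :
    Ex (iid (Fin (t + 1)) p) F =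
      Ex p fun x => Ex (iid (Fin t) p) fun y => F (Fin.cons x y) := by
  rw [iid_eq_indep, Ex_indep_insertNth _ 0]
  simp only [Fin.insertNth_zero']
  rfl

theorem Ex_iid_zero {α : Type} [Fintype α] (p : PMF α) (F : (Fin 0 → α) → ℝ) :
    Ex (iid (Fin 0) p) F = F Fin.elim0 := by
  have : iid (Fin 0) p = PMF.pure Fin.elim0 := by
    ext f
    rw [Subsingleton.elim f Fin.elim0, iid_eq_indep, indep_apply]
    simp
  rw [this, Ex_pure]

/-- The bias `1 - 2η` is multiplicative under sums of independent bits. -/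
theorem Ex_sum_ber {η : ℝ} (h0 : 0 ≤ η) (h1 : η ≤ 1) (t : ℕ) (F : ZMod 2 → ℝ) :
    Ex (iid (Fin t) (ber η)) (fun x => F (∑ i, x i)) = Ex (ber (sumRate η t)) F := by
  obtain ⟨g0, g1⟩ := sumRate_mem h0 h1 t
  induction t generalizing F with
  | zero => rw [Ex_iid_zero, Ex_ber g0 g1]; simp [sumRate]
  | succ t ih =>
    obtain ⟨l0, l1⟩ := sumRate_mem h0 h1 t
    rw [Ex_iid_succ, Ex_ber g0 g1]
    simp only [Fin.sum_univ_succ, Fin.cons_zero, Fin.cons_succ]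
    have := fun x : ZMod 2 => ih (fun y => F (x + y)) l0 l1
    simp only [this]
    rw [Ex_ber h0 h1, Ex_ber l0 l1, Ex_ber l0 l1]
    have e : (1 + 1 : ZMod 2) = 0 := by decide
    simp only [sumRate, zero_add, add_zero, e]
    ring

theorem Ex_iid_swap {α : Type} [Fintype α] (t m : ℕ) (p : PMF α) (F : (Fin t → Fin m → α) → ℝ) :
    Ex (iid (Fin t) (iid (Fin m) p)) F =
      Ex (iid (Fin m) (iid (Fin t) p)) fun x => F fun i j => x j i := by
  have h1 := Ex_iid_curry (ι := Fin t) (ι' := Fin m) p fun x => F fun i j => x (i, j)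
  have h2 := Ex_iid_curry (ι := Fin m) (ι' := Fin t) p fun x => F fun i j => x (j, i)
  rw [← h1, ← h2, Ex_iid_reindex (Equiv.prodComm _ _)]
  rfl

/-- The sum of independent noise vectors. -/
theorem Ex_sum_noise {η : ℝ} (h0 : 0 ≤ η) (h1 : η ≤ 1) (t m : ℕ) (F : (Fin m → ZMod 2) → ℝ) :
    Ex (iid (Fin t) (iid (Fin m) (ber η))) (fun x => F (∑ i, x i)) =
      Ex (iid (Fin m) (ber (sumRate η t))) F := by
  have h : ber (sumRate η t) = (iid (Fin t) (ber η)).map fun x => ∑ i, x i :=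
    pmf_ext_Ex fun f => by rw [Ex_map, Ex_sum_ber h0 h1]
  rw [Ex_iid_swap, h, iid_eq_indep (ι := Fin m) (PMF.map _ _), Ex_indep_map, iid_eq_indep]
  refine congrArg _ (funext fun x => congrArg F (funext fun j => ?_))
  simp

theorem Ex_addNoise (ν : PMF (ZMod 2)) (t : ℕ) (e : ZMod 2) (F : ZMod 2 → ℝ) :
    Ex (addNoise ν t e) F = Ex (iid (Fin t) ν) fun x => F (e + ∑ i, x i) := by
  induction t generalizing e with
  | zero => rw [Ex_iid_zero, addNoise, iter, Ex_pure]; simp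
  | succ t ih =>
    rw [addNoise, iter, Ex_bind, Ex_map, Ex_iid_succ]
    refine congrArg _ (funext fun x => ?_)
    simp only [Fin.sum_univ_succ, Fin.cons_zero, Fin.cons_succ, ← add_assoc]
    exact ih _

/-- Adding noise to each entry of a vector. -/
theorem Ex_indep_addNoise (ν : PMF (ZMod 2)) (t m : ℕ) (e : Fin m → ZMod 2)
    (F : (Fin m → ZMod 2) → ℝ) :
    Ex (indep fun i => addNoise ν t (e i)) F =
      Ex (iid (Fin t) (iid (Fin m) ν)) fun x => F (e + ∑ i, x i) := by
  have h : ∀ i, addNoise ν t (e i) = (iid (Fin t) ν).map fun x => e i + ∑ i, x i :=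
    fun i => pmf_ext_Ex fun f => by rw [Ex_map, Ex_addNoise]
  simp only [h]
  rw [Ex_indep_map, Ex_iid_swap, iid_eq_indep]
  refine congrArg _ (funext fun x => congrArg F (funext fun j => ?_))
  simp

/-! ### The law of the selected rows -/

theorem sel_congr {acc acc' : ℕ → PMF Bool} : ∀ (r i : ℕ), (∀ x < r, acc x = acc' x) →
    sel acc r i = sel acc' r i := by
  intro r
  induction r with
  | zero => intro i _; cases i <;> rfl
  | succ r ih =>
    intro i h
    cases i with
    | zero => rfl
    | succ i =>
      simp only [sel]
      rw [h r (Nat.lt_succ_self r), ih i fun x hx => h x (by omega),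
        ih (i + 1) fun x hx => h x (by omega)]

/-- The probability that `i` of `r` rows are accepted, each with probability `c`. -/
def selProb (c : ℝ) : (r i : ℕ) → ℝ
  | _, 0 => 1
  | 0, _ + 1 => 0
  | r + 1, i + 1 => c * selProb c r i + (1 - c) * selProb c r (i + 1)

/-- A Chernoff bound: for a binomial number `X` of accepted rows, the indicator of `X < i` is at
most `z ^ X / z ^ i`, and `E z ^ X = (1 - c (1 - z)) ^ r`. -/
theorem one_sub_selProb_le {c z : ℝ} (hc : 0 ≤ c) (hc1 : c ≤ 1) (hz : 0 < z) (hz1 : z ≤ 1) :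
    ∀ r i : ℕ, 1 - selProb c r i ≤ (1 - c * (1 - z)) ^ r / z ^ i := by
  have hq : 0 ≤ 1 - c * (1 - z) := by nlinarith
  intro r
  induction r with
  | zero =>
    intro i
    cases i with
    | zero => simp [selProb]
    | succ i =>
      simp only [selProb, sub_zero, pow_zero]
      rw [le_div_iff₀ (by positivity), one_mul]
      exact pow_le_one₀ hz.le hz1
  | succ r ih =>
    intro i
    cases i with
    | zero => simp only [selProb, sub_self]; positivity
    | succ i =>
      have h1 := mul_le_mul_of_nonneg_left (ih i) hc
      have h2 := mul_le_mul_of_nonneg_left (ih (i + 1)) (sub_nonneg.2 hc1)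
      have e : (1 - c * (1 - z)) ^ (r + 1) / z ^ (i + 1) =
          c * ((1 - c * (1 - z)) ^ r / z ^ i) +
            (1 - c) * ((1 - c * (1 - z)) ^ r / z ^ (i + 1)) := by
        field_simp
        ring
      rw [e]
      simp only [selProb]
      linarith

section Pool

variable {Y : Type}

/-- The acceptance law of the rows of a pool. -/
def poolAcc (acc : Y → PMF Bool) {r : ℕ} (X : Fin r → Y) (x : ℕ) : PMF Bool :=
  if h : x < r then acc (X ⟨x, h⟩) else PMF.pure false

/-- Select `i` rows of the pool `X` and apply `g` to them; the value is `0` if too few rows are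
accepted. -/
def selEx (acc : Y → PMF Bool) {r : ℕ} (i : ℕ) (X : Fin r → Y) (g : (Fin i → Y) → ℝ) : ℝ :=
  Ex (sel (poolAcc acc X) r i) fun o => o.elim 0 fun u => g (X ∘ u)

theorem selEx_zero (acc : Y → PMF Bool) {r : ℕ} (X : Fin r → Y) (g : (Fin 0 → Y) → ℝ) :
    selEx acc 0 X g = g Fin.elim0 := by
  have h : sel (poolAcc acc X) r 0 = PMF.pure (some Fin.elim0) := by cases r <;> rfl
  rw [selEx, h, Ex_pure]
  exact congrArg g (Subsingleton.elim _ _)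

theorem selEx_nil (acc : Y → PMF Bool) (i : ℕ) (X : Fin 0 → Y) (g : (Fin (i + 1) → Y) → ℝ) :
    selEx acc (i + 1) X g = 0 := by
  rw [selEx, sel, Ex_pure]; rfl

/-- The selection inspects the last row of the pool first; splitting it off gives the recursion
behind `Ex_selEx`. -/
theorem selEx_snoc (acc : Y → PMF Bool) {r i : ℕ} (X : Fin r → Y) (y : Y)
    (g : (Fin (i + 1) → Y) → ℝ) :
    selEx acc (i + 1) (Fin.snoc (α := fun _ => Y) X y : Fin (r + 1) → Y) g =
      (acc y true).toReal * selEx acc i X (fun w => g (Fin.snoc (α := fun _ => Y) w y)) +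
        (1 - (acc y true).toReal) * selEx acc (i + 1) X g := by
  have h1 : poolAcc acc (Fin.snoc (α := fun _ => Y) X y : Fin (r + 1) → Y) r = acc y := by
    rw [poolAcc, dif_pos (Nat.lt_succ_self r)]
    congr 1
    exact Fin.snoc_last (α := fun _ => Y) y X
  have h2 : ∀ x < r, poolAcc acc (Fin.snoc (α := fun _ => Y) X y : Fin (r + 1) → Y) x =
      poolAcc acc X x := by
    intro x hx
    rw [poolAcc, poolAcc, dif_pos (by omega), dif_pos hx]
    congr 1
    exact Fin.snoc_castSucc (α := fun _ => Y) y X ⟨x, hx⟩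
  simp only [selEx, sel]
  rw [Ex_bind, h1, Ex_eq_bool, if_pos rfl, if_neg (by simp), Ex_map, Ex_map, sel_congr r i h2,
    sel_congr r (i + 1) h2]
  congr 2
  · refine congrArg _ (funext fun o => ?_)
    cases o with
    | none => rfl
    | some u =>
      simp only [Option.map_some, Option.elim_some]
      congr 1
      funext x
      refine Fin.lastCases ?_ (fun x => ?_) x
      · simp
      · simp
  · refine congrArg _ (funext fun o => ?_)
    cases o with
    | none => rfl
    | some u =>
      simp only [Option.map_some, Option.elim_some]
      congr 1
      funext x
      simp

theorem selEx_add (acc : Y → PMF Bool) {r : ℕ} (i : ℕ) (X : Fin r → Y) (f g : (Fin i → Y) → ℝ) :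
    selEx acc i X (fun w => f w + g w) = selEx acc i X f + selEx acc i X g := by
  rw [selEx, selEx, selEx, ← Ex_add]
  refine congrArg _ (funext fun o => ?_)
  cases o <;> simp

theorem selEx_mul_left (acc : Y → PMF Bool) {r : ℕ} (i : ℕ) (X : Fin r → Y) (c : ℝ)
    (g : (Fin i → Y) → ℝ) : selEx acc i X (fun w => c * g w) = c * selEx acc i X g := by
  rw [selEx, selEx, ← Ex_mul_left]
  refine congrArg _ (funext fun o => ?_)
  cases o <;> simp

theorem selEx_mono (acc : Y → PMF Bool) {r : ℕ} (i : ℕ) (X : Fin r → Y) {f g : (Fin i → Y) → ℝ}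
    (h : ∀ w, f w ≤ g w) : selEx acc i X f ≤ selEx acc i X g := by
  refine Ex_mono _ fun o => ?_
  cases o with
  | none => exact le_rfl
  | some u => exact h _

theorem selEx_const_zero (acc : Y → PMF Bool) {r : ℕ} (i : ℕ) (X : Fin r → Y) :
    selEx acc i X (fun _ => 0) = 0 := by
  simpa using selEx_mul_left acc i X 0 fun _ => 0

theorem selEx_sum {ι : Type} (s : Finset ι) (acc : Y → PMF Bool) {r : ℕ} (i : ℕ) (X : Fin r → Y)
    (g : ι → (Fin i → Y) → ℝ) :
    selEx acc i X (fun w => ∑ x ∈ s, g x w) = ∑ x ∈ s, selEx acc i X (g x) := by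
  classical
  induction s using Finset.induction_on with
  | empty => simpa using selEx_const_zero acc i X
  | insert x s hx ih => simp only [Finset.sum_insert hx, selEx_add, ih]

theorem selEx_le_one (acc : Y → PMF Bool) {r : ℕ} (i : ℕ) (X : Fin r → Y) :
    selEx acc i X (fun _ => 1) ≤ 1 := by
  refine Ex_le_one _ fun o => ?_
  cases o <;> simp

variable [Fintype Y]

/-- Rejection sampling: accepted rows of a pool drawn from `ρ` have the law `π`. -/
theorem Ex_selEx {acc : Y → PMF Bool} {ρ π : PMF Y} {c : ℝ}
    (h : ∀ y, (ρ y).toReal * (acc y true).toReal = c * (π y).toReal) :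
    ∀ (r i : ℕ) (g : (Fin i → Y) → ℝ),
      Ex (iid (Fin r) ρ) (fun X => selEx acc i X g) = selProb c r i * Ex (iid (Fin i) π) g := by
  -- The hypothesis integrated against `f`; for `f = 1` it shows that `c` is the overall probability
  -- of acceptance.
  have hE : ∀ f : Y → ℝ, Ex ρ (fun y => (acc y true).toReal * f y) = c * Ex π f := fun f => by
    simp only [Ex, Finset.mul_sum, ← mul_assoc, h]
  have hE' : ∀ f : ℝ, Ex ρ (fun y => (1 - (acc y true).toReal) * f) = (1 - c) * f := fun f => by
    have := hE fun _ => f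
    rw [Ex_const] at this
    simp only [sub_mul, one_mul]
    rw [Ex_sub, Ex_const, this]
  have hsnoc : ∀ (p : PMF Y) (r : ℕ) (F : (Fin (r + 1) → Y) → ℝ), Ex (iid (Fin (r + 1)) p) F =
      Ex p fun y => Ex (iid (Fin r) p) fun X => F (Fin.snoc (α := fun _ => Y) X y) := by
    intro p r F
    rw [iid_eq_indep, Ex_indep_insertNth _ (Fin.last r)]
    simp only [Fin.insertNth_last']
    rfl
  intro r
  induction r with
  | zero =>
    intro i g
    rw [Ex_iid_zero]
    cases i with
    | zero => rw [selEx_zero, Ex_iid_zero, selProb, one_mul]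
    | succ i => rw [selEx_nil, selProb, zero_mul]
  | succ r ih =>
    intro i g
    cases i with
    | zero =>
      simp only [selEx_zero]
      rw [Ex_const, Ex_iid_zero, selProb, one_mul]
    | succ i =>
      rw [hsnoc]
      simp only [selEx_snoc]
      have h1 : ∀ y : Y, Ex (iid (Fin r) ρ) (fun X =>
          (acc y true).toReal * selEx acc i X (fun w => g (Fin.snoc (α := fun _ => Y) w y)) +
          (1 - (acc y true).toReal) * selEx acc (i + 1) X g) =
          (acc y true).toReal * (selProb c r i *
            Ex (iid (Fin i) π) fun w => g (Fin.snoc (α := fun _ => Y) w y)) +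
          (1 - (acc y true).toReal) * (selProb c r (i + 1) * Ex (iid (Fin (i + 1)) π) g) := by
        intro y
        rw [Ex_add, Ex_mul_left, Ex_mul_left, ih, ih]
      simp only [h1]
      rw [Ex_add, hE, hE', Ex_mul_left, ← hsnoc, selProb]
      ring

/-- A bounded weight on the pool becomes a bounded weight on the selected rows. -/
theorem exists_weight {acc : Y → PMF Bool} {ρ π : PMF Y} {c : ℝ} (hc : 0 ≤ c) (hc1 : c ≤ 1)
    (h : ∀ y, (ρ y).toReal * (acc y true).toReal = c * (π y).toReal) (r i : ℕ)
    (w : (Fin r → Y) → ℝ) (hw : ∀ X, 0 ≤ w X ∧ w X ≤ 1) :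
    ∃ φ : (Fin i → Y) → ℝ, (∀ u, 0 ≤ φ u ∧ φ u ≤ 1) ∧
      (∀ g, Ex (iid (Fin r) ρ) (fun X => w X * selEx acc i X g) =
        Ex (iid (Fin i) π) fun u => φ u * g u) ∧
      Ex (iid (Fin r) ρ) w - (1 - selProb c r i) ≤ Ex (iid (Fin i) π) φ := by
  classical
  have hpr : ∀ r i, 0 ≤ selProb c r i ∧ selProb c r i ≤ 1 := by
    intro r
    induction r with
    | zero => intro i; cases i <;> simp [selProb]
    | succ r ih =>
      intro i
      cases i with
      | zero => simp [selProb]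
      | succ i =>
        obtain ⟨h1, h2⟩ := ih i
        obtain ⟨h3, h4⟩ := ih (i + 1)
        simp only [selProb]
        constructor <;> nlinarith
  -- The weighted probability of selecting `u`. Without the weight it would be `selProb c r i` times
  -- the product law of `π`, so its density with respect to that law is at most `1`; this density is
  -- the new weight.
  set l : (Fin i → Y) → ℝ := fun u =>
    Ex (iid (Fin r) ρ) fun X => w X * selEx acc i X fun u' => if u' = u then 1 else 0
  have hs0 : ∀ X : Fin r → Y, ∀ u, 0 ≤ selEx acc i X fun u' => if u' = u then (1 : ℝ) else 0 :=
    fun X u => (selEx_const_zero acc i X).symm.le.trans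
      (selEx_mono acc i X fun u' => by split_ifs <;> simp)
  have hl0 : ∀ u, 0 ≤ l u := fun u => Ex_nonneg _ fun X => mul_nonneg (hw X).1 (hs0 X u)
  have hl1 : ∀ u, l u ≤ (iid (Fin i) π u).toReal := fun u => by
    have h1 : l u ≤ Ex (iid (Fin r) ρ) fun X => selEx acc i X fun u' => if u' = u then 1 else 0 :=
      Ex_mono _ fun X => mul_le_of_le_one_left (hs0 X u) (hw X).2
    rw [Ex_selEx h, Ex_indicator_eq] at h1
    exact h1.trans (mul_le_of_le_one_left ENNReal.toReal_nonneg (hpr r i).2)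
  have hlin : ∀ g, Ex (iid (Fin r) ρ) (fun X => w X * selEx acc i X g) = ∑ u, l u * g u := by
    intro g
    have h1 : ∀ X : Fin r → Y, w X * selEx acc i X g =
        ∑ u, g u * (w X * selEx acc i X fun u' => if u' = u then 1 else 0) := by
      intro X
      have h2 : selEx acc i X g =
          selEx acc i X fun u' => ∑ u, g u * (if u' = u then (1 : ℝ) else 0) := by
        congr 1; funext u'; simp
      rw [h2, selEx_sum, Finset.mul_sum]
      refine Finset.sum_congr rfl fun u _ => ?_
      rw [selEx_mul_left]; ring
    simp only [h1]
    rw [Ex_sum]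
    refine Finset.sum_congr rfl fun u _ => ?_
    rw [Ex_mul_left, mul_comm]
  have hid : ∀ g, Ex (iid (Fin r) ρ) (fun X => w X * selEx acc i X g) =
      Ex (iid (Fin i) π) fun u => l u / (iid (Fin i) π u).toReal * g u := by
    intro g
    rw [hlin, Ex]
    refine Finset.sum_congr rfl fun u _ => ?_
    by_cases h0 : (iid (Fin i) π u).toReal = 0
    · have : l u = 0 := le_antisymm (h0 ▸ hl1 u) (hl0 u)
      rw [this, h0]; simp
    · field_simp
  refine ⟨fun u => l u / (iid (Fin i) π u).toReal, fun u => ⟨div_nonneg (hl0 u)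
    ENNReal.toReal_nonneg, div_le_one_of_le₀ (hl1 u) ENNReal.toReal_nonneg⟩, hid, ?_⟩
  have h1 := hid fun _ => 1
  simp only [mul_one] at h1
  rw [← h1]
  have h2 := Ex_selEx h r i fun _ => 1
  rw [Ex_const, mul_one] at h2
  -- For `w` and `s` at most `1`, `w s ≥ w - (1 - s)`; hence the total weight drops by no more than
  -- the probability of selecting too few rows.
  have h3 : Ex (iid (Fin r) ρ) (fun X => w X - (1 - selEx acc i X fun _ => 1)) ≤
      Ex (iid (Fin r) ρ) fun X => w X * selEx acc i X fun _ => 1 :=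
    Ex_mono _ fun X => by
      have := selEx_le_one acc i X
      nlinarith [(hw X).1, (hw X).2]
  rw [Ex_sub, Ex_sub, Ex_const, h2] at h3
  exact h3

end Pool

/-! ### Counting vectors by weight -/

theorem card_weightSet (n w : ℕ) : (weightSet n w).card = n.choose w := by
  classical
  rw [← Fintype.card_fin n, ← Finset.card_univ, ← Finset.card_powersetCard, Finset.card_univ,
    Fintype.card_fin]
  have h01 : ∀ x : ZMod 2, x ≠ 0 → x = 1 := by decide
  refine Finset.card_bij (fun v _ => Finset.univ.filter fun t => v t ≠ 0) ?_ ?_ ?_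
  · intro v hv
    simp only [weightSet, Finset.mem_filter, Finset.mem_univ, true_and] at hv
    exact Finset.mem_powersetCard.2 ⟨Finset.subset_univ _, hv⟩
  · intro v _ v' _ h
    funext t
    have := Finset.ext_iff.1 h t
    simp only [Finset.mem_filter, Finset.mem_univ, true_and] at this
    by_cases hv : v t = 0
    · rw [hv]; exact (not_not.1 (this.not.1 (not_not.2 hv))).symm
    · rw [h01 _ hv, h01 _ (this.1 hv)]
  · intro s hs
    refine ⟨fun t => if t ∈ s then 1 else 0, ?_, ?_⟩
    · simpa [weightSet, hammingNorm, Finset.mem_powersetCard] using hs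
    · ext t; simp

theorem sum_hammingNorm {B : Type} [AddCommMonoid B] (n : ℕ) (F : ℕ → B) :
    ∑ a : Fin n → ZMod 2, F (hammingNorm a) = ∑ w ∈ Finset.range (n + 1), n.choose w • F w := by
  rw [← Finset.sum_fiberwise_of_maps_to (t := Finset.range (n + 1)) (g := fun a => hammingNorm a)
    fun a _ => Finset.mem_range_succ_iff.2 (hammingNorm_le a)]
  refine Finset.sum_congr rfl fun w _ => ?_
  rw [← card_weightSet, weightSet, ← Finset.sum_const]
  refine Finset.sum_congr rfl fun a ha => ?_
  rw [(Finset.mem_filter.1 ha).2]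

/-- The number of completions of a block of weight `w` to a vector of weight `K`, with `N`
coordinates outside the block. -/
def completions (N K w : ℕ) : ℕ := if w ≤ K then N.choose (K - w) else 0

/-- Vandermonde's identity, with the blocks grouped by weight. -/
theorem sum_completions (n N K : ℕ) :
    ∑ a : Fin n → ZMod 2, completions N K (hammingNorm a) = (n + N).choose K := by
  rw [sum_hammingNorm n (completions N K), Nat.add_choose_eq,
    Finset.Nat.sum_antidiagonal_eq_sum_range_succ (fun i j => n.choose i * N.choose j)]
  simp only [smul_eq_mul]
  have h1 : ∑ w ∈ Finset.range (n + 1), n.choose w * completions N K w =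
      ∑ w ∈ Finset.range (n + K + 1), n.choose w * completions N K w := by
    refine Finset.sum_subset (fun w hw => ?_) fun w _ hw => ?_
    · simp only [Finset.mem_range] at hw ⊢; omega
    · simp only [Finset.mem_range] at hw
      rw [Nat.choose_eq_zero_of_lt (by omega), zero_mul]
  have h2 : ∑ w ∈ Finset.range (K + 1), n.choose w * N.choose (K - w) =
      ∑ w ∈ Finset.range (n + K + 1), n.choose w * completions N K w := by
    refine (Finset.sum_congr rfl fun w hw => ?_).trans (Finset.sum_subset (fun w hw => ?_)
      fun w _ hw => ?_)
    · rw [completions, if_pos (Finset.mem_range_succ_iff.1 hw)]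
    · simp only [Finset.mem_range] at hw ⊢; omega
    · simp only [Finset.mem_range] at hw
      rw [completions, if_neg (by omega), mul_zero]
  rw [h1, h2]

/-- The law of a block of `n` coordinates of a random vector of weight `K` in dimension `n + N`. -/
def blockRow (n N K : ℕ) (h : K ≤ n + N) : PMF (Fin n → ZMod 2) :=
  PMF.ofFintype (fun a => (completions N K (hammingNorm a) : ℝ≥0∞) / ((n + N).choose K : ℝ≥0∞))
    (by
      simp only [div_eq_mul_inv]
      rw [← Finset.sum_mul, ← Nat.cast_sum, sum_completions]
      exact ENNReal.mul_inv_cancel (by exact_mod_cast (Nat.choose_pos h).ne')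
        (ENNReal.natCast_ne_top _))

theorem blockRow_apply {n N K : ℕ} (h : K ≤ n + N) (a : Fin n → ZMod 2) :
    (blockRow n N K h a).toReal =
      (completions N K (hammingNorm a) : ℝ) / ((n + N).choose K : ℝ) := by
  simp [blockRow, PMF.ofFintype_apply, ENNReal.toReal_div]

/-! ### Completing a block to a row -/

theorem coin_true {N r : ℕ} (h : N ≤ r + 1) : (coin N r true).toReal = N / (r + 1) := by
  have h1 : (coin N r true).toReal = Ex (coin N r) fun t => if t then 1 else 0 := by
    rw [Ex_eq_bool]; simp
  rw [h1, coin, Ex_map, Ex_uniformOfFintype]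
  simp only [decide_eq_true_eq, Fintype.card_fin, Nat.cast_add, Nat.cast_one]
  rw [Finset.sum_boole, Fin.card_filter_val_lt, min_eq_right h]

theorem coin_false {N r : ℕ} (h : N ≤ r + 1) :
    (coin N r false).toReal = ((r + 1 - N : ℕ) : ℝ) / (r + 1) := by
  have h1 := sum_toReal_pmf (coin N r)
  rw [Fintype.sum_bool, coin_true h] at h1
  rw [Nat.cast_sub h]
  field_simp at h1 ⊢
  push_cast
  linarith

section Fill

variable {k n : ℕ} {j : Fin k} {a : Fin n → ZMod 2} {R : ℕ}

theorem tailWeight_congr {v v' : Fin (k * n) → ZMod 2} {i : ℕ}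
    (h : ∀ c : Fin (k * n), i ≤ c → v c = v' c) : tailWeight j v i = tailWeight j v' i := by
  refine Finset.sum_congr rfl fun c hc => ?_
  rw [h c (Finset.mem_filter.1 hc).2]

theorem drawAll_fillLaw (v₀ v : Fin (k * n) → ZMod 2) :
    drawAll (fillLaw j a R) (k * n) v₀ v = ∏ c, fillLaw j a R c v (v c) := by
  refine drawAll_full (fun c v v' h => ?_) v₀ v
  unfold fillLaw
  rw [tailWeight_congr fun c' hc' => h c' hc']

theorem block_of_mem_support {v₀ v : Fin (k * n) → ZMod 2}
    (h : v ∈ (drawAll (fillLaw j a R) (k * n) v₀).support) : block j v = a := by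
  funext t
  rw [PMF.mem_support_iff, drawAll_fillLaw, Finset.prod_ne_zero_iff] at h
  have h1 := h (finProdFinEquiv (j, t)) (Finset.mem_univ _)
  have h2 : ¬ Outside j (finProdFinEquiv (j, t)) := by simp [Outside]
  rw [fillLaw, if_neg h2] at h1
  simpa [block] using h1

/-- The weight outside block `j` of the coordinates below `i`. -/
def headWeight {k n : ℕ} (j : Fin k) (v : Fin (k * n) → ZMod 2) (i : ℕ) : ℕ :=
  ∑ c ∈ Finset.univ.filter (fun c : Fin (k * n) => c < i), if Outside j c then (v c).val else 0

theorem sum_filter_lt_succ {d : ℕ} {B : Type} [AddCommMonoid B] (f : Fin d → B) {i : ℕ}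
    (hi : i < d) : ∑ c ∈ Finset.univ.filter (fun c : Fin d => c.val < i + 1), f c =
      f ⟨i, hi⟩ + ∑ c ∈ Finset.univ.filter (fun c : Fin d => c.val < i), f c := by
  have : Finset.univ.filter (fun c : Fin d => c.val < i + 1) =
      insert ⟨i, hi⟩ (Finset.univ.filter (fun c : Fin d => c.val < i)) := by
    ext c
    simp only [Finset.mem_filter, Finset.mem_univ, true_and, Finset.mem_insert, Fin.ext_iff]
    omega
  rw [this, Finset.sum_insert (by simp)]

theorem headWeight_add_tailWeight (j : Fin k) (v : Fin (k * n) → ZMod 2) (i : ℕ) :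
    headWeight j v i + tailWeight j v i = headWeight j v (k * n) := by
  unfold headWeight tailWeight
  have h1 : Finset.univ.filter (fun c : Fin (k * n) => c.val < k * n) = Finset.univ :=
    Finset.filter_true_of_mem fun c _ => c.2
  rw [h1, ← Finset.sum_filter_add_sum_filter_not Finset.univ (fun c : Fin (k * n) => c.val < i)]
  simp only [not_lt]

theorem headWeight_le_headCount (j : Fin k) (v : Fin (k * n) → ZMod 2) (i : ℕ) :
    headWeight j v i ≤ headCount n j i := by
  unfold headWeight headCount
  rw [Finset.card_eq_sum_ones, ← Finset.filter_filter, Finset.sum_filter (fun c => Outside j c)]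
  refine Finset.sum_le_sum fun c _ => ?_
  split_ifs
  · have : ∀ x : ZMod 2, x.val ≤ 1 := by decide
    exact this _
  · exact le_rfl

/-- This is drawing without replacement: a place receives a one with probability (ones left) /
(places left). By the absorption identities for binomial coefficients the product telescopes to the
reciprocal of the number of completions, the same for all of them. -/
theorem prod_fillLaw (v : Fin (k * n) → ZMod 2) (ha : block j v = a)
    (hR : headWeight j v (k * n) = R) : ∀ i ≤ k * n,
    ∏ c ∈ Finset.univ.filter (fun c : Fin (k * n) => c.val < i), (fillLaw j a R c v (v c)).toReal =
      1 / ((headCount n j i).choose (headWeight j v i) : ℝ) := by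
  intro i
  induction i with
  | zero =>
    intro _
    simp [headWeight]
  | succ i ih =>
    intro hi
    have hi' : i < k * n := hi
    have hset : Finset.univ.filter (fun c : Fin (k * n) => c.val < i + 1) =
        insert ⟨i, hi'⟩ (Finset.univ.filter (fun c : Fin (k * n) => c.val < i)) := by
      ext c
      simp only [Finset.mem_filter, Finset.mem_univ, true_and, Finset.mem_insert, Fin.ext_iff]
      omega
    rw [hset, Finset.prod_insert (by simp), ih hi'.le]
    have hc := headCount_succ j ⟨i, hi'⟩
    have hw : headWeight j v (i + 1) =
        (if Outside j ⟨i, hi'⟩ then (v ⟨i, hi'⟩).val else 0) + headWeight j v i :=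
      sum_filter_lt_succ _ hi'
    have hle := headWeight_le_headCount j v i
    have ht := headWeight_add_tailWeight j v (i + 1)
    simp only at hc
    rw [hc, hw]
    unfold fillLaw
    by_cases ho : Outside j ⟨i, hi'⟩
    · simp only [if_pos ho] at hw ⊢
      set N := headWeight j v i
      set h := headCount n j i
      have hN : R - tailWeight j v (i + 1) = (v ⟨i, hi'⟩).val + N := by omega
      rw [hN]
      have hv : ∀ x : ZMod 2, x = 0 ∨ x = 1 := by decide
      have hmap : ∀ (p : PMF Bool),
          (p.map (fun t => if t then (1 : ZMod 2) else 0) 0) = p false ∧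
          (p.map (fun t => if t then (1 : ZMod 2) else 0) 1) = p true := by
        intro p
        constructor <;> simp [PMF.map_apply, tsum_fintype]
      rcases hv (v ⟨i, hi'⟩) with h0 | h1
      · rw [h0, (hmap _).1]
        simp only [ZMod.val_zero, zero_add]
        rw [coin_false (by omega), add_comm 1 h]
        have hpos : (0 : ℝ) < h.choose N := by exact_mod_cast Nat.choose_pos hle
        have hpos' : (0 : ℝ) < (h + 1).choose N := by exact_mod_cast Nat.choose_pos (by omega)
        have := Nat.choose_mul_succ_eq h N
        have hR : ((h.choose N : ℕ) : ℝ) * ((h : ℝ) + 1) =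
          ((h + 1).choose N : ℕ) * ((h + 1 - N : ℕ) : ℝ) := by exact_mod_cast this
        field_simp
        linarith
      · rw [h1, (hmap _).2]
        have e1 : (1 : ZMod 2).val = 1 := rfl
        simp only [e1]
        rw [coin_true (by omega), add_comm 1 h, add_comm 1 N]
        have hpos : (0 : ℝ) < h.choose N := by exact_mod_cast Nat.choose_pos hle
        have hpos' : (0 : ℝ) < (h + 1).choose (N + 1) := by
          exact_mod_cast Nat.choose_pos (by omega)
        have := Nat.add_one_mul_choose_eq h N
        have hR : ((h : ℝ) + 1) * (h.choose N : ℕ) = ((h + 1).choose (N + 1) : ℕ) * ((N : ℝ) + 1) := by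
          exact_mod_cast this
        push_cast
        field_simp
        linarith
    · simp only [if_neg ho, zero_add]
      have : v ⟨i, hi'⟩ = a (finProdFinEquiv.symm ⟨i, hi'⟩).2 := by
        rw [← ha, block]
        congr 1
        have h1 : (finProdFinEquiv.symm (⟨i, hi'⟩ : Fin (k * n))).1 = j := not_not.1 ho
        rw [← h1]
        exact (finProdFinEquiv.apply_symm_apply _).symm
      rw [this]
      simp

end Fill

section Row

variable {k' n σ : ℕ}

theorem hammingNorm_block_add (j : Fin (k' + 1)) (v : Fin ((k' + 1) * n) → ZMod 2) :
    hammingNorm (block j v) + headWeight j v ((k' + 1) * n) = hammingNorm v := by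
  rw [← sum_val_eq_hammingNorm, ← sum_val_eq_hammingNorm, headWeight]
  rw [Finset.filter_true_of_mem fun c _ => c.2, ← Equiv.sum_comp finProdFinEquiv,
    ← Equiv.sum_comp finProdFinEquiv, Fintype.sum_prod_type, Fintype.sum_prod_type,
    ← Finset.add_sum_erase _ _ (Finset.mem_univ j),
    ← Finset.add_sum_erase _ (fun i => ∑ t, (v (finProdFinEquiv (i, t))).val) (Finset.mem_univ j)]
  have h1 : ∀ t : Fin n, ¬ Outside j (finProdFinEquiv (j, t)) := fun t => by simp [Outside]
  have h2 : ∑ t : Fin n, (if Outside j (finProdFinEquiv (j, t)) then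
      (v (finProdFinEquiv (j, t))).val else 0) = 0 :=
    Finset.sum_eq_zero fun t _ => if_neg (h1 t)
  rw [h2, zero_add]
  congr 1
  refine Finset.sum_congr rfl fun i hi => Finset.sum_congr rfl fun t _ => ?_
  rw [if_pos]
  simpa [Outside] using hi

/-- Completion of a block to a row of weight `kσ`. -/
def completeRow (σ : ℕ) (j : Fin (k' + 1)) (a : Fin n → ZMod 2) :
    PMF (Fin ((k' + 1) * n) → ZMod 2) :=
  drawAll (fillLaw j a ((k' + 1) * σ - hammingNorm a)) ((k' + 1) * n) 0

/-- With `R` ones left to place, a block has mass `C(k'n, R) / C(kn, kσ)` for `k = k' + 1`, and each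
completion has conditional mass `1 / C(k'n, R)`. The single term of the mixture that belongs to the
block of `v` thus already accounts for the uniform mass of `v`; since both laws have total mass `1`,
the pointwise inequality is an equality. -/
theorem blockRow_bind_completeRow (hσ : σ ≤ n) (j : Fin (k' + 1))
    (h : (k' + 1) * σ ≤ n + k' * n) :
    (blockRow n (k' * n) ((k' + 1) * σ) h).bind (completeRow σ j) =
      exactRow ((k' + 1) * n) ((k' + 1) * σ) (Nat.mul_le_mul_left _ hσ) := by
  classical
  set p := exactRow ((k' + 1) * n) ((k' + 1) * σ) (Nat.mul_le_mul_left _ hσ)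
  set q := (blockRow n (k' * n) ((k' + 1) * σ) h).bind (completeRow σ j)
  have hle : ∀ v, p v ≤ q v := by
    intro v
    by_cases hv : v ∈ weightSet ((k' + 1) * n) ((k' + 1) * σ)
    swap
    · rw [show p v = 0 from PMF.uniformOfFinset_apply_of_notMem _ hv]; exact zero_le
    have hpv : (p v) = ((((k' + 1) * n).choose ((k' + 1) * σ) : ℕ) : ℝ≥0∞)⁻¹ := by
      rw [show p v = _ from PMF.uniformOfFinset_apply_of_mem _ hv, card_weightSet]
    have hw : hammingNorm v = (k' + 1) * σ := (Finset.mem_filter.1 hv).2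
    have hadd := hammingNorm_block_add j v
    have hhead := headWeight_le_headCount j v ((k' + 1) * n)
    rw [headCount_top] at hhead
    set a := block j v with ha
    set R := (k' + 1) * σ - hammingNorm a
    have hR : headWeight j v ((k' + 1) * n) = R := by omega
    have h1 : (completeRow σ j a v).toReal = 1 / ((k' * n).choose R : ℝ) := by
      rw [completeRow, drawAll_fillLaw, ENNReal.toReal_prod]
      have := prod_fillLaw v ha.symm hR _ le_rfl
      rwa [Finset.filter_true_of_mem fun c _ => c.2, headCount_top, hR] at this
    have hpos : (0 : ℝ) < (k' * n).choose R := by exact_mod_cast Nat.choose_pos (by omega)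
    have h2 : p v = blockRow n (k' * n) ((k' + 1) * σ) h a * completeRow σ j a v := by
      rw [← ENNReal.toReal_eq_toReal_iff' (PMF.apply_ne_top _ _)
        (ENNReal.mul_ne_top (PMF.apply_ne_top _ _) (PMF.apply_ne_top _ _)), ENNReal.toReal_mul, h1,
        blockRow_apply, completions, if_pos (by omega), hpv]
      rw [show n + k' * n = (k' + 1) * n by ring]
      rw [ENNReal.toReal_inv, ENNReal.toReal_natCast]
      field_simp
      rfl
    rw [h2]
    rw [PMF.bind_apply]
    exact ENNReal.le_tsum a
  have hsum : ∀ r : PMF (Fin ((k' + 1) * n) → ZMod 2), ∑ v, (r v).toReal = 1 := sum_toReal_pmf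
  have hle' : ∀ v, (p v).toReal ≤ (q v).toReal := fun v =>
    ENNReal.toReal_mono (PMF.apply_ne_top _ _) (hle v)
  have heq := (Finset.sum_eq_sum_iff_of_le (s := Finset.univ) fun v _ => hle' v).1
    ((hsum p).trans (hsum q).symm)
  ext v
  exact ((ENNReal.toReal_eq_toReal_iff' (PMF.apply_ne_top _ _) (PMF.apply_ne_top _ _)).1
    (heq v (Finset.mem_univ v))).symm

theorem exactRow_map_block (hσ : σ ≤ n) (j : Fin (k' + 1)) (h : (k' + 1) * σ ≤ n + k' * n) :
    (exactRow ((k' + 1) * n) ((k' + 1) * σ) (Nat.mul_le_mul_left _ hσ)).map (block j) =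
      blockRow n (k' * n) ((k' + 1) * σ) h := by
  rw [← blockRow_bind_completeRow hσ j h, PMF.map_bind]
  refine (pmf_bind_congr _ (g := PMF.pure) fun a _ => ?_).trans (PMF.bind_pure _)
  have : (completeRow σ j a).bind (fun v => PMF.pure (block j v)) =
      (completeRow σ j a).bind fun _ => PMF.pure a :=
    pmf_bind_congr _ fun v hv => by rw [block_of_mem_support hv]
  rw [PMF.map, show (PMF.pure ∘ block j : _ → PMF (Fin n → ZMod 2)) =
    fun v => PMF.pure (block j v) from rfl, this, PMF.bind_const]

end Row

/-! ### The acceptance probability -/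

/-- The product of the acceptance factors. -/
def accProd (u p q x : ℕ) : ℝ :=
  ∏ t ∈ Finset.range x, ((u - t * q : ℕ) : ℝ) / ((u + (t + 1) * p : ℕ) : ℝ)

theorem iter_accStep {u p q x : ℕ} (hp : 0 < p) (flag : Bool) :
    (iter (accStep u p q x) x flag true).toReal = if flag then accProd u p q x else 0 := by
  have hE : ∀ q : PMF Bool, (q true).toReal = Ex q fun t => if t then 1 else 0 := fun q => by
    rw [Ex_eq_bool]; simp
  have key : ∀ i ≤ x, ∀ flag : Bool, Ex (iter (accStep u p q x) i flag)
      (fun t => if t then (1 : ℝ) else 0) = if flag then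
        ∏ t ∈ Finset.range i, ((u - (x - (t + 1)) * q : ℕ) : ℝ) / ((u + (x - t) * p : ℕ) : ℝ)
        else 0 := by
    intro i
    induction i with
    | zero => intro _ flag; simp [iter, Ex_pure]
    | succ i ih =>
      intro hi flag
      rw [iter, Ex_bind]
      simp only [ih (by omega)]
      rw [accStep, Ex_map, Ex_eq_bool]
      have h1 : 0 < (x - i) * p := Nat.mul_pos (by omega) hp
      rw [coin_true (by
        have := Nat.sub_le u ((x - (i + 1)) * q)
        omega)]
      cases flag with
      | false => simp
      | true =>
        have h2 : ((u + (x - i) * p - 1 : ℕ) : ℝ) + 1 = ((u + (x - i) * p : ℕ) : ℝ) := by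
          rw [← Nat.cast_succ]; congr 1; omega
        rw [h2, Finset.prod_range_succ]
        simp only [Bool.true_and, if_true, Bool.false_eq_true, if_false, mul_zero, add_zero]
        rw [mul_comm]
  rw [hE, key x le_rfl flag, accProd]
  split_ifs
  · rw [← Finset.prod_range_reflect]
    refine Finset.prod_congr rfl fun t ht => ?_
    have ht := Finset.mem_range.1 ht
    rw [show x - (x - 1 - t + 1) = t by omega, show x - (x - 1 - t) = t + 1 by omega]
  · rfl

theorem acceptLaw_true {n σ k' w : ℕ} (h0 : 0 < σ) (hσ : σ < n) :
    (acceptLaw n σ k' w true).toReal = accProd (k' * σ * (n - σ)) σ (n - σ) (w - σ) *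
      accProd (k' * σ * (n - σ)) (n - σ) σ (σ - w) := by
  have h1 : (acceptLaw n σ k' w true).toReal = Ex (acceptLaw n σ k' w) fun t => if t then 1 else 0 := by
    rw [Ex_eq_bool]; simp
  have h2 : ∀ q : PMF Bool, Ex q (fun t => if t then (1 : ℝ) else 0) = (q true).toReal := fun q => by
    rw [Ex_eq_bool]; simp
  rw [h1, acceptLaw, Ex_bind]
  simp only [h2]
  rw [Ex_eq_bool]
  simp only [iter_accStep h0, iter_accStep (show 0 < n - σ by omega)]
  simp

section

variable {s r k' : ℕ}

/-- With `n = s + r`, raising the weight from `s + t` by one multiplies the number of completions by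
`(k's - t) / (k'r + t + 1)` and the mass of a row with independent coordinates by `s / r`. The
quotient of these two is the next factor of `accProd`. From `t = k's` on, the truncated subtraction
and the vanishing number of completions agree. -/
theorem accProd_up (hs : 0 < s) (hr : 0 < r) : ∀ t ≤ r,
    (s : ℝ) ^ (s + t) * (r : ℝ) ^ (r - t) * accProd (k' * s * r) s r t *
        ((k' * (s + r)).choose (k' * s) : ℝ) =
      (s : ℝ) ^ s * (r : ℝ) ^ r * (completions (k' * (s + r)) ((k' + 1) * s) (s + t) : ℝ) := by
  intro t
  induction t with
  | zero =>
    intro _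
    have : (k' + 1) * s - s = k' * s := by rw [add_mul, one_mul, Nat.add_sub_cancel]
    simp [accProd, completions, this, Nat.le_mul_of_pos_left]
  | succ t ih =>
    intro ht
    have ih := ih (by omega)
    have hcomp : (completions (k' * (s + r)) ((k' + 1) * s) (s + (t + 1)) : ℝ) *
        ((k' * r + t + 1 : ℕ) : ℝ) =
        (completions (k' * (s + r)) ((k' + 1) * s) (s + t) : ℝ) * ((k' * s - t : ℕ) : ℝ) := by
      norm_cast
      have e1 : (k' + 1) * s = k' * s + s := by ring
      unfold completions
      by_cases h : t < k' * s
      · rw [if_pos (by omega), if_pos (by omega), e1,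
          show k' * s + s - (s + (t + 1)) = k' * s - t - 1 by omega,
          show k' * s + s - (s + t) = k' * s - t - 1 + 1 by omega]
        have := Nat.choose_succ_right_eq (k' * (s + r)) (k' * s - t - 1)
        rw [show k' * s - t - 1 + 1 = k' * s - t by omega,
          show k' * (s + r) - (k' * s - t - 1) = k' * r + t + 1 by rw [mul_add]; omega] at this
        rw [show k' * s - t - 1 + 1 = k' * s - t by omega]
        exact this.symm
      · rw [if_neg (by omega), show k' * s - t = 0 by omega]
        simp
    have hf : ((k' * s * r - t * r : ℕ) : ℝ) / ((k' * s * r + (t + 1) * s : ℕ) : ℝ) =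
        (r : ℝ) / s * (((k' * s - t : ℕ) : ℝ) / ((k' * r + t + 1 : ℕ) : ℝ)) := by
      rw [← Nat.sub_mul, show k' * s * r + (t + 1) * s = s * (k' * r + t + 1) by ring]
      push_cast
      field_simp
    have hD : (0 : ℝ) < ((k' * r + t + 1 : ℕ) : ℝ) := by positivity
    rw [accProd, Finset.prod_range_succ, ← accProd, hf]
    have e2 : (r : ℝ) ^ (r - t) = r ^ (r - (t + 1)) * r := by
      rw [← pow_succ]; congr 1; omega
    rw [e2] at ih
    rw [eq_div_iff hD.ne' |>.2 hcomp]
    have hs' : (0 : ℝ) < s := by exact_mod_cast hs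
    have e3 : (s : ℝ) ^ (s + (t + 1)) = s ^ (s + t) * s := by rw [← pow_succ]; rfl
    rw [e3]
    calc _ = ((s : ℝ) ^ (s + t) * (r ^ (r - (t + 1)) * r) * accProd (k' * s * r) s r t *
        ((k' * (s + r)).choose (k' * s) : ℝ)) *
          (((k' * s - t : ℕ) : ℝ) / ((k' * r + t + 1 : ℕ) : ℝ)) := by
          field_simp
      _ = _ := by rw [ih]; ring

/-- As in `accProd_up`: lowering the weight from `s - t` by one multiplies the number of completions
by `(k'r - t) / (k's + t + 1)` and the mass of the row by `r / s`. -/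
theorem accProd_down (hs : 0 < s) (hr : 0 < r) : ∀ t ≤ s,
    (s : ℝ) ^ (s - t) * (r : ℝ) ^ (r + t) * accProd (k' * s * r) r s t *
        ((k' * (s + r)).choose (k' * s) : ℝ) =
      (s : ℝ) ^ s * (r : ℝ) ^ r * (completions (k' * (s + r)) ((k' + 1) * s) (s - t) : ℝ) := by
  intro t
  have e1 : (k' + 1) * s = k' * s + s := by ring
  induction t with
  | zero =>
    intro _
    have : (k' + 1) * s - s = k' * s := by rw [add_mul, one_mul, Nat.add_sub_cancel]
    simp [accProd, completions, this, Nat.le_mul_of_pos_left]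
  | succ t ih =>
    intro ht
    have ih := ih (by omega)
    have hcomp : (completions (k' * (s + r)) ((k' + 1) * s) (s - (t + 1)) : ℝ) *
        ((k' * s + t + 1 : ℕ) : ℝ) =
        (completions (k' * (s + r)) ((k' + 1) * s) (s - t) : ℝ) * ((k' * r - t : ℕ) : ℝ) := by
      norm_cast
      unfold completions
      rw [if_pos (by omega), if_pos (by omega), e1,
        show k' * s + s - (s - (t + 1)) = k' * s + t + 1 by omega,
        show k' * s + s - (s - t) = k' * s + t by omega]
      have := Nat.choose_succ_right_eq (k' * (s + r)) (k' * s + t)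
      rwa [show k' * (s + r) - (k' * s + t) = k' * r - t by rw [mul_add]; omega] at this
    have hf : ((k' * s * r - t * s : ℕ) : ℝ) / ((k' * s * r + (t + 1) * r : ℕ) : ℝ) =
        (s : ℝ) / r * (((k' * r - t : ℕ) : ℝ) / ((k' * s + t + 1 : ℕ) : ℝ)) := by
      rw [show k' * s * r = k' * r * s by ring, ← Nat.sub_mul,
        show k' * r * s + (t + 1) * r = r * (k' * s + t + 1) by ring]
      push_cast
      field_simp
    have hD : (0 : ℝ) < ((k' * s + t + 1 : ℕ) : ℝ) := by positivity
    rw [accProd, Finset.prod_range_succ, ← accProd, hf]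
    have e2 : (s : ℝ) ^ (s - t) = s ^ (s - (t + 1)) * s := by
      rw [← pow_succ]; congr 1; omega
    rw [e2] at ih
    rw [eq_div_iff hD.ne' |>.2 hcomp]
    have hr' : (0 : ℝ) < r := by exact_mod_cast hr
    have e3 : (r : ℝ) ^ (r + (t + 1)) = r ^ (r + t) * r := by rw [← pow_succ]; rfl
    rw [e3]
    calc _ = ((s : ℝ) ^ (s - (t + 1)) * s * r ^ (r + t) * accProd (k' * s * r) r s t *
        ((k' * (s + r)).choose (k' * s) : ℝ)) *
          (((k' * r - t : ℕ) : ℝ) / ((k' * s + t + 1 : ℕ) : ℝ)) := by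
          field_simp
      _ = _ := by rw [ih]; ring

end

section

variable {n σ k' : ℕ}

theorem approxRow_apply (hσ : σ ≤ n) (a : Fin n → ZMod 2) : (approxRow n σ a).toReal =
    (σ : ℝ) ^ hammingNorm a * ((n - σ : ℕ) : ℝ) ^ (n - hammingNorm a) / (n : ℝ) ^ n := by
  rcases Nat.eq_zero_or_pos n with rfl | hn
  · have : hammingNorm a = 0 := Nat.le_zero.1 (hammingNorm_le a)
    simp [this, approxRow, iid_eq_indep, indep_apply]
  have hn' : (0 : ℝ) < n := by exact_mod_cast hn
  have hp0 : (0 : ℝ) ≤ (σ : ℝ) / n := by positivity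
  have hp1 : (σ : ℝ) / n ≤ 1 := by
    rw [div_le_one hn']; exact_mod_cast hσ
  have h01 : ∀ x : ZMod 2, x ≠ 0 → x = 1 := by decide
  rw [approxRow, iid_eq_indep, indep_apply_toReal,
    ← Finset.prod_filter_mul_prod_filter_not Finset.univ (fun t => a t ≠ 0),
    Finset.prod_congr rfl (g := fun _ => (σ : ℝ) / n), Finset.prod_const,
    Finset.prod_congr rfl (g := fun _ => ((n - σ : ℕ) : ℝ) / n), Finset.prod_const]
  · have hc : (Finset.univ.filter fun t => ¬ a t ≠ 0).card = n - hammingNorm a := by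
      have := Finset.card_filter_add_card_filter_not (s := Finset.univ) (fun t => a t ≠ 0)
      rw [Finset.card_univ, Fintype.card_fin] at this
      unfold hammingNorm
      omega
    have hw := hammingNorm_le a
    rw [hc, show (Finset.univ.filter fun t => a t ≠ 0).card = hammingNorm a from rfl, div_pow,
      div_pow, div_mul_div_comm, ← pow_add, Nat.add_sub_cancel' hw]
  · intro t ht
    rw [not_not.1 (Finset.mem_filter.1 ht).2, ber_zero hp0 hp1, Nat.cast_sub hσ]
    field_simp
  · intro t ht
    rw [h01 _ (Finset.mem_filter.1 ht).2, ber_one hp0 hp1]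

/-- The overall acceptance probability. -/
def acceptProb (n σ k' : ℕ) : ℝ :=
  (σ : ℝ) ^ σ * ((n - σ : ℕ) : ℝ) ^ (n - σ) / (n : ℝ) ^ n *
    (((n + k' * n).choose ((k' + 1) * σ) : ℝ) / ((k' * n).choose (k' * σ) : ℝ))

/-- Rejection sampling turns a row with independent coordinates into a block of a row of fixed
weight. -/
theorem approxRow_mul_acceptLaw (h0 : 0 < σ) (hσ : σ < n) (h : (k' + 1) * σ ≤ n + k' * n)
    (a : Fin n → ZMod 2) :
    (approxRow n σ a).toReal * (acceptLaw n σ k' (hammingNorm a) true).toReal =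
      acceptProb n σ k' * (blockRow n (k' * n) ((k' + 1) * σ) h a).toReal := by
  rw [approxRow_apply hσ.le, acceptLaw_true h0 hσ, blockRow_apply, acceptProb]
  have hw := hammingNorm_le a
  set w := hammingNorm a
  obtain ⟨r, rfl⟩ : ∃ r, n = σ + r := ⟨n - σ, by omega⟩
  have hr : 0 < r := by omega
  rw [show σ + r - σ = r by omega]
  have hC : (0 : ℝ) < (((σ + r) + k' * (σ + r)).choose ((k' + 1) * σ) : ℝ) := by
    exact_mod_cast Nat.choose_pos h
  have hC' : (0 : ℝ) < ((k' * (σ + r)).choose (k' * σ) : ℝ) := by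
    exact_mod_cast Nat.choose_pos (Nat.mul_le_mul_left _ (by omega))
  have hn : (0 : ℝ) < ((σ + r : ℕ) : ℝ) ^ (σ + r) := by
    have : 0 < σ + r := by omega
    positivity
  suffices hk : (σ : ℝ) ^ w * (r : ℝ) ^ (σ + r - w) * (accProd (k' * σ * r) σ r (w - σ) *
      accProd (k' * σ * r) r σ (σ - w)) * ((k' * (σ + r)).choose (k' * σ) : ℝ) =
      (σ : ℝ) ^ σ * (r : ℝ) ^ r * (completions (k' * (σ + r)) ((k' + 1) * σ) w : ℝ) by
    field_simp
    linarith
  rcases le_total σ w with hle | hle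
  · have h1 := accProd_up (k' := k') h0 hr (w - σ) (by omega)
    rw [show σ + (w - σ) = w by omega, show r - (w - σ) = σ + r - w by omega] at h1
    rw [show σ - w = 0 by omega, show accProd (k' * σ * r) r σ 0 = 1 by simp [accProd], mul_one]
    exact h1
  · have h1 := accProd_down (k' := k') h0 hr (σ - w) (by omega)
    rw [show σ - (σ - w) = w by omega, show r + (σ - w) = σ + r - w by omega] at h1
    rw [show w - σ = 0 by omega, show accProd (k' * σ * r) σ r 0 = 1 by simp [accProd], one_mul]
    exact h1

theorem acceptProb_nonneg : 0 ≤ acceptProb n σ k' := by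
  unfold acceptProb; positivity

/-- Summing the rejection identity over all rows exhibits `acceptProb` as the probability that a
random row is accepted. -/
theorem acceptProb_le_one (h0 : 0 < σ) (hσ : σ < n) : acceptProb n σ k' ≤ 1 := by
  have h : (k' + 1) * σ ≤ n + k' * n := by nlinarith
  have h1 : ∑ a, (approxRow n σ a).toReal * (acceptLaw n σ k' (hammingNorm a) true).toReal =
      acceptProb n σ k' := by
    simp only [approxRow_mul_acceptLaw h0 hσ h]
    rw [← Finset.mul_sum, sum_toReal_pmf, mul_one]
  rw [← h1, ← sum_toReal_pmf (approxRow n σ)]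
  refine Finset.sum_le_sum fun a _ => mul_le_of_le_one_right ENNReal.toReal_nonneg ?_
  exact ENNReal.toReal_mono ENNReal.one_ne_top (PMF.coe_le_one _ _)

/-! ### A lower bound for the central binomial probability -/

/-- The Stirling sequence decreases from its first value `e / √2`. -/
theorem factorial_le (s : ℕ) (hs : 0 < s) :
    (s.factorial : ℝ) ≤ Real.exp 1 * Real.sqrt s * (s / Real.exp 1) ^ s := by
  obtain ⟨t, rfl⟩ : ∃ t, s = t + 1 := ⟨s - 1, by omega⟩
  have h1 : Stirling.stirlingSeq (t + 1) ≤ Stirling.stirlingSeq 1 :=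
    Stirling.stirlingSeq'_antitone (Nat.zero_le t)
  rw [Stirling.stirlingSeq_one, Stirling.stirlingSeq] at h1
  have hpos : (0 : ℝ) < Real.sqrt (2 * (t + 1 : ℕ)) * ((t + 1 : ℕ) / Real.exp 1) ^ (t + 1) := by
    positivity
  rw [div_le_iff₀ hpos] at h1
  refine h1.trans_eq ?_
  rw [Real.sqrt_mul (by norm_num)]
  have : Real.sqrt 2 ≠ 0 := by positivity
  field_simp

/-- The ratio of consecutive terms is `e / (1 + 1/b) ^ b ≥ 1`. -/
theorem factorial_mul_exp_mono {a b : ℕ} (ha : 0 < a) (h : a ≤ b) :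
    (a.factorial : ℝ) * Real.exp a / (a : ℝ) ^ a ≤ b.factorial * Real.exp b / (b : ℝ) ^ b := by
  induction b, h using Nat.le_induction with
  | base => exact le_rfl
  | succ b hb ih =>
    refine ih.trans ?_
    have hb0 : (0 : ℝ) < b := by exact_mod_cast (by omega : 0 < b)
    rw [div_le_div_iff₀ (by positivity) (by positivity), Nat.factorial_succ]
    push_cast
    rw [Real.exp_add]
    have h1 : ((b : ℝ) + 1) ^ b ≤ Real.exp 1 * (b : ℝ) ^ b := by
      have : (1 + 1 / (b : ℝ)) ^ b ≤ Real.exp 1 := by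
        have h2 := Real.add_one_le_exp (1 / (b : ℝ))
        calc (1 + 1 / (b : ℝ)) ^ b ≤ (Real.exp (1 / b)) ^ b := by
              refine pow_le_pow_left₀ (by positivity) (by linarith) b
          _ = Real.exp 1 := by rw [← Real.exp_nat_mul]; congr 1; field_simp
      calc ((b : ℝ) + 1) ^ b = (1 + 1 / (b : ℝ)) ^ b * (b : ℝ) ^ b := by
            rw [← mul_pow]; congr 1; field_simp
        _ ≤ _ := by gcongr
    have h3 : (0 : ℝ) ≤ b.factorial * Real.exp b * (b + 1) := by positivity
    have := mul_le_mul_of_nonneg_left h1 h3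
    rw [pow_succ]
    linarith

/-- The probability that a binomial variable takes its mean as value. -/
theorem le_acceptProb (h0 : 0 < σ) (hσ : σ < n) :
    1 / (Real.exp 1 * Real.sqrt σ) ≤ acceptProb n σ k' := by
  obtain ⟨r, rfl⟩ : ∃ r, n = σ + r := ⟨n - σ, by omega⟩
  have hr : 0 < r := by omega
  have hC' : (0 : ℝ) < ((k' * (σ + r)).choose (k' * σ) : ℝ) := by
    exact_mod_cast Nat.choose_pos (Nat.mul_le_mul_left _ (by omega))
  have hσ' : (0 : ℝ) < σ := by exact_mod_cast h0
  have hr' : (0 : ℝ) < r := by exact_mod_cast hr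
  -- One term of Vandermonde's sum. It cancels the dependence on `k'` and leaves the probability
  -- that a binomial variable with parameters `n` and `σ/n` equals its mean `σ`.
  have hV : ((σ + r).choose σ : ℝ) * ((k' * (σ + r)).choose (k' * σ) : ℝ) ≤
      (((σ + r) + k' * (σ + r)).choose ((k' + 1) * σ) : ℝ) := by
    have h1 := Nat.add_choose_eq (σ + r) (k' * (σ + r)) ((k' + 1) * σ)
    have h2 := Finset.single_le_sum (f := fun ij : ℕ × ℕ =>
      (σ + r).choose ij.1 * (k' * (σ + r)).choose ij.2)
      (s := Finset.HasAntidiagonal.antidiagonal ((k' + 1) * σ)) (fun _ _ => Nat.zero_le _)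
      (show (σ, k' * σ) ∈ Finset.HasAntidiagonal.antidiagonal ((k' + 1) * σ) by
        rw [Finset.HasAntidiagonal.mem_antidiagonal]; ring)
    rw [← h1] at h2
    exact_mod_cast h2
  have hch : ((σ + r).choose σ : ℝ) = (σ + r).factorial / (σ.factorial * r.factorial) := by
    rw [Nat.choose_symm_add, Nat.add_choose, Nat.cast_div]
    · push_cast; rfl
    · exact Nat.factorial_mul_factorial_dvd_factorial_add σ r
    · positivity
  have h1 : (σ : ℝ) ^ σ * (r : ℝ) ^ r / ((σ + r : ℕ) : ℝ) ^ (σ + r) * ((σ + r).choose σ : ℝ) ≤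
      acceptProb (σ + r) σ k' := by
    rw [acceptProb, show σ + r - σ = r by omega]
    refine mul_le_mul_of_nonneg_left ?_ (by positivity)
    rw [le_div_iff₀ hC']; exact hV
  refine le_trans ?_ h1
  rw [hch]
  have h2 := factorial_mul_exp_mono hr (show r ≤ σ + r by omega)
  have h3 := factorial_le σ h0
  have e1 : Real.exp ((σ + r : ℕ) : ℝ) = Real.exp σ * Real.exp r := by
    rw [← Real.exp_add]; push_cast; rfl
  rw [e1, div_le_div_iff₀ (by positivity) (by positivity)] at h2
  have e2 : ((σ : ℝ) / Real.exp 1) ^ σ = (σ : ℝ) ^ σ / Real.exp σ := by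
    rw [div_pow, ← Real.exp_nat_mul, mul_one]
  rw [e2] at h3
  rw [div_mul_div_comm, div_le_div_iff₀ (by positivity) (by positivity), one_mul]
  have h4 : (r.factorial : ℝ) * ((σ + r : ℕ) : ℝ) ^ (σ + r) ≤
      (σ + r).factorial * Real.exp σ * (r : ℝ) ^ r := by
    have hx : (0 : ℝ) < Real.exp r := Real.exp_pos _
    nlinarith
  have h5 : (σ.factorial : ℝ) * Real.exp σ ≤ Real.exp 1 * Real.sqrt σ * (σ : ℝ) ^ σ := by
    have hx : (0 : ℝ) < Real.exp σ := Real.exp_pos _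
    calc _ ≤ (Real.exp 1 * Real.sqrt σ * ((σ : ℝ) ^ σ / Real.exp σ)) * Real.exp σ := by gcongr
      _ = _ := by field_simp
  calc ((σ + r : ℕ) : ℝ) ^ (σ + r) * (σ.factorial * r.factorial)
      = (r.factorial * ((σ + r : ℕ) : ℝ) ^ (σ + r)) * σ.factorial := by ring
    _ ≤ ((σ + r).factorial * Real.exp σ * (r : ℝ) ^ r) * σ.factorial := by gcongr
    _ = (σ.factorial * Real.exp σ) * ((σ + r).factorial * (r : ℝ) ^ r) := by ring
    _ ≤ (Real.exp 1 * Real.sqrt σ * (σ : ℝ) ^ σ) * ((σ + r).factorial * (r : ℝ) ^ r) := by gcongr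
    _ = _ := by ring

end

/-! ### From weights on instances to weights on blocks of queries -/

/-- The law of an independent pair. -/
def pairLaw {α β : Type} (p : PMF α) (q : PMF β) : PMF (α × β) :=
  p.bind fun a => q.map (Prod.mk a)

theorem pairLaw_apply {α β : Type} [Fintype α] [Fintype β] (p : PMF α) (q : PMF β) (x : α × β) :
    (pairLaw p q x).toReal = (p x.1).toReal * (q x.2).toReal := by
  classical
  obtain ⟨a, b⟩ := x
  rw [← Ex_indicator_eq, pairLaw, Ex_bind]
  simp only [Ex_map, Prod.mk.injEq, ite_and]
  have : ∀ a', Ex q (fun b' => if a' = a then (if b' = b then (1 : ℝ) else 0) else 0) =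
      (q b).toReal * (if a' = a then 1 else 0) := by
    intro a'
    by_cases h : a' = a
    · simp [h, Ex_indicator_eq]
    · simp [h, Ex_const]
  simp only [this]
  rw [Ex_mul_left, Ex_indicator_eq, mul_comm]

theorem Ex_iid_pair {ι α β : Type} [Fintype ι] [DecidableEq ι] [Fintype α] [Fintype β]
    (p : PMF α) (q : PMF β) (F : (ι → α) → (ι → β) → ℝ) :
    Ex (iid ι p) (fun a => Ex (iid ι q) (F a)) =
      Ex (iid ι (pairLaw p q)) fun w => F (fun i => (w i).1) (fun i => (w i).2) :=
  Ex_indep_pair (fun _ => p) (fun _ _ => q) F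

section Flat

variable {k n : ℕ}

/-- The vector with given blocks. -/
def flat (S : Fin k → Fin n → ZMod 2) : Fin (k * n) → ZMod 2 :=
  fun c => S (finProdFinEquiv.symm c).1 (finProdFinEquiv.symm c).2

@[simp] theorem block_flat (S : Fin k → Fin n → ZMod 2) (j : Fin k) : block j (flat S) = S j := by
  funext t; simp [block, flat]

theorem Ex_uniform_flat (F : (Fin (k * n) → ZMod 2) → ℝ) :
    Ex (PMF.uniformOfFintype (Fin (k * n) → ZMod 2)) F =
      Ex (iid (Fin k) (PMF.uniformOfFintype (Fin n → ZMod 2))) fun S => F (flat S) := by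
  rw [uniform_eq_iid, Ex_iid_reindex finProdFinEquiv.symm, Ex_iid_curry, uniform_eq_iid]
  rfl

/-- The part inside block `j` is already contained in the label of the instance, with the unknown
`s`; the rest involves only the secret chosen by the program. -/
theorem dotProduct_flat_update (S : Fin k → Fin n → ZMod 2) (j : Fin k) (s : Fin n → ZMod 2)
    (v : Fin (k * n) → ZMod 2) :
    v ⬝ᵥ flat (Function.update S j s) = block j v ⬝ᵥ s + tailDot j (flat S) v 0 := by
  simp only [dotProduct, tailDot]
  rw [Finset.filter_true_of_mem fun c _ => Nat.zero_le _, ← Equiv.sum_comp finProdFinEquiv,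
    ← Equiv.sum_comp finProdFinEquiv (fun c => if Outside j c then flat S c * v c else 0),
    Fintype.sum_prod_type, Fintype.sum_prod_type, ← Finset.add_sum_erase _ _ (Finset.mem_univ j),
    ← Finset.add_sum_erase _ (fun i => ∑ t, if Outside j (finProdFinEquiv (i, t)) then
      flat S (finProdFinEquiv (i, t)) * v (finProdFinEquiv (i, t)) else 0) (Finset.mem_univ j)]
  have h2 : ∑ t : Fin n, (if Outside j (finProdFinEquiv (j, t)) then
      flat S (finProdFinEquiv (j, t)) * v (finProdFinEquiv (j, t)) else 0) = 0 :=
    Finset.sum_eq_zero fun t _ => if_neg (by simp [Outside])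
  rw [h2, zero_add]
  congr 1
  · refine Finset.sum_congr rfl fun t _ => ?_
    simp [flat, block]
  · refine Finset.sum_congr rfl fun i hi => Finset.sum_congr rfl fun t _ => ?_
    have hij : i ≠ j := Finset.ne_of_mem_erase hi
    rw [if_pos (by simpa [Outside] using hij)]
    simp [flat, Function.update_of_ne hij, mul_comm]

end Flat

section Trial

variable {n M m k' σ : ℕ}

/-- The trial with a fixed position of the block. -/
def trialAt (ν : PMF (ZMod 2)) (σ : ℕ) (O : Solver m ((k' + 1) * n))
    (A : Matrix (Fin M) (Fin n) (ZMod 2)) (b : Fin M → ZMod 2) (j : Fin (k' + 1)) :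
    PMF (Option (Fin n → ZMod 2)) :=
  (drawAll (fun _ _ => PMF.uniformOfFintype (ZMod 2)) ((k' + 1) * n) 0).bind fun S =>
    (sel (fun x => acceptLaw n σ k' (hammingNorm (fun t => if h : x < M then A ⟨x, h⟩ t else 0)))
      M m).bind fun o => o.elim (PMF.pure none) fun u =>
        (drawAll (fun i _ => rowLaw ν k' σ j S (A (u i)) (b (u i))) m 0).bind fun Q =>
          (O (Matrix.of fun i => (Q i).1) fun i => (Q i).2).map fun g => some (block j g)

theorem trial_some (ν : PMF (ZMod 2)) (O : Solver m ((k' + 1) * n))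
    (A : Matrix (Fin M) (Fin n) (ZMod 2)) (b : Fin M → ZMod 2) (s : Fin n → ZMod 2) :
    (trial ν σ O A b (some s)).toReal =
      (∑ j, (trialAt ν σ O A b j (some s)).toReal) / ((k' : ℝ) + 1) := by
  classical
  rw [← Ex_indicator_eq, trial, Ex_bind]
  have h : ∀ j, Ex (trialAt ν σ O A b j) (fun o => if o = some s then (1 : ℝ) else 0) =
    (trialAt ν σ O A b j (some s)).toReal := fun j => Ex_indicator_eq _ _
  simp only [trialAt] at h ⊢
  simp only [h]
  rw [Ex_uniformOfFintype]
  simp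

/-- Acceptance of a sample. -/
def sampleAcc (n σ k' : ℕ) (y : (Fin n → ZMod 2) × ZMod 2) : PMF Bool :=
  acceptLaw n σ k' (hammingNorm y.1)

/-- The probability that the answer of the oracle has block `s` at position `j`. -/
def hitProb (O : Solver m ((k' + 1) * n)) (j : Fin (k' + 1)) (s : Fin n → ZMod 2)
    (Q : Fin m → Fin ((k' + 1) * n) → ZMod 2) (b : Fin m → ZMod 2) : ℝ :=
  Ex (O (Matrix.of Q) b) fun g => if block j g = s then 1 else 0

/-- The pool is viewed as rows with their noise rather than with their labels: acceptance depends on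
the row alone, so the noise remains independent after the selection. -/
theorem trialAt_some (ν : PMF (ZMod 2)) (O : Solver m ((k' + 1) * n))
    (A : Fin M → Fin n → ZMod 2) (e : Fin M → ZMod 2) (s : Fin n → ZMod 2) (j : Fin (k' + 1)) :
    (trialAt ν σ O (Matrix.of A) (Matrix.of A *ᵥ s + e) j (some s)).toReal =
      Ex (iid (Fin (k' + 1)) (PMF.uniformOfFintype (Fin n → ZMod 2))) fun S =>
        selEx (sampleAcc n σ k') m (fun r => (A r, e r)) fun y =>
          Ex (indep fun i => rowLaw ν k' σ j (flat S) (y i).1 ((y i).1 ⬝ᵥ s + (y i).2)) fun Q =>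
            hitProb O j s (fun i => (Q i).1) fun i => (Q i).2 := by
  classical
  rw [← Ex_indicator_eq, trialAt, Ex_bind, drawAll_eq_indep, ← iid_eq_indep, ← uniform_eq_iid,
    Ex_uniform_flat]
  refine congrArg _ (funext fun S => ?_)
  rw [Ex_bind, selEx]
  have hsel : sel (fun x => acceptLaw n σ k' (hammingNorm
      (fun t => if h : x < M then Matrix.of A ⟨x, h⟩ t else 0))) M m =
      sel (poolAcc (sampleAcc n σ k') fun r => (A r, e r)) M m := by
    refine sel_congr _ _ fun x hx => ?_
    simp [poolAcc, sampleAcc, hx]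
  rw [hsel]
  refine congrArg _ (funext fun o => ?_)
  cases o with
  | none => simp [Ex_pure]
  | some u =>
    simp only [Option.elim_some]
    rw [Ex_bind, drawAll_eq_indep]
    refine congrArg _ (funext fun Q => ?_)
    rw [Ex_map, hitProb]
    simp only [Option.some.injEq]

/-- The probability that the oracle solves the instance with secret `flat S`, rows `Q` and noise
`e`. -/
def solveProb (O : Solver m ((k' + 1) * n)) (S : Fin (k' + 1) → Fin n → ZMod 2)
    (Q : Fin m → Fin ((k' + 1) * n) → ZMod 2) (e : Fin m → ZMod 2) : ℝ :=
  (O (Matrix.of Q) (Matrix.of Q *ᵥ flat S + e) (flat S)).toReal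

theorem solveProb_le_hitProb (O : Solver m ((k' + 1) * n)) (S : Fin (k' + 1) → Fin n → ZMod 2)
    (Q : Fin m → Fin ((k' + 1) * n) → ZMod 2) (e : Fin m → ZMod 2) (j : Fin (k' + 1)) :
    solveProb O S Q e ≤ hitProb O j (S j) Q (Matrix.of Q *ᵥ flat S + e) := by
  classical
  rw [solveProb, ← Ex_indicator_eq]
  refine Ex_mono _ fun g => ?_
  by_cases h : g = flat S
  · simp [h]
  · rw [if_neg h]; split_ifs <;> simp

/-- Block `j` of a completed row is the row of the sample, so the label is the one for the secret
with `s` planted in block `j`. Its noise is the noise of the sample plus `k'` fresh bits. -/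
theorem Ex_rowLaw (ν : PMF (ZMod 2)) (j : Fin (k' + 1)) (S : Fin (k' + 1) → Fin n → ZMod 2)
    (s : Fin n → ZMod 2) (y : Fin m → (Fin n → ZMod 2) × ZMod 2)
    (F : (Fin m → Fin ((k' + 1) * n) → ZMod 2) → (Fin m → ZMod 2) → ℝ) :
    Ex (indep fun i => rowLaw ν k' σ j (flat S) (y i).1 ((y i).1 ⬝ᵥ s + (y i).2))
      (fun Q => F (fun i => (Q i).1) fun i => (Q i).2) =
    Ex (iid (Fin k') (iid (Fin m) ν)) fun x => Ex (indep fun i => completeRow σ j (y i).1) fun v =>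
      F v (Matrix.of v *ᵥ flat (Function.update S j s) + ((fun i => (y i).2) + ∑ i, x i)) := by
  simp only [rowLaw]
  rw [Ex_indep_bind, Ex_indep_addNoise]
  refine congrArg _ (funext fun x => ?_)
  rw [Ex_indep_map]
  refine Ex_congr_support _ fun v hv => ?_
  have hb : ∀ i, block j (v i) = (y i).1 := fun i => by
    refine block_of_mem_support (v₀ := 0) (R := (k' + 1) * σ - hammingNorm (y i).1) ?_
    rw [PMF.mem_support_iff] at hv ⊢
    exact fun h0 => hv (Finset.prod_eq_zero (Finset.mem_univ i) h0)
  congr 1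
  funext i
  have h1 : (Matrix.of v *ᵥ flat (Function.update S j s)) i =
    v i ⬝ᵥ flat (Function.update S j s) := rfl
  simp only [Pi.add_apply]
  rw [h1, dotProduct_flat_update, hb]
  ring

/-- A bounded weight on instances becomes a bounded weight on the blocks of a query. -/
theorem exists_blockWeight (h0 : 0 < σ) (hσ : σ < n) (h : (k' + 1) * σ ≤ n + k' * n)
    (ν : PMF (ZMod 2)) (O : Solver m ((k' + 1) * n))
    (w : (Fin n → ZMod 2) → (Fin M → Fin n → ZMod 2) → (Fin M → ZMod 2) → ℝ)
    (hw : ∀ s A e, 0 ≤ w s A e ∧ w s A e ≤ 1) :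
    ∃ φ : (Fin n → ZMod 2) → (Fin m → Fin n → ZMod 2) → (Fin m → ZMod 2) → ℝ,
      (∀ s q e, 0 ≤ φ s q e ∧ φ s q e ≤ 1) ∧
      (∀ j, Ex (iid (Fin (k' + 1)) (PMF.uniformOfFintype (Fin n → ZMod 2))) (fun S =>
          Ex (iid (Fin m) (exactRow ((k' + 1) * n) ((k' + 1) * σ) (Nat.mul_le_mul_left _ hσ.le)))
            fun Q => Ex (iid (Fin (k' + 1)) (iid (Fin m) ν)) fun e =>
              φ (S j) (fun i => block j (Q i)) (e j) * solveProb O S Q (∑ i, e i)) ≤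
        Ex (PMF.uniformOfFintype (Fin n → ZMod 2)) fun s => Ex (iid (Fin M) (approxRow n σ)) fun A =>
          Ex (iid (Fin M) ν) fun e => w s A e *
            (trialAt ν σ O (Matrix.of A) (Matrix.of A *ᵥ s + e) j (some s)).toReal) ∧
      Ex (PMF.uniformOfFintype (Fin n → ZMod 2)) (fun s => Ex (iid (Fin M) (approxRow n σ)) fun A =>
          Ex (iid (Fin M) ν) fun e => w s A e) - (1 - selProb (acceptProb n σ k') M m) ≤
        Ex (PMF.uniformOfFintype (Fin n → ZMod 2)) fun s =>
          Ex (iid (Fin m) (blockRow n (k' * n) ((k' + 1) * σ) h)) fun q =>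
            Ex (iid (Fin m) ν) (φ s q) := by
  classical
  -- Acceptance ignores the noise, so the rejection identity carries over to pairs of a row and its
  -- noise.
  have hacc : ∀ y, (pairLaw (approxRow n σ) ν y).toReal * (sampleAcc n σ k' y true).toReal =
      acceptProb n σ k' * (pairLaw (blockRow n (k' * n) ((k' + 1) * σ) h) ν y).toReal := fun y => by
    rw [pairLaw_apply, pairLaw_apply, sampleAcc, mul_right_comm, approxRow_mul_acceptLaw h0 hσ h,
      mul_assoc]
  choose φ hφ1 hφ2 hφ3 using fun s => exists_weight acceptProb_nonneg (acceptProb_le_one h0 hσ) hacc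
    M m (fun X => w s (fun i => (X i).1) (fun i => (X i).2)) fun X => hw _ _ _
  refine ⟨fun s q e => φ s fun i => (q i, e i), fun s q e => hφ1 s _, fun j => ?_, ?_⟩
  · -- the success probability of the trial, in terms of the weight on the selected samples
    set U := PMF.uniformOfFintype (Fin n → ZMod 2)
    have h1 : ∀ s, Ex (iid (Fin M) (approxRow n σ)) (fun A => Ex (iid (Fin M) ν) fun e => w s A e *
        (trialAt ν σ O (Matrix.of A) (Matrix.of A *ᵥ s + e) j (some s)).toReal) =
        Ex (iid (Fin (k' + 1)) U) fun S => Ex (iid (Fin m) (exactRow ((k' + 1) * n) ((k' + 1) * σ)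
          (Nat.mul_le_mul_left _ hσ.le))) fun Q => Ex (iid (Fin (k' + 1)) (iid (Fin m) ν)) fun e =>
            φ s (fun i => (block j (Q i), e j i)) * hitProb O j s Q
              (Matrix.of Q *ᵥ flat (Function.update S j s) + ∑ i, e i) := by
      intro s
      simp only [trialAt_some, ← Ex_mul_left]
      rw [Ex_iid_pair, Ex_comm]
      refine congrArg _ (funext fun S => ?_)
      have h2 := hφ2 s fun y => Ex (indep fun i => rowLaw ν k' σ j (flat S) (y i).1
        ((y i).1 ⬝ᵥ s + (y i).2)) fun Q => hitProb O j s (fun i => (Q i).1) fun i => (Q i).2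
      simp only [Prod.mk.eta] at h2 ⊢
      rw [h2]
      simp only [Ex_rowLaw ν j S s _ (hitProb O j s)]
      have h3 := Ex_iid_pair (ι := Fin m) (blockRow n (k' * n) ((k' + 1) * σ) h) ν fun q e =>
        φ s (fun i => (q i, e i)) * Ex (iid (Fin k') (iid (Fin m) ν)) fun x =>
          Ex (indep fun i => completeRow σ j (q i)) fun v => hitProb O j s v
            (Matrix.of v *ᵥ flat (Function.update S j s) + ((fun i => e i) + ∑ i, x i))
      simp only [Prod.mk.eta] at h3
      rw [← h3]
      -- The noise of the instance takes place `j` among `k' + 1` independent noise vectors.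
      have h4 : ∀ q : Fin m → Fin n → ZMod 2, Ex (iid (Fin m) ν) (fun e =>
          φ s (fun i => (q i, e i)) * Ex (iid (Fin k') (iid (Fin m) ν)) fun x =>
          Ex (indep fun i => completeRow σ j (q i)) fun v => hitProb O j s v
            (Matrix.of v *ᵥ flat (Function.update S j s) + ((fun i => e i) + ∑ i, x i))) =
          Ex (indep fun i => completeRow σ j (q i)) fun v =>
            Ex (iid (Fin (k' + 1)) (iid (Fin m) ν)) fun e => φ s (fun i => (q i, e j i)) *
              hitProb O j s v (Matrix.of v *ᵥ flat (Function.update S j s) + ∑ i, e i) := by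
        intro q
        have h5 : ∀ v : Fin m → Fin ((k' + 1) * n) → ZMod 2,
            Ex (iid (Fin (k' + 1)) (iid (Fin m) ν)) (fun e => φ s (fun i => (q i, e j i)) *
              hitProb O j s v (Matrix.of v *ᵥ flat (Function.update S j s) + ∑ i, e i)) =
            Ex (iid (Fin m) ν) fun e => Ex (iid (Fin k') (iid (Fin m) ν)) fun x =>
              φ s (fun i => (q i, e i)) * hitProb O j s v
                (Matrix.of v *ᵥ flat (Function.update S j s) + (e + ∑ i, x i)) := by
          intro v
          rw [iid_eq_indep, Ex_indep_insertNth _ j]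
          simp only [Fin.sum_univ_succAbove _ j, Fin.insertNth_apply_same,
            Fin.insertNth_apply_succAbove]
          rfl
        simp only [h5, ← Ex_mul_left]
        rw [Ex_comm (indep fun i => completeRow σ j (q i))]
        refine congrArg _ (funext fun e => ?_)
        rw [Ex_comm (indep fun i => completeRow σ j (q i))]
      simp only [h4]
      -- Drawing a block and completing it is drawing a row of fixed weight, from which the block
      -- can be read off again.
      rw [iid_eq_indep, Ex_indep_disintegrate _ (fun _ => completeRow σ j) (fun _ => block j)
        (fun i a b hb _ => block_of_mem_support hb)
        (fun q v => Ex (iid (Fin (k' + 1)) (iid (Fin m) ν)) fun e => φ s (fun i => (q i, e j i)) *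
              hitProb O j s v (Matrix.of v *ᵥ flat (Function.update S j s) + ∑ i, e i)),
        blockRow_bind_completeRow hσ.le j h]
      rfl
    simp only [h1]
    -- The planted secret becomes block `j` of a uniform secret, so the oracle faces a genuine
    -- instance. An entirely correct answer is in particular correct in block `j`.
    rw [Ex_iid_resample U j fun s S => Ex (iid (Fin m) (exactRow ((k' + 1) * n) ((k' + 1) * σ)
      (Nat.mul_le_mul_left _ hσ.le))) fun Q => Ex (iid (Fin (k' + 1)) (iid (Fin m) ν)) fun e =>
        φ s (fun i => (block j (Q i), e j i)) * hitProb O j s Q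
          (Matrix.of Q *ᵥ flat S + ∑ i, e i)]
    exact Ex_mono _ fun S => Ex_mono _ fun Q => Ex_mono _ fun e =>
      mul_le_mul_of_nonneg_left (solveProb_le_hitProb O S Q _ j) (hφ1 _ _).1
  · rw [← Ex_const (PMF.uniformOfFintype (Fin n → ZMod 2)) (1 - selProb (acceptProb n σ k') M m),
      ← Ex_sub]
    refine Ex_mono _ fun s => ?_
    rw [Ex_iid_pair, Ex_iid_pair]
    exact hφ3 s

end Trial

/-! ### The direct product argument -/

/-- `exp (2x) ≥ 1 + 2x`, and `(1 - x/2)(1 + 2x) ≥ 1` on `[0, 1]`. -/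
theorem exp_neg_sq_le {x : ℝ} (h0 : 0 ≤ x) (h1 : x ≤ 1) : Real.exp (-x) ^ 2 ≤ 1 - x / 2 := by
  have h2 : Real.exp (-x) ^ 2 * Real.exp (2 * x) = 1 := by
    rw [← Real.exp_nat_mul, ← Real.exp_add]; simp
  have h3 := Real.add_one_le_exp (2 * x)
  have h4 : (1 : ℝ) ≤ (1 - x / 2) * (2 * x + 1) := by nlinarith
  have h5 : (1 - x / 2) * (2 * x + 1) ≤ (1 - x / 2) * Real.exp (2 * x) :=
    mul_le_mul_of_nonneg_left h3 (by linarith)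
  refine le_of_mul_le_mul_right ?_ (Real.exp_pos (2 * x))
  linarith

/-- If `t ≤ c`, the first term is at least `1`; otherwise `t / c ≥ 1` and the second suffices. Here
`t` is the total weight of the blocks: either it is small, which is rare, or the success `f` is
charged to the weighted blocks. -/
theorem le_exp_mul_add {c f t : ℝ} (hc : 0 < c) (hf0 : 0 ≤ f) (hf1 : f ≤ 1) (ht : 0 ≤ t) :
    f ≤ Real.exp c * Real.exp (-t) + 1 / c * (t * f) := by
  rcases le_total t c with h | h
  · have : 1 ≤ Real.exp c * Real.exp (-t) := by
      rw [← Real.exp_add]; exact Real.one_le_exp (by linarith)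
    have : 0 ≤ 1 / c * (t * f) := by positivity
    linarith
  · have h1 : 0 < Real.exp c * Real.exp (-t) := by positivity
    have h2 : 1 / c * (t * f) = t / c * f := by ring
    have h3 : 1 ≤ t / c := by rwa [le_div_iff₀ hc, one_mul]
    nlinarith

section

variable {n m k' σ : ℕ}

theorem Ex_exactRow_block (hσ : σ ≤ n) (j : Fin (k' + 1)) (h : (k' + 1) * σ ≤ n + k' * n)
    (g : (Fin m → Fin n → ZMod 2) → ℝ) :
    Ex (iid (Fin m) (exactRow ((k' + 1) * n) ((k' + 1) * σ) (Nat.mul_le_mul_left _ hσ)))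
      (fun Q => g fun i => block j (Q i)) =
    Ex (iid (Fin m) (blockRow n (k' * n) ((k' + 1) * σ) h)) g := by
  rw [← exactRow_map_block hσ j h, iid_eq_indep (p := PMF.map _ _), Ex_indep_map]
  rfl

/-- For fixed secrets and noise, `exactRow_block_holder` separates the blocks of the rows; the
secrets and the noise vectors of different blocks are independent. The `1/4` arises as `(1 + (1 -
φ/2)) / 2 = 1 - φ/4`, from `exp (-φ) ^ 2 ≤ 1 - φ/2`. -/
theorem direct_product (hσ : σ ≤ n) (h : (k' + 1) * σ ≤ n + k' * n) (ν : PMF (ZMod 2))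
    (φ : (Fin n → ZMod 2) → (Fin m → Fin n → ZMod 2) → (Fin m → ZMod 2) → ℝ)
    (hφ : ∀ s q e, 0 ≤ φ s q e ∧ φ s q e ≤ 1)
    (f : (Fin (k' + 1) → Fin n → ZMod 2) → (Fin m → Fin ((k' + 1) * n) → ZMod 2) →
      (Fin (k' + 1) → Fin m → ZMod 2) → ℝ) (hf : ∀ S Q e, 0 ≤ f S Q e ∧ f S Q e ≤ 1)
    {c β : ℝ} (hc : 0 < c)
    (hβ : ∑ j, Ex (iid (Fin (k' + 1)) (PMF.uniformOfFintype (Fin n → ZMod 2))) (fun S =>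
      Ex (iid (Fin m) (exactRow ((k' + 1) * n) ((k' + 1) * σ) (Nat.mul_le_mul_left _ hσ)))
        fun Q => Ex (iid (Fin (k' + 1)) (iid (Fin m) ν)) fun e =>
          φ (S j) (fun i => block j (Q i)) (e j) * f S Q e) ≤ β) :
    Ex (iid (Fin (k' + 1)) (PMF.uniformOfFintype (Fin n → ZMod 2))) (fun S =>
      Ex (iid (Fin m) (exactRow ((k' + 1) * n) ((k' + 1) * σ) (Nat.mul_le_mul_left _ hσ)))
        fun Q => Ex (iid (Fin (k' + 1)) (iid (Fin m) ν)) fun e => f S Q e) ≤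
      Real.exp c * (1 - Ex (PMF.uniformOfFintype (Fin n → ZMod 2)) (fun s =>
        Ex (iid (Fin m) (blockRow n (k' * n) ((k' + 1) * σ) h)) fun q =>
          Ex (iid (Fin m) ν) (φ s q)) / 4) ^ (k' + 1) + 1 / c * β := by
  set U := PMF.uniformOfFintype (Fin n → ZMod 2)
  set X := exactRow ((k' + 1) * n) ((k' + 1) * σ) (Nat.mul_le_mul_left _ hσ)
  set π := blockRow n (k' * n) ((k' + 1) * σ) h
  have h1 : ∀ S Q e, f S Q e ≤ Real.exp c * (∏ j, Real.exp (-φ (S j) (fun i => block j (Q i)) (e j)))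
      + 1 / c * ∑ j, φ (S j) (fun i => block j (Q i)) (e j) * f S Q e := by
    intro S Q e
    rw [← Real.exp_sum, Finset.sum_neg_distrib, ← Finset.sum_mul]
    exact le_exp_mul_add hc (hf S Q e).1 (hf S Q e).2 (Finset.sum_nonneg fun j _ => (hφ _ _ _).1)
  refine (Ex_mono _ fun S => Ex_mono _ fun Q => Ex_mono _ fun e => h1 S Q e).trans ?_
  simp only [Ex_add, Ex_mul_left, Ex_sum]
  refine add_le_add (mul_le_mul_of_nonneg_left ?_ (Real.exp_pos c).le)
    (mul_le_mul_of_nonneg_left ?_ (by positivity))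
  · set ψ : (Fin n → ZMod 2) → (Fin m → ZMod 2) → ℝ := fun s e =>
      1 - 1 / 4 * Ex (iid (Fin m) π) fun q => φ s q e
    have h2 : ∀ S : Fin (k' + 1) → Fin n → ZMod 2, ∀ e : Fin (k' + 1) → Fin m → ZMod 2,
        Ex (iid (Fin m) X) (fun Q => ∏ j, Real.exp (-φ (S j) (fun i => block j (Q i)) (e j))) ≤
          ∏ j, ψ (S j) (e j) := by
      intro S e
      refine (exactRow_block_holder (Nat.mul_le_mul_left _ hσ)
        (fun j q => Real.exp (-φ (S j) q (e j))) fun j q => Real.exp_pos _).trans ?_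
      refine Finset.prod_le_prod (fun j _ => ?_) fun j _ => ?_
      · have := Ex_nonneg (iid (Fin m) X) (f := fun Q =>
          Real.exp (-φ (S j) (fun i => block j (Q i)) (e j)) ^ 2) fun Q => by positivity
        positivity
      · have h3 := Ex_mono (iid (Fin m) X) fun Q => exp_neg_sq_le
          (hφ (S j) (fun i => block j (Q i)) (e j)).1 (hφ _ _ _).2
        have h4 := Ex_exactRow_block hσ j h fun q => 1 - φ (S j) q (e j) / 2
        have h5 : Ex (iid (Fin m) π) (fun q => 1 - φ (S j) q (e j) / 2) =
            1 - 1 / 2 * Ex (iid (Fin m) π) fun q => φ (S j) q (e j) := by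
          rw [Ex_sub, Ex_const, ← Ex_mul_left]
          congr 2
          funext q; ring
        rw [h4, h5] at h3
        simp only [ψ]
        linarith
    have h3 : Ex (iid (Fin (k' + 1)) U) (fun S => Ex (iid (Fin m) X) fun Q =>
        Ex (iid (Fin (k' + 1)) (iid (Fin m) ν)) fun e =>
          ∏ j, Real.exp (-φ (S j) (fun i => block j (Q i)) (e j))) ≤
        Ex (iid (Fin (k' + 1)) U) fun S => Ex (iid (Fin (k' + 1)) (iid (Fin m) ν)) fun e =>
          ∏ j, ψ (S j) (e j) := by
      refine Ex_mono _ fun S => ?_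
      rw [Ex_comm]
      exact Ex_mono _ fun e => h2 S e
    refine h3.trans_eq ?_
    have h4 : ∀ S : Fin (k' + 1) → Fin n → ZMod 2,
        Ex (iid (Fin (k' + 1)) (iid (Fin m) ν)) (fun e => ∏ j, ψ (S j) (e j)) =
          ∏ j, Ex (iid (Fin m) ν) (ψ (S j)) := fun S =>
      Ex_indep_prod (fun _ => iid (Fin m) ν) fun j => ψ (S j)
    simp only [h4]
    rw [iid_eq_indep, Ex_indep_prod (fun _ => U) fun _ s => Ex (iid (Fin m) ν) (ψ s),
      Finset.prod_const, Finset.card_univ, Fintype.card_fin]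
    congr 1
    simp only [ψ, Ex_sub, Ex_const, Ex_mul_left]
    have h5 : ∀ s, Ex (iid (Fin m) ν) (fun e => Ex (iid (Fin m) π) fun q => φ s q e) =
        Ex (iid (Fin m) π) fun q => Ex (iid (Fin m) ν) (φ s q) := fun s => Ex_comm _ _ _
    simp only [h5]
    ring
  · exact hβ

end

section

variable {n M m k' σ : ℕ}

/-- An instance on which a trial rarely succeeds. -/
def hardWeight (ν : PMF (ZMod 2)) (σ : ℕ) (O : Solver m ((k' + 1) * n)) (τ : ℝ)
    (s : Fin n → ZMod 2) (A : Fin M → Fin n → ZMod 2) (e : Fin M → ZMod 2) : ℝ :=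
  if (trial ν σ O (Matrix.of A) (Matrix.of A *ᵥ s + e) (some s)).toReal < τ then 1 else 0

/-- The probability that an instance is hard. -/
def hardProb (ν : PMF (ZMod 2)) (σ : ℕ) (O : Solver m ((k' + 1) * n)) (M : ℕ) (τ : ℝ) : ℝ :=
  Ex (PMF.uniformOfFintype (Fin n → ZMod 2)) fun s => Ex (iid (Fin M) (approxRow n σ)) fun A =>
    Ex (iid (Fin M) ν) fun e => hardWeight ν σ O τ s A e

/-- If the oracle succeeds with probability `ε`, then few instances are hard. -/
theorem hardProb_le (h0 : 0 < σ) (hσ : σ < n) (ν : PMF (ZMod 2)) (O : Solver m ((k' + 1) * n))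
    {ε δ : ℝ} (hε : 0 < ε) (hε1 : ε ≤ 1) (hδ : 0 < δ)
    (hk : 192 / δ * Real.log (16 / ε) < (k' : ℝ) + 1)
    (hfail : 1 - selProb (acceptProb n σ k') M m ≤ δ / 4)
    (hO : ε ≤ Ex (iid (Fin (k' + 1)) (PMF.uniformOfFintype (Fin n → ZMod 2))) fun S =>
      Ex (iid (Fin m) (exactRow ((k' + 1) * n) ((k' + 1) * σ) (Nat.mul_le_mul_left _ hσ.le)))
        fun Q => Ex (iid (Fin (k' + 1)) (iid (Fin m) ν)) fun e => solveProb O S Q (∑ i, e i)) :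
    hardProb ν σ O M (ε / 32) ≤ δ / 2 := by
  by_contra hμ
  push Not at hμ
  have h : (k' + 1) * σ ≤ n + k' * n := by nlinarith
  set τ := ε / 32
  set w := hardWeight (M := M) ν σ O τ
  have hw : ∀ s A e, 0 ≤ w s A e ∧ w s A e ≤ 1 := by
    intro s A e
    simp only [w, hardWeight]
    split_ifs <;> simp
  obtain ⟨φ, hφ, hφ1, hφ2⟩ := exists_blockWeight h0 hσ h ν O w hw
  set μ := hardProb ν σ O M τ
  change μ - _ ≤ _ at hφ2
  set φb := Ex (PMF.uniformOfFintype (Fin n → ZMod 2)) fun s =>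
    Ex (iid (Fin m) (blockRow n (k' * n) ((k' + 1) * σ) h)) fun q => Ex (iid (Fin m) ν) (φ s q)
  have hk0 : (0 : ℝ) < (k' : ℝ) + 1 := by positivity
  set K : ℝ := (k' : ℝ) + 1
  -- the average over the position of the block
  set a : Fin (k' + 1) → ℝ := fun j => Ex (PMF.uniformOfFintype (Fin n → ZMod 2)) fun s =>
    Ex (iid (Fin M) (approxRow n σ)) fun A => Ex (iid (Fin M) ν) fun e => w s A e *
      (trialAt ν σ O (Matrix.of A) (Matrix.of A *ᵥ s + e) j (some s)).toReal
  -- The sum over the positions is `K` times the success probability of a trial with random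
  -- position, which is below `τ` wherever `w` is nonzero.
  have hsum : ∑ j, a j ≤ K * (μ * τ) := by
    have h1 : ∑ j, a j = Ex (PMF.uniformOfFintype (Fin n → ZMod 2)) fun s =>
        Ex (iid (Fin M) (approxRow n σ)) fun A => Ex (iid (Fin M) ν) fun e =>
          K * (w s A e * (trial ν σ O (Matrix.of A) (Matrix.of A *ᵥ s + e) (some s)).toReal) := by
      simp only [a, ← Ex_sum]
      refine congrArg _ (funext fun s => congrArg _ (funext fun A => congrArg _ (funext fun e => ?_)))
      rw [trial_some, ← Finset.mul_sum]
      field_simp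
      rfl
    rw [h1]
    have h2 : K * (μ * τ) = Ex (PMF.uniformOfFintype (Fin n → ZMod 2)) fun s =>
        Ex (iid (Fin M) (approxRow n σ)) fun A => Ex (iid (Fin M) ν) fun e =>
          K * (τ * w s A e) := by
      simp only [Ex_mul_left]
      rw [mul_comm μ]; rfl
    rw [h2]
    refine Ex_mono _ fun s => Ex_mono _ fun A => Ex_mono _ fun e =>
      mul_le_mul_of_nonneg_left ?_ hk0.le
    simp only [w, hardWeight]
    split_ifs with hlt
    · linarith
    · simp
  have hmain := fun (c : ℝ) (hc : 0 < c) =>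
    direct_product hσ.le h ν φ hφ (fun S Q e => solveProb O S Q (∑ i, e i))
      (fun S Q e => ⟨ENNReal.toReal_nonneg, ENNReal.toReal_mono ENNReal.one_ne_top
        (PMF.coe_le_one _ _)⟩) hc ((Finset.sum_le_sum fun j _ => hφ1 j).trans hsum)
  have hμ0 : 0 < μ := by linarith
  have hφb1 : φb ≤ 1 := Ex_le_one _ fun s => Ex_le_one _ fun q => Ex_le_one _ fun e => (hφ s q e).2
  -- The loss in transferring the weight is at most `δ/4`, less than `μ/2`.
  have hφb : μ / 2 ≤ φb := by linarith
  -- The choice `c = Kμ/16` spends half of the exponent `Kμ/8` and turns the second term into `16 τ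
  -- = ε/2`.
  have h1 := hO.trans (hmain (K * μ / 16) (by positivity))
  have h2 : (1 - φb / 4) ^ (k' + 1) ≤ Real.exp (-(K * μ / 8)) := by
    have h3 : 1 - φb / 4 ≤ Real.exp (-(μ / 8)) := by
      have := Real.add_one_le_exp (-(μ / 8))
      linarith
    refine (pow_le_pow_left₀ (by linarith) h3 _).trans_eq ?_
    rw [← Real.exp_nat_mul]
    congr 1
    push_cast
    ring
  have h3 : Real.exp (K * μ / 16) * (1 - φb / 4) ^ (k' + 1) ≤ Real.exp (-(K * μ / 16)) := by
    refine (mul_le_mul_of_nonneg_left h2 (Real.exp_pos _).le).trans_eq ?_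
    rw [← Real.exp_add]
    congr 1
    ring
  have h4 : 1 / (K * μ / 16) * (K * (μ * τ)) = ε / 2 := by
    simp only [τ]
    field_simp
    norm_num
  have hlog : 0 < Real.log (16 / ε) := Real.log_pos (by rw [lt_div_iff₀ hε]; linarith)
  -- From `Kδ > 192 log (16/ε)` and `μ > δ/2`, with room to spare.
  have h5 : Real.log (16 / ε) < K * μ / 16 := by
    have h6 : 192 * Real.log (16 / ε) < K * δ := by
      rw [div_mul_eq_mul_div, div_lt_iff₀ hδ] at hk
      exact hk
    nlinarith
  have h6 : Real.exp (-(K * μ / 16)) < ε / 16 := by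
    have := Real.exp_lt_exp.2 (neg_lt_neg h5)
    rwa [Real.exp_neg (Real.log _), Real.exp_log (by positivity), inv_div] at this
  linarith

end

/-! ### The secret is the unique best candidate -/

/-- The nontrivial character of `𝔽₂`. -/
def chi (x : ZMod 2) : ℝ := if x = 0 then 1 else -1

theorem chi_add (x y : ZMod 2) : chi (x + y) = chi x * chi y := by
  have h : ∀ x : ZMod 2, x = 0 ∨ x = 1 := by decide
  have e : (1 + 1 : ZMod 2) = 0 := by decide
  rcases h x with rfl | rfl <;> rcases h y with rfl | rfl <;> simp [chi, e]

theorem chi_sum {ι : Type} (s : Finset ι) (f : ι → ZMod 2) :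
    chi (∑ i ∈ s, f i) = ∏ i ∈ s, chi (f i) := by
  classical
  induction s using Finset.induction_on with
  | empty => simp [chi]
  | insert i s hi ih => rw [Finset.sum_insert hi, Finset.prod_insert hi, chi_add, ih]

theorem Ex_chi_approxRow {n σ : ℕ} (hσ : σ ≤ n) (d : Fin n → ZMod 2) :
    Ex (approxRow n σ) (fun a => chi (a ⬝ᵥ d)) =
      (1 - 2 * ((σ : ℝ) / n)) ^ hammingNorm d := by
  have hp0 : (0 : ℝ) ≤ (σ : ℝ) / n := by positivity
  have hp1 : (σ : ℝ) / n ≤ 1 := div_le_one_of_le₀ (by exact_mod_cast hσ) (by positivity)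
  simp only [dotProduct, chi_sum]
  rw [approxRow, iid_eq_indep, Ex_indep_prod _ fun t x => chi (x * d t)]
  have h : ∀ t, Ex (ber ((σ : ℝ) / n)) (fun x => chi (x * d t)) =
      if d t ≠ 0 then 1 - 2 * ((σ : ℝ) / n) else 1 := by
    intro t
    rw [Ex_ber hp0 hp1]
    by_cases hd : d t = 0
    · simp [hd, chi]
    · simp [hd, chi]; ring
  simp only [h]
  rw [← Finset.prod_filter, Finset.prod_const]
  rfl

/-- The contribution of a row to the comparison of two candidates. -/
def tilt (x e : ZMod 2) : ℝ := 2 ^ e.val * (1 / 2) ^ (x + e).val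

theorem tilt_pos (x e : ZMod 2) : 0 < tilt x e := by unfold tilt; positivity

/-- The product is `2 ^ (|e| - |x + e|)`; it dominates the indicator of the event that `x` does not
increase the weight of the noise. -/
theorem one_le_prod_tilt {M : ℕ} (x e : Fin M → ZMod 2) (h : hammingNorm (x + e) ≤ hammingNorm e) :
    1 ≤ ∏ i, tilt (x i) (e i) := by
  simp only [tilt]
  rw [Finset.prod_mul_distrib, Finset.prod_pow_eq_pow_sum, Finset.prod_pow_eq_pow_sum,
    sum_val_eq_hammingNorm, show ∑ i, (x i + e i).val = hammingNorm (x + e) from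
      sum_val_eq_hammingNorm (x + e), one_div, inv_pow, ← div_eq_mul_inv, one_le_div (by positivity)]
  exact pow_le_pow_right₀ (by norm_num) h

theorem Ex_tilt {η : ℝ} (h0 : 0 ≤ η) (h1 : η ≤ 1) (x : ZMod 2) :
    Ex (ber η) (tilt x) = 1 - (1 / 4 - 3 * η / 4) * (1 - chi x) := by
  have h : ∀ x : ZMod 2, x = 0 ∨ x = 1 := by decide
  have e1 : (1 : ZMod 2).val = 1 := rfl
  have e2 : (1 + 1 : ZMod 2) = 0 := by decide
  rw [Ex_ber h0 h1]
  rcases h x with rfl | rfl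
  · simp [tilt, chi, e1]
  · simp [tilt, chi, e1, e2]; ring

theorem exp_neg_two_mul_le {u : ℝ} (h0 : 0 ≤ u) (h1 : u ≤ 1) :
    Real.exp (-(2 * u)) ≤ 1 - 2 / 3 * u := by
  have h3 := Real.add_one_le_exp (2 * u)
  have h4 : (1 : ℝ) ≤ (1 - 2 / 3 * u) * (2 * u + 1) := by nlinarith
  have h5 : (1 - 2 / 3 * u) * (2 * u + 1) ≤ (1 - 2 / 3 * u) * Real.exp (2 * u) :=
    mul_le_mul_of_nonneg_left h3 (by linarith)
  rw [Real.exp_neg, inv_le_iff_one_le_mul₀ (Real.exp_pos _)]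
  linarith

section

variable {n M σ : ℕ} {η : ℝ}

/-- `1 ≤ σ ≤ n - 1` keeps the bias of a coordinate away from both `1` and `-1`: `|1 - 2σ/n| ≤ 1 -
2/n ≤ exp (-2/n)`. For `σ = n` this fails. -/
theorem pow_bias_le (h0 : 0 < σ) (hσ : σ < n) {t : ℕ} (ht : t ≤ n) :
    (1 - 2 * ((σ : ℝ) / n)) ^ t ≤ 1 - 2 / 3 * (t / n) := by
  have hn : (0 : ℝ) < n := by exact_mod_cast (by omega : 0 < n)
  have h1 : (1 : ℝ) ≤ σ := by exact_mod_cast h0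
  have h2 : (σ : ℝ) + 1 ≤ n := by exact_mod_cast hσ
  have habs : |1 - 2 * ((σ : ℝ) / n)| ≤ Real.exp (-(2 / n)) := by
    have h3 := Real.add_one_le_exp (-(2 / (n : ℝ)))
    have h4 : 1 / (n : ℝ) ≤ σ / n := by gcongr
    have h5 : (σ : ℝ) / n + 1 / n ≤ 1 := by rw [← add_div, div_le_one hn]; exact h2
    have h6 : 2 / (n : ℝ) = 2 * (1 / n) := by ring
    rw [abs_le]
    constructor <;> linarith
  calc (1 - 2 * ((σ : ℝ) / n)) ^ t ≤ |1 - 2 * ((σ : ℝ) / n)| ^ t := by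
        rw [← abs_pow]; exact le_abs_self _
    _ ≤ Real.exp (-(2 / n)) ^ t := pow_le_pow_left₀ (abs_nonneg _) habs t
    _ = Real.exp (-(2 * (t / n))) := by rw [← Real.exp_nat_mul]; congr 1; ring
    _ ≤ _ := exp_neg_two_mul_le (by positivity) (by
        rw [div_le_one hn]; exact_mod_cast ht)

/-- The probability that `d` is a counterexample to the secret being the best candidate. -/
theorem Ex_closer_le (h0 : 0 < σ) (hσ : σ < n) (hη0 : 0 ≤ η) (hη : η ≤ 1 / 8) {y : ℝ}
    (hy : y ≤ 5 * M / (48 * n)) (d : Fin n → ZMod 2) :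
    Ex (iid (Fin M) (approxRow n σ)) (fun A => Ex (iid (Fin M) (ber η)) fun e =>
      if hammingNorm (Matrix.of A *ᵥ d + e) ≤ hammingNorm e then 1 else 0) ≤
    Real.exp (-y) ^ hammingNorm d := by
  have hn : (0 : ℝ) < n := by exact_mod_cast (by omega : 0 < n)
  have h1 : Ex (iid (Fin M) (approxRow n σ)) (fun A => Ex (iid (Fin M) (ber η)) fun e =>
      if hammingNorm (Matrix.of A *ᵥ d + e) ≤ hammingNorm e then (1 : ℝ) else 0) ≤
      Ex (iid (Fin M) (approxRow n σ)) fun A => Ex (iid (Fin M) (ber η)) fun e =>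
        ∏ i, tilt (A i ⬝ᵥ d) (e i) := by
    refine Ex_mono _ fun A => Ex_mono _ fun e => ?_
    split_ifs with h
    · exact one_le_prod_tilt (Matrix.of A *ᵥ d) e h
    · exact Finset.prod_nonneg fun i _ => (tilt_pos _ _).le
  refine h1.trans ?_
  have h2 : ∀ A : Fin M → Fin n → ZMod 2, Ex (iid (Fin M) (ber η)) (fun e =>
      ∏ i, tilt (A i ⬝ᵥ d) (e i)) = ∏ i, (1 - (1 / 4 - 3 * η / 4) * (1 - chi (A i ⬝ᵥ d))) := by
    intro A
    rw [iid_eq_indep, Ex_indep_prod _ fun i => tilt (A i ⬝ᵥ d)]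
    exact Finset.prod_congr rfl fun i _ => Ex_tilt hη0 (by linarith) _
  simp only [h2]
  rw [iid_eq_indep, Ex_indep_prod _ fun _ a => 1 - (1 / 4 - 3 * η / 4) * (1 - chi (a ⬝ᵥ d)),
    Finset.prod_const, Finset.card_univ, Fintype.card_fin]
  simp only [Ex_sub, Ex_const, Ex_mul_left, Ex_chi_approxRow hσ.le]
  set t := hammingNorm d
  have ht : t ≤ n := hammingNorm_le d
  have h3 := pow_bias_le h0 hσ ht
  have hpow1 : |(1 - 2 * ((σ : ℝ) / n)) ^ t| ≤ 1 := by
    rw [abs_pow]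
    refine pow_le_one₀ (abs_nonneg _) (abs_le.2 ?_)
    have hp0 : (0 : ℝ) ≤ (σ : ℝ) / n := by positivity
    have hp1 : (σ : ℝ) / n ≤ 1 := div_le_one_of_le₀ (by exact_mod_cast hσ.le) hn.le
    constructor <;> linarith
  obtain ⟨h4, h5⟩ := abs_le.1 hpow1
  have h6 : 0 ≤ 1 - (1 / 4 - 3 * η / 4) * (1 - (1 - 2 * ((σ : ℝ) / n)) ^ t) := by nlinarith
  -- `η ≤ 1/8` gives `1/4 - 3η/4 ≥ 5/32`, and `5/32 · 2/3 = 5/48`.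
  have h7 : 1 - (1 / 4 - 3 * η / 4) * (1 - (1 - 2 * ((σ : ℝ) / n)) ^ t) ≤
      Real.exp (-(5 / 48 * (t / n))) := by
    have h8 := Real.add_one_le_exp (-(5 / 48 * ((t : ℝ) / n)))
    have h9 : 5 / 32 * (2 / 3 * ((t : ℝ) / n)) ≤
        (1 / 4 - 3 * η / 4) * (1 - (1 - 2 * ((σ : ℝ) / n)) ^ t) :=
      mul_le_mul (by linarith) (by linarith) (by positivity) (by linarith)
    linarith
  refine (pow_le_pow_left₀ h6 h7 M).trans ?_
  rw [← Real.exp_nat_mul, ← Real.exp_nat_mul, Real.exp_le_exp]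
  have h10 := mul_le_mul_of_nonneg_left hy (Nat.cast_nonneg (α := ℝ) t)
  have h11 : (t : ℝ) * (5 * M / (48 * n)) = M * (5 / 48 * (t / n)) := by field_simp
  linarith

theorem sum_pow_hammingNorm (n : ℕ) (z : ℝ) :
    ∑ d : Fin n → ZMod 2, z ^ hammingNorm d = (1 + z) ^ n := by
  rw [sum_hammingNorm n fun w => z ^ w, add_comm (1 : ℝ), add_pow]
  refine Finset.sum_congr rfl fun w _ => ?_
  simp [mul_comm]

/-- A union bound over `d ≠ 0`, summed by weight: `(1 + z)^n - 1 ≤ exp (nz) - 1 ≤ 2nz` for `z = exp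
(-y)` and `nz ≤ 1`. -/
theorem Ex_exists_closer_le (h0 : 0 < σ) (hσ : σ < n) (hη0 : 0 ≤ η) (hη : η ≤ 1 / 8) {y : ℝ}
    (hy : y ≤ 5 * M / (48 * n)) (hny : n * Real.exp (-y) ≤ 1) :
    Ex (iid (Fin M) (approxRow n σ)) (fun A => Ex (iid (Fin M) (ber η)) fun e =>
      if ∃ d, d ≠ 0 ∧ hammingNorm (Matrix.of A *ᵥ d + e) ≤ hammingNorm e then 1 else 0) ≤
    2 * (n * Real.exp (-y)) := by
  classical
  have h1 : Ex (iid (Fin M) (approxRow n σ)) (fun A => Ex (iid (Fin M) (ber η)) fun e =>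
      if ∃ d, d ≠ 0 ∧ hammingNorm (Matrix.of A *ᵥ d + e) ≤ hammingNorm e then (1 : ℝ) else 0) ≤
      Ex (iid (Fin M) (approxRow n σ)) fun A => Ex (iid (Fin M) (ber η)) fun e =>
        ∑ d ∈ Finset.univ.erase 0,
          if hammingNorm (Matrix.of A *ᵥ d + e) ≤ hammingNorm e then (1 : ℝ) else 0 := by
    refine Ex_mono _ fun A => Ex_mono _ fun e => ?_
    have hnn : ∀ d ∈ Finset.univ.erase (0 : Fin n → ZMod 2), (0 : ℝ) ≤
        if hammingNorm (Matrix.of A *ᵥ d + e) ≤ hammingNorm e then (1 : ℝ) else 0 :=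
      fun d _ => by split_ifs <;> simp
    split_ifs with h
    · obtain ⟨d, hd0, hd⟩ := h
      refine le_trans ?_ (Finset.single_le_sum hnn (Finset.mem_erase.2 ⟨hd0, Finset.mem_univ d⟩))
      rw [if_pos hd]
    · exact Finset.sum_nonneg hnn
  refine h1.trans ?_
  simp only [Ex_sum]
  have h2 : ∑ d ∈ Finset.univ.erase (0 : Fin n → ZMod 2), Real.exp (-y) ^ hammingNorm d =
      (1 + Real.exp (-y)) ^ n - 1 := by
    rw [← sum_pow_hammingNorm, ← Finset.add_sum_erase _ _ (Finset.mem_univ (0 : Fin n → ZMod 2))]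
    simp
  refine (Finset.sum_le_sum fun d _ => Ex_closer_le h0 hσ hη0 hη hy d).trans ?_
  rw [h2]
  have h3 : (1 + Real.exp (-y)) ^ n ≤ Real.exp (n * Real.exp (-y)) := by
    rw [Real.exp_nat_mul]
    refine pow_le_pow_left₀ (by positivity) ?_ n
    have := Real.add_one_le_exp (Real.exp (-y))
    linarith
  have h4 : 0 ≤ (n : ℝ) * Real.exp (-y) := by positivity
  have h5 := Real.abs_exp_sub_one_le (x := n * Real.exp (-y)) (by rwa [abs_of_nonneg h4])
  rw [abs_of_nonneg h4] at h5
  have := (abs_le.1 h5).2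
  linarith

end

/-! ### Information-theoretic bounds -/

/-- For each label vector the guesses of the solver have total mass one, so it cannot serve more
secrets, counted with probability, than there are label vectors. -/
theorem sum_solver_le {m d : ℕ} (O : Solver m d) (Q : Matrix (Fin m) (Fin d) (ZMod 2))
    (e : Fin m → ZMod 2) (V : Finset (Fin m → ZMod 2)) (hV : ∀ S, Q *ᵥ S + e ∈ V) :
    ∑ S, (O Q (Q *ᵥ S + e) S).toReal ≤ V.card := by
  classical
  have h1 : ∀ S, (O Q (Q *ᵥ S + e) S).toReal ≤ ∑ y ∈ V, (O Q y S).toReal := fun S =>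
    Finset.single_le_sum (f := fun y => (O Q y S).toReal) (fun _ _ => ENNReal.toReal_nonneg) (hV S)
  refine (Finset.sum_le_sum fun S _ => h1 S).trans_eq ?_
  rw [Finset.sum_comm]
  simp [sum_toReal_pmf]

/-- If the labels take few values, then no solver succeeds often. -/
theorem successProb_le {m d : ℕ} (row : PMF (Fin d → ZMod 2)) (η : ℝ) (O : Solver m d) (N : ℕ)
    (hN : ∀ Q ∈ (iid (Fin m) row).support, ∀ e : Fin m → ZMod 2,
      ∃ V : Finset (Fin m → ZMod 2), V.card ≤ N ∧ ∀ S, Matrix.of Q *ᵥ S + e ∈ V) :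
    successProb row η O ≤ N / 2 ^ d := by
  rw [successProb_eq_Ex, Ex_comm]
  simp only [Ex_comm (PMF.uniformOfFintype (Fin d → ZMod 2)) (iid (Fin m) (ber η))]
  rw [← Ex_const (iid (Fin m) row) ((N : ℝ) / 2 ^ d)]
  refine Ex_mono_support _ fun Q hQ => ?_
  rw [← Ex_const (iid (Fin m) (ber η)) ((N : ℝ) / 2 ^ d)]
  refine Ex_mono _ fun e => ?_
  obtain ⟨V, hV, hV'⟩ := hN Q hQ e
  rw [Ex_uniformOfFintype]
  have h1 := (sum_solver_le O (Matrix.of Q) e V hV').trans (Nat.cast_le.2 hV)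
  have h2 : ((Fintype.card (Fin d → ZMod 2) : ℕ) : ℝ) = 2 ^ d := by simp [ZMod.card]
  rw [h2]
  gcongr

/-- This bounds `k` in terms of `m / n` whenever an oracle with success probability `ε` exists. -/
theorem successProb_le_pow {m d : ℕ} (row : PMF (Fin d → ZMod 2)) (η : ℝ) (O : Solver m d) :
    successProb row η O ≤ 2 ^ m / 2 ^ d := by
  have := successProb_le row η O (2 ^ m) fun Q _ e =>
    ⟨Finset.univ, by simp [ZMod.card], fun S => Finset.mem_univ _⟩
  exact_mod_cast this

/-- All rows are the all-ones vector, so the labels reveal only the parity of the secret. This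
excludes `σ = n`. -/
theorem successProb_exactRow_self_le {m d : ℕ} (h : d ≤ d) (η : ℝ) (O : Solver m d) :
    successProb (exactRow d d h) η O ≤ 2 / 2 ^ d := by
  classical
  refine (successProb_le (exactRow d d h) η O 2 fun Q hQ e => ?_).trans_eq (by norm_num)
  refine ⟨Finset.univ.image fun x : ZMod 2 => (fun _ => x) + e,
    Finset.card_image_le.trans (by simp [ZMod.card]), fun S => ?_⟩
  have hrow : ∀ i, Q i = 1 := by
    intro i
    have h1 : Q i ∈ (exactRow d d h).support := by
      rw [PMF.mem_support_iff] at hQ ⊢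
      intro h0; exact hQ (Finset.prod_eq_zero (Finset.mem_univ i) h0)
    rw [exactRow, PMF.mem_support_uniformOfFinset_iff, weightSet, Finset.mem_filter] at h1
    have h2 : (Finset.univ.filter fun t => Q i t ≠ 0) = Finset.univ :=
      Finset.eq_univ_of_card _ (by rw [Fintype.card_fin]; exact h1.2)
    have h01 : ∀ x : ZMod 2, x ≠ 0 → x = 1 := by decide
    funext t
    have h3 : t ∈ Finset.univ.filter fun t => Q i t ≠ 0 := by rw [h2]; exact Finset.mem_univ t
    exact h01 _ (Finset.mem_filter.1 h3).2
  refine Finset.mem_image.2 ⟨∑ t, S t, Finset.mem_univ _, ?_⟩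
  congr 1
  funext i
  change _ = Q i ⬝ᵥ S
  rw [hrow i]
  simp [dotProduct]

/-! ### Numerical estimates -/

/-- The Chernoff bound with `z = 10/11`: the gain in the exponent is `cM/11`, where `cM ≥ (3/e) m ≥
1.1036 m`, and the cost is `m log 1.1 ≤ 0.0954 m`. The difference exceeds `2n` because `m ≥ 1200 n`,
and `exp (-2) ≤ 1/4`. -/
theorem one_sub_selProb_le_pow {n m M σ : ℕ} {c : ℝ} (h0 : 0 < σ) (hc1 : c ≤ 1)
    (hc : 1 / (Real.exp 1 * Real.sqrt σ) ≤ c) (hm : 1200 * (n : ℝ) ≤ m)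
    (hM : 3 * Real.sqrt σ * m ≤ M) : 1 - selProb c M m ≤ (1 / 4) ^ n := by
  have hs : 0 < Real.sqrt σ := Real.sqrt_pos.2 (by exact_mod_cast h0)
  have hc0 : 0 ≤ c := le_trans (by positivity) hc
  refine (one_sub_selProb_le hc0 hc1 (z := 10 / 11) (by norm_num) (by norm_num) M m).trans ?_
  have h1 : (1 - c * (1 - 10 / 11)) ^ M ≤ Real.exp (-(c * M / 11)) := by
    have h2 : 1 - c * (1 - 10 / 11) ≤ Real.exp (-(c / 11)) := by
      have := Real.add_one_le_exp (-(c / 11))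
      linarith
    refine (pow_le_pow_left₀ (by linarith) h2 M).trans_eq ?_
    rw [← Real.exp_nat_mul]; congr 1; ring
  have h3 : (1100 / 1000 : ℝ) ≤ Real.exp 0.0954 := by
    have := Real.sum_le_exp_of_nonneg (x := 0.0954) (by norm_num) 4
    refine le_trans ?_ this
    norm_num [Finset.sum_range_succ, Nat.factorial]
  have h4 : ((10 / 11 : ℝ) ^ m)⁻¹ ≤ Real.exp (0.0954 * m) := by
    rw [← inv_pow, mul_comm, Real.exp_nat_mul]
    exact pow_le_pow_left₀ (by norm_num) (le_trans (by norm_num) h3) m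
  have h5 : 1.1036 * (m : ℝ) ≤ c * M := by
    have he := Real.exp_one_lt_d9
    have h6 : 1 / (Real.exp 1 * Real.sqrt σ) * (3 * Real.sqrt σ * m) ≤ c * M := by gcongr
    have h7 : 1 / (Real.exp 1 * Real.sqrt σ) * (3 * Real.sqrt σ * m) = 3 / Real.exp 1 * m := by
      field_simp
    have h8 : (1.1036 : ℝ) ≤ 3 / Real.exp 1 := by
      rw [le_div_iff₀ (Real.exp_pos 1)]; linarith
    have h9 : 1.1036 * (m : ℝ) ≤ 3 / Real.exp 1 * m := by gcongr
    linarith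
  rw [div_eq_mul_inv]
  calc _ ≤ Real.exp (-(c * M / 11)) * Real.exp (0.0954 * m) :=
        mul_le_mul h1 h4 (by positivity) (by positivity)
    _ = Real.exp (-(c * M / 11) + 0.0954 * m) := (Real.exp_add _ _).symm
    _ ≤ Real.exp (n * -2) := by
        rw [Real.exp_le_exp]; linarith [Nat.cast_nonneg (α := ℝ) n]
    _ = Real.exp (-2) ^ n := Real.exp_nat_mul _ _
    _ ≤ _ := by
        refine pow_le_pow_left₀ (Real.exp_pos _).le ?_ n
        rw [Real.exp_neg, one_div]
        have := Real.quadratic_le_exp_of_nonneg (x := 2) (by norm_num)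
        exact inv_anti₀ (by norm_num) (by linarith)

/-- Multiplying `m σ² ≥ 48 n³` by `m³ ≥ (1200 n)³` bounds the square of `σ m²` from below. The
number `164` is `16 · 256 / 25` rounded up, which is what the claim needs. -/
theorem sixteen_mul_le_sq {n m σ : ℕ} (h0 : 0 < σ) (hn : 0 < n)
    (hm1 : 48 * ((n : ℝ) ^ 3 / (σ : ℝ) ^ 2) ≤ m) (hm2 : 1200 * (n : ℝ) ≤ m) :
    16 * (n : ℝ) ≤ (5 / 16 * (Real.sqrt σ * m / n)) ^ 2 := by
  have hn' : (0 : ℝ) < n := by exact_mod_cast hn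
  have hσ' : (0 : ℝ) < σ := by exact_mod_cast h0
  have h1 : 48 * (n : ℝ) ^ 3 ≤ m * (σ : ℝ) ^ 2 := by
    rw [← mul_div_assoc, div_le_iff₀ (by positivity)] at hm1
    exact hm1
  have h2 : (1200 * (n : ℝ)) ^ 3 ≤ (m : ℝ) ^ 3 := pow_le_pow_left₀ (by positivity) hm2 3
  have h3 : (164 * (n : ℝ) ^ 3) ^ 2 ≤ (σ * (m : ℝ) ^ 2) ^ 2 := by
    have h4 := mul_le_mul h1 h2 (by positivity) (by positivity)
    have h5 : (0 : ℝ) ≤ (n : ℝ) ^ 6 := by positivity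
    calc (164 * (n : ℝ) ^ 3) ^ 2 ≤ 48 * (n : ℝ) ^ 3 * (1200 * (n : ℝ)) ^ 3 := by nlinarith
      _ ≤ m * (σ : ℝ) ^ 2 * (m : ℝ) ^ 3 := h4
      _ = _ := by ring
  have h6 : 164 * (n : ℝ) ^ 3 ≤ σ * (m : ℝ) ^ 2 :=
    le_of_sq_le_sq h3 (by positivity)
  have h7 : (5 / 16 * (Real.sqrt σ * m / n)) ^ 2 = 25 * (σ * (m : ℝ) ^ 2) / (256 * (n : ℝ) ^ 2) := by
    rw [mul_pow, div_pow (Real.sqrt σ * m), mul_pow (Real.sqrt σ), Real.sq_sqrt hσ'.le]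
    ring
  rw [h7, le_div_iff₀ (by positivity)]
  have h8 : 16 * (n : ℝ) * (256 * (n : ℝ) ^ 2) = 4096 * (n : ℝ) ^ 3 := by ring
  have h9 : (0 : ℝ) < (n : ℝ) ^ 3 := by positivity
  linarith

/-- Half of the exponent absorbs the factor `n`, since `exp (y/2) ≥ y²/8 ≥ 2n`. The other half gives
`exp (-y/2) ≤ 1 / (1 + y/2) ≤ 32 / (5K) ≤ δ/75`. -/
theorem exp_bounds {n : ℕ} {y K δ : ℝ} (hy0 : 0 ≤ y) (hy : 16 * (n : ℝ) ≤ y ^ 2)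
    (hyK : 5 / 16 * (K - 2) ≤ y) (hK : 0 < K) (hKδ : 480 ≤ K * δ) :
    n * Real.exp (-y) ≤ 1 ∧ 2 * (n * Real.exp (-y)) ≤ δ / 4 := by
  have h1 : (n : ℝ) * Real.exp (-(y / 2)) ≤ 1 := by
    have h2 := Real.quadratic_le_exp_of_nonneg (x := y / 2) (by positivity)
    rw [Real.exp_neg, ← div_eq_mul_inv, div_le_one (Real.exp_pos _)]
    nlinarith
  have h3 : Real.exp (-(y / 2)) ≤ 32 / (5 * K) := by
    have h4 := Real.add_one_le_exp (y / 2)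
    rw [Real.exp_neg, inv_le_comm₀ (Real.exp_pos _) (by positivity), inv_div]
    linarith
  have h5 : n * Real.exp (-y) ≤ Real.exp (-(y / 2)) := by
    have : Real.exp (-y) = Real.exp (-(y / 2)) * Real.exp (-(y / 2)) := by
      rw [← Real.exp_add]; congr 1; ring
    rw [this, ← mul_assoc]
    exact mul_le_of_le_one_left (Real.exp_pos _).le h1
  refine ⟨h5.trans (Real.exp_le_one_iff.2 (by linarith)), ?_⟩
  have h6 : 32 / (5 * K) ≤ δ / 75 := by
    rw [div_le_div_iff₀ (by positivity) (by norm_num)]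
    linarith
  have hδ : 0 < δ := by
    by_contra h
    push Not at h
    nlinarith
  linarith

/-! ### The error budget and the running time -/

section

variable {n m M k' σ : ℕ}

theorem successProb_eq_solveProb {η : ℝ} (h0 : 0 ≤ η) (h1 : η ≤ 1)
    (row : PMF (Fin ((k' + 1) * n) → ZMod 2)) (O : Solver m ((k' + 1) * n)) :
    successProb row ((1 - (1 - 2 * η) ^ (k' + 1)) / 2) O =
      Ex (iid (Fin (k' + 1)) (PMF.uniformOfFintype (Fin n → ZMod 2))) fun S =>
        Ex (iid (Fin m) row) fun Q => Ex (iid (Fin (k' + 1)) (iid (Fin m) (ber η))) fun e =>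
          solveProb O S Q (∑ i, e i) := by
  rw [successProb_eq_Ex, Ex_uniform_flat]
  refine congrArg _ (funext fun S => congrArg _ (funext fun Q => ?_))
  exact (Ex_sum_noise h0 h1 (k' + 1) m fun e => solveProb O S Q e).symm

/-- The output can be wrong only if a nonzero shift fits the noise as well as the secret does, if
the instance is hard, or if all trials on an instance that is not hard miss the secret. -/
theorem le_successProb (hσ : σ ≤ n) (O : Solver m ((k' + 1) * n)) {η : ℝ} (D E : ℕ)
    {τ β p : ℝ} (hτ1 : τ ≤ 1) (hβ : Ex (iid (Fin M) (approxRow n σ)) (fun A =>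
      Ex (iid (Fin M) (ber η)) fun e =>
        if ∃ d, d ≠ 0 ∧ hammingNorm (Matrix.of A *ᵥ d + e) ≤ hammingNorm e then 1 else 0) ≤ β)
    (hp : hardProb (ber η) σ O M τ ≤ p) :
    1 - β - p - (1 - τ) ^ (128 * D * E) ≤ successProb (approxRow n σ) η
      (programSolver reduction [n, m, k' + 1, σ, M, D, E] M n η O (reductionTime n m k' M D E)) := by
  classical
  rw [successProb_eq_Ex]
  set L := 128 * D * E with hL
  set bad : (Fin M → Fin n → ZMod 2) → (Fin M → ZMod 2) → ℝ := fun A e =>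
    if ∃ d, d ≠ 0 ∧ hammingNorm (Matrix.of A *ᵥ d + e) ≤ hammingNorm e then 1 else 0
  have key : ∀ s A e, 1 - (1 - τ) ^ L - bad A e - hardWeight (ber η) σ O τ s A e ≤
      (programSolver reduction [n, m, k' + 1, σ, M, D, E] M n η O (reductionTime n m k' M D E)
        (Matrix.of A) (Matrix.of A *ᵥ s + e) s).toReal := by
    intro s A e
    have hpow : 0 ≤ (1 - τ) ^ L := pow_nonneg (by linarith) _
    have hnn : 0 ≤ (programSolver reduction [n, m, k' + 1, σ, M, D, E] M n η O
      (reductionTime n m k' M D E) (Matrix.of A) (Matrix.of A *ᵥ s + e) s).toReal :=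
      ENNReal.toReal_nonneg
    by_cases hbad : ∃ d, d ≠ 0 ∧ hammingNorm (Matrix.of A *ᵥ d + e) ≤ hammingNorm e
    · have h1 : bad A e = 1 := if_pos hbad
      have h2 : 0 ≤ hardWeight (ber η) σ O τ s A e := by
        unfold hardWeight; split_ifs <;> simp
      linarith
    have h1 : bad A e = 0 := if_neg hbad
    by_cases hhard : (trial (ber η) σ O (Matrix.of A) (Matrix.of A *ᵥ s + e) (some s)).toReal < τ
    · have h2 : hardWeight (ber η) σ O τ s A e = 1 := if_pos hhard
      linarith
    have h2 : hardWeight (ber η) σ O τ s A e = 0 := if_neg hhard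
    push Not at hbad hhard
    have htwo : ∀ x : ZMod 2, x + x = 0 := by decide
    -- Over `𝔽₂` the residual of a candidate `g` is `A (g + s) + e`, so wrong candidates correspond
    -- to nonzero vectors `d`.
    have hgood : ∀ g, g ≠ s → hammingNorm (Matrix.of A *ᵥ s + (Matrix.of A *ᵥ s + e)) <
        hammingNorm (Matrix.of A *ᵥ g + (Matrix.of A *ᵥ s + e)) := by
      intro g hg
      have h3 : Matrix.of A *ᵥ s + (Matrix.of A *ᵥ s + e) = e := by
        funext i
        simp only [Pi.add_apply]
        rw [← add_assoc, htwo, zero_add]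
      have h4 : Matrix.of A *ᵥ g + (Matrix.of A *ᵥ s + e) = Matrix.of A *ᵥ (g + s) + e := by
        rw [Matrix.mulVec_add, add_assoc]
      rw [h3, h4]
      refine hbad (g + s) fun h0 => hg ?_
      funext t
      have h5 := congrFun h0 t
      simp only [Pi.add_apply, Pi.zero_apply] at h5
      have h6 : ∀ x y : ZMod 2, x + y = 0 → x = y := by decide
      exact h6 _ _ h5
    have h3 := ENNReal.toReal_mono (PMF.apply_ne_top _ _)
      (seenLaw_le_programSolver O hσ η D E (Matrix.of A) (Matrix.of A *ᵥ s + e) s hgood)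
    rw [seenLaw_true, ← hL] at h3
    have h4 : (1 - (trial (ber η) σ O (Matrix.of A) (Matrix.of A *ᵥ s + e) (some s)).toReal) ^ L ≤
        (1 - τ) ^ L := by
      refine pow_le_pow_left₀ ?_ (by linarith) L
      rw [sub_nonneg]
      exact ENNReal.toReal_mono ENNReal.one_ne_top (PMF.coe_le_one _ _)
    linarith
  refine le_trans ?_ (Ex_mono _ fun s => Ex_mono _ fun A => Ex_mono _ fun e => key s A e)
  simp only [Ex_sub, Ex_const]
  have h5 : Ex (PMF.uniformOfFintype (Fin n → ZMod 2)) (fun s =>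
      Ex (iid (Fin M) (approxRow n σ)) fun A => Ex (iid (Fin M) (ber η)) fun e =>
        hardWeight (ber η) σ O τ s A e) = hardProb (ber η) σ O M τ := rfl
  rw [h5]
  linarith

theorem reduction_solves {ε δ η : ℝ} (hσn : σ ≤ n) (hn : 0 < n) (h0 : 0 < σ)
    (hm : max (48 * ((n : ℝ) ^ 3 / (σ : ℝ) ^ 2)) (1200 * (n : ℝ)) ≤ (m : ℝ))
    (hM : M = ⌈3 * Real.sqrt (σ : ℝ) * (m : ℝ)⌉₊) (hε : 0 < ε)
    (hδ : 6 * ((1 : ℝ) / 2 ^ (2 * n - 1)) < δ) (hδ1 : δ < 1) (hη0 : 0 < η) (hη : η < 1 / 8)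
    (hk1 : 192 / δ * Real.log (16 / ε) < ((k' + 1 : ℕ) : ℝ))
    (hk2 : ((k' + 1 : ℕ) : ℝ) < 2 ^ (2 * n - 2) * ε) (O : Solver m ((k' + 1) * n))
    (hO : ε ≤ successProb (exactRow ((k' + 1) * n) ((k' + 1) * σ) (Nat.mul_le_mul_left _ hσn))
      ((1 - (1 - 2 * η) ^ (k' + 1)) / 2) O) :
    1 - δ ≤ successProb (approxRow n σ) η
      (programSolver reduction [n, m, k' + 1, σ, M, ⌈1 / δ⌉₊, ⌈1 / ε⌉₊] M n η O
        (reductionTime n m k' M ⌈1 / δ⌉₊ ⌈1 / ε⌉₊)) := by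
  have hδ0 : 0 < δ := lt_trans (by positivity) hδ
  have hε1 : ε ≤ 1 := by
    rw [successProb_eq_Ex] at hO
    exact hO.trans (Ex_le_one _ fun s => Ex_le_one _ fun A => Ex_le_one _ fun e =>
      ENNReal.toReal_mono ENNReal.one_ne_top (PMF.coe_le_one _ _))
  set K : ℝ := ((k' + 1 : ℕ) : ℝ) with hKdef
  have hK1 : 1 ≤ K := by simp [K]
  -- `log (16/ε) ≥ 4 log 2 > 2.5`, and `192 · 2.5 = 480`.
  have hKδ : 480 ≤ K * δ := by
    have h1 : (2.5 : ℝ) ≤ Real.log (16 / ε) := by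
      have h2 : Real.log 16 ≤ Real.log (16 / ε) :=
        Real.log_le_log (by norm_num) (by rw [le_div_iff₀ hε]; linarith)
      have h3 : Real.log 16 = 4 * Real.log 2 := by
        rw [show (16 : ℝ) = 2 ^ 4 by norm_num, Real.log_pow]; norm_num
      have := Real.log_two_gt_d9
      linarith
    rw [div_mul_eq_mul_div, div_lt_iff₀ hδ0] at hk1
    linarith
  have hK480 : 480 ≤ K := by nlinarith
  obtain ⟨hm1, hm2⟩ := max_le_iff.1 hm
  -- the oracle cannot succeed when all rows are equal
  have hσ : σ < n := by
    refine lt_of_le_of_ne hσn fun hσn' => ?_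
    subst hσn'
    have h1 := hO.trans (successProb_exactRow_self_le _ _ O)
    rw [le_div_iff₀ (by positivity)] at h1
    have h2 : (2 : ℝ) ^ ((k' + 1) * σ) < 2 ^ (2 * σ - 2 + 1) := by
      rw [pow_succ]
      calc (2 : ℝ) ^ ((k' + 1) * σ) ≤ K * 2 ^ ((k' + 1) * σ) :=
            le_mul_of_one_le_left (by positivity) hK1
        _ < 2 ^ (2 * σ - 2) * ε * 2 ^ ((k' + 1) * σ) := by gcongr
        _ = 2 ^ (2 * σ - 2) * (ε * 2 ^ ((k' + 1) * σ)) := by ring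
        _ ≤ _ := by gcongr
    have h3 := (pow_lt_pow_iff_right₀ (by norm_num : (1 : ℝ) < 2)).1 h2
    have h4 : 480 ≤ k' + 1 := by
      have h := hK480
      rw [hKdef] at h
      exact_mod_cast h
    have h5 : 480 * σ ≤ (k' + 1) * σ := Nat.mul_le_mul_right σ h4
    omega
  -- Counting label vectors gives `ε 2^(kn) ≤ 2^m`, while `ε > k / 2^(2n-2)`. A successful oracle
  -- thus forces `m / n` to grow with `k`, which makes the verification error small compared with
  -- `δ`.
  have hKn : (K - 2) * n ≤ m := by
    have h1 := hO.trans (successProb_le_pow _ _ O)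
    rw [le_div_iff₀ (by positivity)] at h1
    have h2 : (2 : ℝ) ^ ((k' + 1) * n) < 2 ^ (2 * n - 2 + m) := by
      rw [pow_add]
      calc (2 : ℝ) ^ ((k' + 1) * n) ≤ K * 2 ^ ((k' + 1) * n) :=
            le_mul_of_one_le_left (by positivity) hK1
        _ < 2 ^ (2 * n - 2) * ε * 2 ^ ((k' + 1) * n) := by gcongr
        _ = 2 ^ (2 * n - 2) * (ε * 2 ^ ((k' + 1) * n)) := by ring
        _ ≤ _ := by gcongr
    have h3 := (pow_lt_pow_iff_right₀ (by norm_num : (1 : ℝ) < 2)).1 h2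
    have h4 : (k' + 1) * n ≤ 2 * n + m := by omega
    have h5 : (((k' + 1) * n : ℕ) : ℝ) ≤ ((2 * n + m : ℕ) : ℝ) := by exact_mod_cast h4
    push_cast at h5
    simp only [hKdef]
    push_cast
    linarith
  have hn' : (0 : ℝ) < n := by exact_mod_cast hn
  have hM' : 3 * Real.sqrt σ * m ≤ M := by rw [hM]; exact Nat.le_ceil _
  have hs1 : 1 ≤ Real.sqrt σ := Real.one_le_sqrt.2 (by exact_mod_cast h0)
  -- `5/16 = 3 · 5/48`, from `M ≥ 3√σ m` in the exponent `5M / (48n)`.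
  set y := 5 / 16 * (Real.sqrt σ * m / n)
  have hyK : 5 / 16 * (K - 2) ≤ y := by
    refine mul_le_mul_of_nonneg_left ?_ (by norm_num)
    rw [le_div_iff₀ hn']
    exact hKn.trans (le_mul_of_one_le_left (Nat.cast_nonneg m) hs1)
  obtain ⟨hy1, hy2⟩ := exp_bounds (n := n) (y := y) (K := K) (δ := δ) (by positivity)
    (sixteen_mul_le_sq h0 hn hm1 hm2) hyK (by linarith) hKδ
  have hyM : y ≤ 5 * M / (48 * n) := by
    rw [le_div_iff₀ (by positivity)]
    have : y * (48 * n) = 5 * (3 * Real.sqrt σ * m) := by simp only [y]; field_simp; ring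
    linarith
  have hbad := (Ex_exists_closer_le (M := M) h0 hσ hη0.le hη.le hyM hy1).trans hy2
  -- The hypothesis on `δ` reads `12 · (1/4)^n < δ`.
  have hfail : 1 - selProb (acceptProb n σ k') M m ≤ δ / 4 := by
    refine (one_sub_selProb_le_pow h0 (acceptProb_le_one h0 hσ) (le_acceptProb h0 hσ) hm2 hM').trans
      ?_
    have h1 : (1 : ℝ) / 2 ^ (2 * n - 1) = 2 * (1 / 4) ^ n := by
      obtain ⟨l, rfl⟩ : ∃ l, n = l + 1 := ⟨n - 1, by omega⟩
      rw [show 2 * (l + 1) - 1 = 2 * l + 1 by omega, pow_succ, pow_mul, one_div_pow, pow_succ]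
      norm_num
      ring
    rw [h1] at hδ
    have : (0 : ℝ) < (1 / 4) ^ n := by positivity
    linarith
  rw [successProb_eq_solveProb hη0.le (by linarith)] at hO
  have hhard := hardProb_le h0 hσ (ber η) O hε hε1 hδ0 (by simpa [K] using hk1) hfail hO
  -- The error budget: `δ/4` for a shift that fits as well as the secret, `δ/2` for hard instances,
  -- `δ/4` for trials that all miss.
  refine le_trans ?_ (le_successProb hσn O ⌈1 / δ⌉₊ ⌈1 / ε⌉₊ (τ := ε / 32) (by linarith) hbad hhard)
  -- The number of trials is chosen so that its product with `ε/32` is at least `4/δ`, and `exp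
  -- (-4/δ) ≤ δ/4`.
  have hrep : (1 - ε / 32) ^ (128 * ⌈1 / δ⌉₊ * ⌈1 / ε⌉₊) ≤ δ / 4 := by
    have h1 : 1 - ε / 32 ≤ Real.exp (-(ε / 32)) := by
      have := Real.add_one_le_exp (-(ε / 32))
      linarith
    refine (pow_le_pow_left₀ (by linarith) h1 _).trans ?_
    rw [← Real.exp_nat_mul]
    have h2 : 4 / δ ≤ ((128 * ⌈1 / δ⌉₊ * ⌈1 / ε⌉₊ : ℕ) : ℝ) * (ε / 32) := by
      push_cast
      have h3 : 1 / δ * (1 / ε) ≤ (⌈1 / δ⌉₊ : ℝ) * (⌈1 / ε⌉₊ : ℝ) :=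
        mul_le_mul (Nat.le_ceil _) (Nat.le_ceil _) (by positivity) (by positivity)
      calc 4 / δ = 128 * (1 / δ * (1 / ε)) * (ε / 32) := by field_simp; norm_num
        _ ≤ 128 * ((⌈1 / δ⌉₊ : ℝ) * (⌈1 / ε⌉₊ : ℝ)) * (ε / 32) := by gcongr
        _ = _ := by ring
    have h4 : Real.exp (-(4 / δ)) ≤ δ / 4 := by
      have := Real.add_one_le_exp (4 / δ)
      rw [Real.exp_neg, inv_le_comm₀ (Real.exp_pos _) (by positivity), inv_div]
      linarith
    refine le_trans (Real.exp_le_exp.2 ?_) h4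
    linarith
  linarith

/-- With `U` the sum of the parameters, `M ≤ 4U²`, a trial takes at most `2000 U³` steps and there
are at most `128 U²` trials. The bounds `m, n ≥ 1` absorb the rounding of `1/δ` and `1/ε`, and
`300000` leaves room for the terms of lower order. -/
theorem reductionTime_le {C : ℕ} (hC : 300000 ≤ C) {ε δ : ℝ} (hm : 0 < m)
    (hn : 0 < n) (h0 : 0 < σ) (hσ : σ ≤ n)
    (hM : M = ⌈3 * Real.sqrt (σ : ℝ) * (m : ℝ)⌉₊) (hε : 0 < ε) (hδ : 0 < δ) :
    (reductionTime n m k' M ⌈1 / δ⌉₊ ⌈1 / ε⌉₊ : ℝ) ≤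
      C * ((n : ℝ) + m + (k' + 1 : ℕ) + 1 / δ + 1 / ε) ^ C := by
  set U := (n : ℝ) + m + (k' + 1 : ℕ) + 1 / δ + 1 / ε
  have hn' : (1 : ℝ) ≤ n := by exact_mod_cast hn
  have hm' : (1 : ℝ) ≤ m := by exact_mod_cast hm
  have hk' : (0 : ℝ) ≤ k' := Nat.cast_nonneg _
  have hδ' : 0 < 1 / δ := by positivity
  have hε' : 0 < 1 / ε := by positivity
  have hU : U = (n : ℝ) + m + (k' + 1) + 1 / δ + 1 / ε := by simp [U]
  have hU1 : 1 ≤ U := by linarith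
  have hnU : (n : ℝ) ≤ U := by linarith
  have hmU : (m : ℝ) ≤ U := by linarith
  have hkU : (k' : ℝ) + 1 ≤ U := by linarith
  have hDU : (⌈1 / δ⌉₊ : ℝ) ≤ U := by
    have := Nat.ceil_lt_add_one hδ'.le
    linarith
  have hEU : (⌈1 / ε⌉₊ : ℝ) ≤ U := by
    have := Nat.ceil_lt_add_one hε'.le
    linarith
  have hMU : (M : ℝ) ≤ 4 * U ^ 2 := by
    have h1 : Real.sqrt σ ≤ n := by
      rw [Real.sqrt_le_left (by positivity)]
      have : (σ : ℝ) ≤ n := by exact_mod_cast hσ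
      nlinarith
    have h2 := Nat.ceil_lt_add_one (a := 3 * Real.sqrt (σ : ℝ) * (m : ℝ)) (by positivity)
    rw [← hM] at h2
    have h3 : 3 * Real.sqrt (σ : ℝ) * (m : ℝ) ≤ 3 * U * U := by
      have := h1.trans hnU
      gcongr
    nlinarith
  have hknU : ((k' : ℝ) + 1) * n ≤ U ^ 2 := by
    rw [pow_two]; exact mul_le_mul hkU hnU (by positivity) (by positivity)
  have hp : ∀ a b : ℕ, a ≤ b → U ^ a ≤ U ^ b := fun a b h => pow_le_pow_right₀ hU1 h
  have htrial : (trialTime n m k' M : ℝ) ≤ 2000 * U ^ 3 := by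
    unfold trialTime
    push_cast
    have h1 : (M : ℝ) * (40 * n + 80) ≤ 4 * U ^ 2 * (120 * U) :=
      mul_le_mul hMU (by linarith) (by positivity) (by positivity)
    have h2 : (M : ℝ) * (15 * n + 20) ≤ 4 * U ^ 2 * (35 * U) :=
      mul_le_mul hMU (by linarith) (by positivity) (by positivity)
    have h3 : (m : ℝ) * (60 * ((k' + 1) * n) + 8 * n + 6 * k' + 120) ≤ U * (194 * U ^ 2) := by
      have := hp 1 2 (by norm_num)
      have := hp 0 2 (by norm_num)
      refine mul_le_mul hmU ?_ (by positivity) (by positivity)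
      simp only [pow_one, pow_zero] at *
      linarith
    have h4 := hp 1 3 (by norm_num)
    have h5 := hp 2 3 (by norm_num)
    have h6 := hp 0 3 (by norm_num)
    simp only [pow_one, pow_zero] at h4 h6
    have e1 : 4 * U ^ 2 * (120 * U) = 480 * U ^ 3 := by ring
    have e2 : 4 * U ^ 2 * (35 * U) = 140 * U ^ 3 := by ring
    have e3 : U * (194 * U ^ 2) = 194 * U ^ 3 := by ring
    linarith
  have hloop : (128 * (⌈1 / δ⌉₊ : ℝ) * (⌈1 / ε⌉₊ : ℝ)) * ((trialTime n m k' M : ℝ) + 7) ≤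
      (128 * U * U) * (2007 * U ^ 3) := by
    have h6 := hp 0 3 (by norm_num)
    simp only [pow_zero] at h6
    refine mul_le_mul ?_ (by linarith) (by positivity) (by positivity)
    gcongr
  unfold reductionTime
  push_cast
  have h1 := hp 5 C (by omega)
  have h2 := hp 1 5 (by norm_num)
  have h3 := hp 0 5 (by norm_num)
  rw [pow_one] at h2
  rw [pow_zero] at h3
  have e1 : (128 * U * U) * (2007 * U ^ 3) = 256896 * U ^ 5 := by ring
  have hC' : (300000 : ℝ) ≤ C := by exact_mod_cast hC
  have h4 : 300000 * U ^ 5 ≤ C * U ^ C := mul_le_mul hC' h1 (by positivity) (by positivity)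
  linarith

end

end SparseLPN

end

theorem mainTheorem7 :
    ∃ (P : SparseLPN.Prog) (C : ℕ),
      ∀ (m n k σ M : ℕ) (ε δ η : ℝ) (hσn : σ ≤ n),
        0 < m → 0 < n → 0 < k → 0 < σ →
        max (48 * ((n : ℝ) ^ 3 / (σ : ℝ) ^ 2)) (1200 * (n : ℝ)) ≤ (m : ℝ) →
        M = ⌈3 * Real.sqrt (σ : ℝ) * (m : ℝ)⌉₊ →
        0 < ε →
        6 * ((1 : ℝ) / 2 ^ (2 * n - 1)) < δ →
        0 < η → η < 1 / 8 →
        192 / δ * Real.log (16 / ε) < (k : ℝ) →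
        (k : ℝ) < 2 ^ (2 * n - 2) * ε →
        ∃ T : ℕ,
          (T : ℝ) ≤ C * ((n : ℝ) + m + k + 1 / δ + 1 / ε) ^ C ∧
          ∀ O : SparseLPN.Solver m (k * n),
            SparseLPN.HaltsWithin P [n, m, k, σ, M, ⌈1 / δ⌉₊, ⌈1 / ε⌉₊] M n η O T ∧
            (ε ≤ SparseLPN.successProb
                (SparseLPN.exactRow (k * n) (k * σ) (Nat.mul_le_mul_left k hσn))
                ((1 - (1 - 2 * η) ^ k) / 2) O →
              1 - δ ≤ SparseLPN.successProb (SparseLPN.approxRow n σ) η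
                (SparseLPN.programSolver P [n, m, k, σ, M, ⌈1 / δ⌉₊, ⌈1 / ε⌉₊] M n η O T)) := by
  -- One constant serves as coefficient and as exponent; only `300000 ≤ C` matters.
  obtain ⟨C, hC⟩ : ∃ C : ℕ, 300000 ≤ C := ⟨300000, le_rfl⟩
  refine ⟨SparseLPN.reduction, C, ?_⟩
  intro m n k σ M ε δ η hσn hm hn hk h0 hmax hM hε hδ hη0 hη hk1 hk2
  obtain ⟨k', rfl⟩ : ∃ k', k = k' + 1 := ⟨k - 1, by omega⟩
  have hδ0 : 0 < δ := lt_trans (by positivity) hδ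
  refine ⟨SparseLPN.reductionTime n m k' M ⌈1 / δ⌉₊ ⌈1 / ε⌉₊,
    SparseLPN.reductionTime_le hC hm hn h0 hσn hM hε hδ0, fun O =>
      ⟨SparseLPN.reduction_halts O hσn η _ _, fun hO => ?_⟩⟩
  -- For `δ ≥ 1` the claimed success probability is not positive and nothing has to be shown.
  rcases le_or_gt 1 δ with hδ1 | hδ1
  · exact le_trans (by linarith) ENNReal.toReal_nonneg
  · exact SparseLPN.reduction_solves hσn hn h0 hmax hM hε hδ hδ1 hη0 hη hk1 hk2 O hO
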